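/- A graph $\Gamma$ consists of a finite set $H(\Gamma)$ of half-edges, a finite set $V(\Gamma)$ of vertices, a map assigning to each half-edge its vertex, and a symmetric adjacency relation between distinct half-edges for which each half-edge is adjacent to at most one other. Non-adjacent half-edges are called external edges (set $Ex(\Gamma)$), pairs of adjacent ones internal edges (set $Int(\Gamma)$). A labeled ($\phi^3$, one-particle irreducible) Feynman graph is a graph, possibly disconnected or empty, with named half-edges, in which every vertex has exactly three half-edges and every connected component has $2$ or $3$ external edges, contains at least one loop ($\dim H_1>0$), and remains connected when any one internal edge is removed. Isomorphisms are pairs of bijections of vertices and half-edges preserving all incidences; an unlabeled graph is an isomorphism class. A subgraph $\gamma\subset\Gamma$ is a Feynman graph with $V(\gamma)\subset V(\Gamma)$, $H(\gamma)$ the set of all half-edges of $\Gamma$ at the vertices of $\gamma$, and $Int(\gamma)\subset Int(\Gamma)$. The quotient $\Gamma/\gamma$ is obtained by contracting each connected component $c$ of $\gamma$: if $c$ is a connected component of $\Gamma$ it is deleted; otherwise, if $c$ has three external edges it is replaced by a trivalent vertex, and if it has two, it is removed and the two half-edges to which it was attached are joined. Then $\Gamma/\gamma$ is again a Feynman graph,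 and so is the disjoint union $\Gamma\oplus\Gamma'$. A morphism $\Gamma_1\to\Gamma_2$ is a triple $(\gamma_1,\gamma_2,f)$ with $\gamma_i\subset\Gamma_i$ subgraphs and $f:\Gamma_1/\gamma_1\cong\gamma_2$ an isomorphism; its kernel is $\gamma_1$ and its image $\gamma_2$. A short exact sequence $\emptyset\to M\to L\to N\to\emptyset$ is a morphism $M\to L$ with empty kernel and a morphism $L\to N$ with image $N$ such that the image of the first is the kernel of the second. Let $I(LFG)$ be the set of isomorphism classes of labeled Feynman graphs, and let $\mathcal H_{LFG}$ be the $\mathbb Q$-vector space of finitely supported functions $I(LFG)\to\mathbb Q$. Let $\mathfrak n_{LFG}$ be the $\mathbb Q$-vector space with basis the connected non-empty unlabeled Feynman graphs. For connected $\Gamma_1,\Gamma_2$ let $$\Gamma_1\star\Gamma_2=\sum_{v\in V(\Gamma_2),\ f:Ex(\Gamma_1)\cong H(v)}\Gamma_2\circ_{v,f}\Gamma_1\ +\sum_{e\in Int(\Gamma_2),\ f:Ex(\Gamma_1)\cong e}\Gamma_2\circ_{e,f}\Gamma_1 ,$$ where $f$ runs over bijections (so that only the first sum contributes if $\Gamma_1$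 has three external edges, and only the second if it has two), $H(v)$ is the set of half-edges at $v$, $\Gamma_2\circ_{v,f}\Gamma_1$ is obtained by replacing $v$ by $\Gamma_1$, identifying external edges of $\Gamma_1$ with half-edges at $v$ along $f$, and $\Gamma_2\circ_{e,f}\Gamma_1$ by cutting $e$ and joining the external edges of $\Gamma_1$ to the two halves of $e$ along $f$. These insertions are again connected Feynman graphs. **Theorem.** The bracket $[\Gamma_1,\Gamma_2]=\Gamma_1\star\Gamma_2-\Gamma_2\star\Gamma_1$ makes $\mathfrak n_{LFG}$ a Lie algebra over $\mathbb Q$. The product and coproduct $$(f\times g)(\Gamma)=\sum_{\gamma\subset\Gamma}f(\gamma)\,g(\Gamma/\gamma),\qquad \Delta(f)(M,N)=f(M\oplus N)$$ make $\mathcal H_{LFG}$ an associative Hopf algebra over $\mathbb Q$. For characteristic functions of isomorphism classes, $$(\delta_M\times\delta_N)(L)=\frac{\#\{\text{short exact sequences }\emptyset\to M\to L\to N\to\emptyset\}}{|\mathrm{Aut}(M)|\,|\mathrm{Aut}(N)|}.$$ Finally, $\mathcal H_{LFG}$ is isomorphic, as a Hopf algebra, to the universal enveloping algebra $U(\mathfrak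 n_{LFG})$, in which the elements of $\mathfrak n_{LFG}$ are primitive. -/

import Mathlib

open scoped TensorProduct

/-! ### Graphs made of half-edges -/

/-- The raw data of a finite graph: half-edges, vertices, the vertex of each half-edge, and the
half-edge/half-edge adjacency relation.  The elements of the set `H` are the names (labels) of the
half-edges, so a term of this type is a labeled graph; an unlabeled graph is an isomorphism class.
-/
structure PreGraph : Type 1 where
  H : Type
  V : Type
  finite_H : Finite H
  finite_V : Finite V
  vert : H → V
  Adj : H → H → Prop

namespace PreGraph

attribute [instance] PreGraph.finite_H PreGraph.finite_V

/-- The graph axioms: adjacency is symmetric, and each half-edge is adjacent to at most one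
other half-edge. -/
structure IsGraph (Γ : PreGraph) : Prop where
  symm : ∀ a b, Γ.Adj a b → Γ.Adj b a
  irrefl : ∀ a, ¬ Γ.Adj a a
  unique : ∀ a b c, Γ.Adj a b → Γ.Adj a c → b = c

/-- A half-edge which is not adjacent to another half-edge. -/
def IsExternal (Γ : PreGraph) (h : Γ.H) : Prop := ∀ k, ¬ Γ.Adj h k

/-- The set of external edges. -/
abbrev Ex (Γ : PreGraph) : Type := {h : Γ.H // Γ.IsExternal h}

/-- The set of internal edges: pairs of adjacent half-edges. -/
abbrev IntEdge (Γ : PreGraph) : Type := {e : Set Γ.H // ∃ a b, Γ.Adj a b ∧ e = {a, b}}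

/-- Two vertices are joined by a path whose steps are the internal edges `{a, b}` with `R a b`. -/
def Joined (Γ : PreGraph) (R : Γ.H → Γ.H → Prop) : Γ.V → Γ.V → Prop :=
  Relation.EqvGen (fun v w => ∃ a b, R a b ∧ Γ.vert a = v ∧ Γ.vert b = w)

/-- The set of connected components. -/
def Component (Γ : PreGraph) : Type :=
  Quotient (⟨Γ.Joined Γ.Adj, Relation.EqvGen.is_equivalence _⟩ : Setoid Γ.V)

/-- The connected component of a vertex. -/
def comp (Γ : PreGraph) (v : Γ.V) : Γ.Component := Quotient.mk _ v

/-- The number of external edges of a connected component. -/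
noncomputable def legs (Γ : PreGraph) (C : Γ.Component) : ℕ :=
  Nat.card {h : Γ.Ex // Γ.comp (Γ.vert h.1) = C}

/-- The dimension of the first rational homology of a connected component,
i.e. (number of internal edges) - (number of vertices) + 1. -/
noncomputable def loopNumber (Γ : PreGraph) (C : Γ.Component) : ℤ :=
  (Nat.card {e : Γ.IntEdge // ∀ h ∈ e.1, Γ.comp (Γ.vert h) = C} : ℤ)
    - Nat.card {v : Γ.V // Γ.comp v = C} + 1

/-- A `φ³` Feynman graph (possibly disconnected, possibly empty): trivalent, and each connected
component has two or three external edges, is one-particle irreducible and contains a loop. -/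
structure IsFeynman (Γ : PreGraph) : Prop extends IsGraph Γ where
  trivalent : ∀ v, Nat.card {h : Γ.H // Γ.vert h = v} = 3
  legs_eq : ∀ C, Γ.legs C = 2 ∨ Γ.legs C = 3
  /-- Removing the internal edge `{a, b}` disconnects no component. -/
  onePI : ∀ a b, Γ.Adj a b → ∀ v w, Γ.Joined Γ.Adj v w →
    Γ.Joined (fun x y => Γ.Adj x y ∧ x ≠ a ∧ x ≠ b) v w
  loop : ∀ C, 0 < Γ.loopNumber C

/-- Connected (in particular non-empty) graphs. -/
def IsConnected (Γ : PreGraph) : Prop := Nonempty Γ.V ∧ ∀ v w, Γ.Joined Γ.Adj v w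

/-- Isomorphisms: bijections on vertices and on half-edges that respect all incidences. -/
structure Iso (Γ Γ' : PreGraph) where
  eV : Γ.V ≃ Γ'.V
  eH : Γ.H ≃ Γ'.H
  vert_eq : ∀ h, Γ'.vert (eH h) = eV (Γ.vert h)
  adj_iff : ∀ a b, Γ'.Adj (eH a) (eH b) ↔ Γ.Adj a b

def Iso.refl (Γ : PreGraph) : Iso Γ Γ :=
  ⟨Equiv.refl _, Equiv.refl _, fun _ => rfl, fun _ _ => Iff.rfl⟩

def Iso.symm {Γ Γ' : PreGraph} (e : Iso Γ Γ') : Iso Γ' Γ where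
  eV := e.eV.symm
  eH := e.eH.symm
  vert_eq h := by
    rw [Equiv.eq_symm_apply, ← e.vert_eq, Equiv.apply_symm_apply]
  adj_iff a b := by
    rw [← e.adj_iff, Equiv.apply_symm_apply, Equiv.apply_symm_apply]

def Iso.trans {Γ Γ' Γ'' : PreGraph} (e : Iso Γ Γ') (e' : Iso Γ' Γ'') : Iso Γ Γ'' where
  eV := e.eV.trans e'.eV
  eH := e.eH.trans e'.eH
  vert_eq h := by simp [e.vert_eq, e'.vert_eq]
  adj_iff a b := by simp [e.adj_iff, e'.adj_iff]

/-! ### Subgraphs -/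

/-- A set of vertices and a set of internal edges of `Γ` between them. -/
structure PreSubgraph (Γ : PreGraph) where
  verts : Set Γ.V
  adj : Γ.H → Γ.H → Prop
  adj_le : ∀ a b, adj a b → Γ.Adj a b ∧ Γ.vert a ∈ verts ∧ Γ.vert b ∈ verts

/-- The graph with vertices `γ.verts`, all half-edges of `Γ` at these vertices, and the adjacencies
`γ.adj`. -/
def PreSubgraph.toGraph {Γ : PreGraph} (γ : Γ.PreSubgraph) : PreGraph where
  H := {h : Γ.H // Γ.vert h ∈ γ.verts}
  V := {v : Γ.V // v ∈ γ.verts}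
  finite_H := inferInstance
  finite_V := inferInstance
  vert h := ⟨Γ.vert h.1, h.2⟩
  Adj a b := γ.adj a.1 b.1

/-- A subgraph of `Γ`: a Feynman graph with `V(γ) ⊆ V(Γ)` and `H(γ) ⊆ H(Γ)` containing all
half-edges incident to its vertices, each of its internal edges being one of `Γ`.  Two different
components of `γ` may be adjacent in `Γ`; the halves of an edge between them are then external
edges of `γ`. -/
abbrev Subgraph (Γ : PreGraph) : Type := {γ : Γ.PreSubgraph // γ.toGraph.IsFeynman}

namespace Subgraph

variable {Γ : PreGraph}

/-- The subgraph, as a graph. -/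
def toGraph (γ : Γ.Subgraph) : PreGraph := γ.1.toGraph

/-- The inclusion `H(γ) ⊆ H(Γ)`. -/
def val (γ : Γ.Subgraph) (h : γ.toGraph.H) : Γ.H := h.1

instance : Finite Γ.Subgraph := by
  refine Finite.of_injective
    (fun γ : Γ.Subgraph => ((γ.1.verts, γ.1.adj) : Set Γ.V × (Γ.H → Γ.H → Prop))) ?_
  rintro ⟨⟨v, a, h⟩, hf⟩ ⟨⟨v', a', h'⟩, hf'⟩ heq
  simp only [Prod.mk.injEq] at heq
  obtain ⟨rfl, rfl⟩ := heq
  rfl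

/-- The empty subgraph. -/
def IsBot (γ : Γ.Subgraph) : Prop := γ.1.verts = ∅

/-- The subgraph `Γ ⊆ Γ`. -/
def IsTop (γ : Γ.Subgraph) : Prop := γ.1.verts = Set.univ ∧ γ.1.adj = Γ.Adj

/-- A component of `γ` is whole if it is a connected component of `Γ`, i.e. if its external edges
are external edges of `Γ`. -/
def IsWhole (γ : Γ.Subgraph) (C : γ.toGraph.Component) : Prop :=
  ∀ h : γ.toGraph.Ex, γ.toGraph.comp (γ.toGraph.vert h.1) = C → Γ.IsExternal (γ.val h.1)

/-- Components of `γ` which the quotient replaces by a trivalent vertex: those with three external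
edges, unless they are connected components of `Γ`. -/
def BecomesVertex (γ : Γ.Subgraph) (C : γ.toGraph.Component) : Prop :=
  γ.toGraph.legs C = 3 ∧ ¬ γ.IsWhole C

/-- `a` and `b` are the two external edges of a component of `γ` with two external edges. -/
def Bridged (γ : Γ.Subgraph) (a b : Γ.H) : Prop :=
  ∃ a' b' : γ.toGraph.Ex, γ.val a'.1 = a ∧ γ.val b'.1 = b ∧ a' ≠ b' ∧
    γ.toGraph.comp (γ.toGraph.vert a'.1) = γ.toGraph.comp (γ.toGraph.vert b'.1) ∧
    γ.toGraph.legs (γ.toGraph.comp (γ.toGraph.vert a'.1)) = 2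

/-- The two half-edges are connected by a chain that alternates between edges of `Γ` outside `γ` and
passages through components of `γ` with two external edges. -/
def Linked (γ : Γ.Subgraph) : Γ.H → Γ.H → Prop :=
  Relation.EqvGen (fun a b => (Γ.Adj a b ∧ ¬ γ.1.adj a b) ∨ γ.Bridged a b)

/-- The half-edges of `Γ / γ`: those of `Γ` outside `γ`, and the external edges of the components
which are replaced by a vertex. -/
abbrev QuotH (γ : Γ.Subgraph) : Type :=
  {h : Γ.H // Γ.vert h ∉ γ.1.verts} ⊕
    {h : γ.toGraph.Ex // γ.BecomesVertex (γ.toGraph.comp (γ.toGraph.vert h.1))}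

/-- The half-edge of `Γ` underlying a half-edge of `Γ / γ`. -/
def QuotH.under {γ : Γ.Subgraph} : γ.QuotH → Γ.H :=
  Sum.elim (fun h => h.1) (fun h => γ.val h.1.1)

end Subgraph

/-- The quotient graph `Γ / γ`, contracting each connected component of `γ`.  Components with three
external edges become vertices, those with two external edges are removed and the two half-edges
to which they were attached are joined; a component of `γ` which is a connected
component of `Γ` is deleted. -/
def quotient (Γ : PreGraph) (γ : Γ.Subgraph) : PreGraph where
  H := γ.QuotH
  V := {v : Γ.V // v ∉ γ.1.verts} ⊕ {C : γ.toGraph.Component // γ.BecomesVertex C}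
  finite_H := inferInstance
  finite_V := by
    have : Finite γ.toGraph.Component := Quotient.finite _
    infer_instance
  vert := Sum.map (fun h => ⟨Γ.vert h.1, h.2⟩) (fun h => ⟨_, h.2⟩)
  Adj a b := a ≠ b ∧ γ.Linked a.under b.under

/-- The disjoint union of graphs. -/
def sum (Γ Γ' : PreGraph) : PreGraph where
  H := Γ.H ⊕ Γ'.H
  V := Γ.V ⊕ Γ'.V
  finite_H := inferInstance
  finite_V := inferInstance
  vert := Sum.map Γ.vert Γ'.vert
  Adj := Sum.LiftRel Γ.Adj Γ'.Adj

/-! ### Insertion of graphs -/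

open Classical in
/-- `Γ₂ ∘_{v,f} Γ₁`: replace the vertex `v` of `Γ₂` by `Γ₁`, the external edges of `Γ₁` being
identified with the half-edges at `v` along `f`. -/
noncomputable def insertVertex (Γ₂ Γ₁ : PreGraph) (v : Γ₂.V)
    (f : Γ₁.Ex ≃ {h : Γ₂.H // Γ₂.vert h = v}) : PreGraph where
  H := Γ₂.H ⊕ {h : Γ₁.H // ¬ Γ₁.IsExternal h}
  V := {w : Γ₂.V // w ≠ v} ⊕ Γ₁.V
  finite_H := inferInstance
  finite_V := inferInstance
  vert
    | .inl a => if ha : Γ₂.vert a = v then .inr (Γ₁.vert (f.symm ⟨a, ha⟩).1)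
        else .inl ⟨Γ₂.vert a, ha⟩
    | .inr h => .inr (Γ₁.vert h.1)
  Adj := Sum.LiftRel Γ₂.Adj (fun a b => Γ₁.Adj a.1 b.1)

/-- `Γ₂ ∘_{e,f} Γ₁`: cut the internal edge `e` of `Γ₂` and join the external edges of `Γ₁` to the two
halves of `e` along `f`. -/
def insertEdge (Γ₂ Γ₁ : PreGraph) (e : Γ₂.IntEdge) (f : Γ₁.Ex ≃ {h : Γ₂.H // h ∈ e.1}) :
    PreGraph where
  H := Γ₂.H ⊕ Γ₁.H
  V := Γ₂.V ⊕ Γ₁.V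
  finite_H := inferInstance
  finite_V := inferInstance
  vert := Sum.map Γ₂.vert Γ₁.vert
  Adj
    | .inl a, .inl b => Γ₂.Adj a b ∧ ¬ (a ∈ e.1 ∧ b ∈ e.1)
    | .inr x, .inr y => Γ₁.Adj x y
    | .inl a, .inr x => ∃ hx : Γ₁.IsExternal x, (f ⟨x, hx⟩).1 = a
    | .inr x, .inl a => ∃ hx : Γ₁.IsExternal x, (f ⟨x, hx⟩).1 = a

end PreGraph

/-! ### Labeled Feynman graphs, morphisms, isomorphism classes -/

/-- Labeled Feynman graphs, including the empty graph. -/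
abbrev LFG : Type 1 := {Γ : PreGraph // Γ.IsFeynman}

/-- Connected labeled Feynman graphs. -/
abbrev ConnLFG : Type 1 := {Γ : PreGraph // Γ.IsFeynman ∧ Γ.IsConnected}

/-- Isomorphism of graphs satisfying `P`. -/
def isoSetoid (P : PreGraph → Prop) : Setoid {Γ : PreGraph // P Γ} where
  r Γ Γ' := Nonempty (PreGraph.Iso Γ.1 Γ'.1)
  iseqv :=
    ⟨fun Γ => ⟨.refl Γ.1⟩, fun ⟨e⟩ => ⟨e.symm⟩, fun ⟨e⟩ ⟨e'⟩ => ⟨e.trans e'⟩⟩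

/-- Isomorphism classes of graphs satisfying `P`. -/
def IsoClass (P : PreGraph → Prop) : Type 1 := Quotient (isoSetoid P)

/-- The set of isomorphism classes of labeled Feynman graphs. -/
abbrev LFGClass : Type 1 := IsoClass PreGraph.IsFeynman

/-- The set of connected unlabeled Feynman graphs. -/
abbrev ConnClass : Type 1 := IsoClass (fun Γ => Γ.IsFeynman ∧ Γ.IsConnected)

/-- The isomorphism class of a labeled Feynman graph. -/
def LFG.cls (Γ : LFG) : LFGClass := Quotient.mk (isoSetoid PreGraph.IsFeynman) Γ

/-- The unlabeled graph underlying a connected labeled Feynman graph. -/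
def ConnLFG.cls (Γ : ConnLFG) : ConnClass :=
  Quotient.mk (isoSetoid (fun Γ => Γ.IsFeynman ∧ Γ.IsConnected)) Γ

/-- Morphisms `Γ₁ → Γ₂`: triples `(γ₁, γ₂, f)` of subgraphs `γᵢ ⊆ Γᵢ` and an isomorphism
`f : Γ₁ / γ₁ ≅ γ₂`. -/
structure LFG.Hom (Γ₁ Γ₂ : LFG) where
  ker : Γ₁.1.Subgraph
  im : Γ₂.1.Subgraph
  iso : PreGraph.Iso (Γ₁.1.quotient ker) im.toGraph

/-- Short exact sequences `∅ → M → L → N → ∅`: a morphism with empty kernel, followed by one with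
full image, the image of the first being the kernel of the second. -/
def LFG.ShortExact (M L N : LFG) : Type :=
  {p : LFG.Hom M L × LFG.Hom L N // p.1.ker.IsBot ∧ p.2.im.IsTop ∧ p.1.im = p.2.ker}

/-! ### The two vector spaces -/

/-- The underlying vector space of the Ringel-Hall algebra: rational functions on the set of
isomorphism classes, with finite support. -/
abbrev HallSpace : Type 1 := LFGClass →₀ ℚ

/-- The vector space spanned by connected unlabeled Feynman graphs. -/
abbrev GraphSpace : Type 1 := ConnClass →₀ ℚ

/-- The characteristic function of the isomorphism class of `Γ`. -/
noncomputable def LFG.delta (Γ : LFG) : HallSpace := Finsupp.single Γ.cls 1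

/-- The basis vector of a connected graph. -/
noncomputable def ConnLFG.basis (Γ : ConnLFG) : GraphSpace := Finsupp.single Γ.cls 1

/-- The value of an element of `HallSpace ⊗ HallSpace`, seen as a finitely supported function of two
variables, at a pair of isomorphism classes: `(f ⊗ g)(M, N) = f(M) g(N)`. -/
noncomputable def evalPair (M N : LFGClass) : HallSpace ⊗[ℚ] HallSpace →ₗ[ℚ] ℚ :=
  LinearMap.mul' ℚ ℚ ∘ₗ TensorProduct.map (Finsupp.lapply M) (Finsupp.lapply N)

/-- Insertions of connected Feynman graphs are connected Feynman graphs. -/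
structure InsertionClosed : Prop where
  vertex : ∀ (Γ₂ Γ₁ : ConnLFG) (v : Γ₂.1.V) (f : Γ₁.1.Ex ≃ {h : Γ₂.1.H // Γ₂.1.vert h = v}),
    (Γ₂.1.insertVertex Γ₁.1 v f).IsFeynman ∧ (Γ₂.1.insertVertex Γ₁.1 v f).IsConnected
  edge : ∀ (Γ₂ Γ₁ : ConnLFG) (e : Γ₂.1.IntEdge) (f : Γ₁.1.Ex ≃ {h : Γ₂.1.H // h ∈ e.1}),
    (Γ₂.1.insertEdge Γ₁.1 e f).IsFeynman ∧ (Γ₂.1.insertEdge Γ₁.1 e f).IsConnected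

/-- The product `Γ₁ ⋆ Γ₂`: the sum of all insertions of `Γ₁` into `Γ₂`.  The first sum is empty unless
`Γ₁` has three external edges, the second one is empty unless it has two. -/
noncomputable def insertionProduct (hi : InsertionClosed) (Γ₁ Γ₂ : ConnLFG) : GraphSpace :=
  (∑ᶠ v : Γ₂.1.V, ∑ᶠ f : Γ₁.1.Ex ≃ {h : Γ₂.1.H // Γ₂.1.vert h = v},
      ConnLFG.basis ⟨Γ₂.1.insertVertex Γ₁.1 v f, hi.vertex Γ₂ Γ₁ v f⟩)
    + ∑ᶠ e : Γ₂.1.IntEdge, ∑ᶠ f : Γ₁.1.Ex ≃ {h : Γ₂.1.H // h ∈ e.1},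
      ConnLFG.basis ⟨Γ₂.1.insertEdge Γ₁.1 e f, hi.edge Γ₂ Γ₁ e f⟩

/-! ### The bialgebra structure of an enveloping algebra -/

namespace UniversalEnvelopingAlgebra

attribute [local instance 10000] LieRing.ofAssociativeRing

variable (R : Type*) (L : Type*) [CommRing R] [LieRing L] [LieAlgebra R L]

/-- `x ↦ x ⊗ 1 + 1 ⊗ x`, as a morphism of Lie algebras. -/
noncomputable def diag :
    L →ₗ⁅R⁆ UniversalEnvelopingAlgebra R L ⊗[R] UniversalEnvelopingAlgebra R L where
  toFun x := ι R x ⊗ₜ[R] 1 + 1 ⊗ₜ[R] ι R x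
  map_add' x y := by
    simp only [map_add, TensorProduct.add_tmul, TensorProduct.tmul_add]; abel
  map_smul' c x := by
    simp only [map_smul, TensorProduct.smul_tmul', TensorProduct.tmul_smul, smul_add,
      RingHom.id_apply]
  map_lie' {x y} := by
    simp only [LieHom.map_lie, LieRing.of_associative_ring_bracket, add_mul, mul_add,
      Algebra.TensorProduct.tmul_mul_tmul, one_mul, mul_one, TensorProduct.sub_tmul,
      TensorProduct.tmul_sub]
    abel

theorem lift_diag_ι (x : L) : lift R (diag R L) (ι R x) = ι R x ⊗ₜ[R] 1 + 1 ⊗ₜ[R] ι R x :=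
  lift_ι_apply R (diag R L) x

theorem lift_zero_ι (x : L) : lift R (0 : L →ₗ⁅R⁆ R) (ι R x) = 0 :=
  lift_ι_apply R (0 : L →ₗ⁅R⁆ R) x

/-- The standard bialgebra structure, for which the elements of `L` are primitive. -/
noncomputable instance : Bialgebra R (UniversalEnvelopingAlgebra R L) :=
  Bialgebra.ofAlgHom (lift R (diag R L)) (lift R (0 : L →ₗ⁅R⁆ R))
    (by
      refine hom_ext R (LieHom.ext fun x => ?_)
      simp only [LieHom.comp_apply, AlgHom.coe_toLieHom, AlgHom.comp_apply, lift_diag_ι, map_add,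
        Algebra.TensorProduct.map_tmul, map_one, AlgHom.id_apply, TensorProduct.add_tmul,
        TensorProduct.tmul_add, Algebra.TensorProduct.one_def]
      abel)
    (by
      refine hom_ext R (LieHom.ext fun x => ?_)
      simp [lift_diag_ι, lift_zero_ι, -ι_apply])
    (by
      refine hom_ext R (LieHom.ext fun x => ?_)
      simp [lift_diag_ι, lift_zero_ι, -ι_apply])

end UniversalEnvelopingAlgebra

/-! ### Half-edge calculus -/

/-! ### Equivalence closures and matchings. -/

namespace HalfEdge

/-! Everything is described by relations on the half-edges of one fixed graph. A subgraph is
determined by its edge relation `A`: its vertices are those at an edge of `A`, and every other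
vertex is an isolated component of `A` with three legs. For trivalent graphs with two or three legs
per component, the loop condition only says that each vertex is at an edge; the remaining axioms
(`Semi`) make sense for `A` on the whole vertex set.

The edges of a quotient are chains alternating between edges outside `A` and two-legged components
of `A`. Such chains live in the union of two matchings, so they are orbits of two involutions and
have at most two ends. One-particle irreducibility and the existence of legs ensure that a chain
entering a component of `A` from outside reaches a half-edge of the quotient (`Semi.good`). Hence
the axioms pass to quotients (`Model.semi`), and back from a subgraph and its quotient to the graph
(`Model.semi_of_quotient`); the latter also shows that insertions are Feynman graphs.

Subgraphs of Γ/γ' correspond to subgraphs γ containing γ', with (Γ/γ')/(γ/γ') isomorphic to Γ/γ. So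
both bracketings of a triple product are sums over flags γ' ⊆ γ ⊆ Γ (`splitSum_assoc`). Subgraphs of
a disjoint union are pairs of subgraphs, so the coproduct is multiplicative (`splitSum_add`). The
primitive functions are the combinations of characteristic functions of connected graphs.

For connected graphs, an insertion of Γ₁ into Γ₂ together with an isomorphism to L amounts to a
subgraph of L identified with Γ₁ whose quotient is identified with Γ₂ (`Fill.card_vertex`,
`Fill.card_edge`). Therefore Γ ↦ |Aut Γ| δ_Γ turns the insertion bracket into the commutator of
primitive elements, and the Lie axioms are inherited.

Products of characteristic functions of connected graphs are triangular with respect to the number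
of components, so ordered monomials form a basis of the Hall algebra
(`linearIndependent_multisetProd`, `span_multisetProd`). The corresponding monomials span the
enveloping algebra, because commutators shorten products. Thus the canonical map from the enveloping
algebra of the primitive elements is bijective, and the Hopf structure is transported along it. -/

theorem eqvGen_closed {X : Type*} {r : X → X → Prop} {P : X → Prop}
    (h : ∀ a b, r a b → (P a ↔ P b)) {a b : X} (hab : Relation.EqvGen r a b) : P a ↔ P b := by
  induction hab with
  | rel x y hxy => exact h x y hxy
  | refl x => exact Iff.rfl
  | symm x y _ ih => exact ih.symm
  | trans x y z _ _ ih ih' => exact ih.trans ih'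

theorem eqvGen_map {X Y : Type*} {r : X → X → Prop} {s : Y → Y → Prop} (f : X → Y)
    (h : ∀ a b, r a b → Relation.EqvGen s (f a) (f b)) {a b : X} (hab : Relation.EqvGen r a b) :
    Relation.EqvGen s (f a) (f b) := by
  induction hab with
  | rel x y hxy => exact h x y hxy
  | refl x => exact .refl _
  | symm x y _ ih => exact ih.symm
  | trans x y z _ _ ih ih' => exact ih.trans _ _ _ ih'

/-- A symmetric irreflexive relation in which each element is related to at most one other. -/
structure Matching {X : Type*} (R : X → X → Prop) : Prop where
  symm : ∀ {a b}, R a b → R b a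
  irrefl : ∀ a, ¬ R a a
  unique : ∀ {a b c}, R a b → R a c → b = c

/-- The elements which are not related to any other. -/
def Free {X : Type*} (R : X → X → Prop) (h : X) : Prop := ∀ k, ¬ R h k

theorem not_free {X : Type*} {R : X → X → Prop} {h : X} : ¬ Free R h ↔ ∃ k, R h k := by
  simp [Free]

namespace Matching

variable {X : Type*} {R : X → X → Prop}

open Classical in
/-- The partner of an element, or the element itself when it is free. -/
noncomputable def partner (R : X → X → Prop) (x : X) : X := if h : ∃ y, R x y then h.choose else x

theorem partner_eq (hR : Matching R) {x y : X} (h : R x y) : partner R x = y := by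
  have h' : ∃ y, R x y := ⟨y, h⟩
  rw [partner, dif_pos h']
  exact hR.unique h'.choose_spec h

theorem partner_eq_self_iff (hR : Matching R) {x : X} : partner R x = x ↔ Free R x := by
  constructor
  · intro h y hy
    rw [hR.partner_eq hy] at h
    subst h
    exact hR.irrefl _ hy
  · intro h
    rw [partner, dif_neg]
    rintro ⟨y, hy⟩
    exact h y hy

theorem partner_partner (hR : Matching R) (x : X) : partner R (partner R x) = x := by
  by_cases h : Free R x
  · rw [hR.partner_eq_self_iff.2 h, hR.partner_eq_self_iff.2 h]
  · obtain ⟨y, hy⟩ := not_free.1 h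
    rw [hR.partner_eq hy, hR.partner_eq (hR.symm hy)]

/-- The involution exchanging partners. -/
noncomputable def perm (hR : Matching R) : Equiv.Perm X :=
  Function.Involutive.toPerm (partner R) hR.partner_partner

theorem perm_apply (hR : Matching R) (x : X) : hR.perm x = partner R x := rfl

theorem perm_mul_self (hR : Matching R) : hR.perm * hR.perm = 1 := by
  ext x
  exact hR.partner_partner x

end Matching

/-! ### Orbits of two involutions, and ends of alternating chains. -/

section Dihedral

variable {X : Type*} (α β : Equiv.Perm X)

/-- The dihedral relation: `β` conjugates `α * β` to its inverse. Along the rotation orbit of a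
fixed point of `β`, the involution `β` thus acts on exponents as `i ↦ -i`, and `α = (α * β) * β`
acts as `i ↦ 1 - i`. -/
theorem involution_zpow_right (hα : α * α = 1) (hβ : β * β = 1) {a : X} (ha : β a = a) (i : ℤ) :
    β (((α * β) ^ i) a) = ((α * β) ^ (-i)) a := by
  have h : SemiconjBy β (α * β) (α * β)⁻¹ := by
    rw [SemiconjBy, mul_inv_rev, eq_inv_of_mul_eq_one_left hα, eq_inv_of_mul_eq_one_left hβ]
    simp only [inv_inv, mul_assoc]
    rw [← eq_inv_of_mul_eq_one_left hα, ← eq_inv_of_mul_eq_one_left hβ]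
  have h' := h.zpow_right i
  have := congrArg (fun σ : Equiv.Perm X => σ a) h'.eq
  simp only [Equiv.Perm.mul_apply, ha, inv_zpow'] at this
  rw [← this]

theorem involution_zpow_left (hα : α * α = 1) (hβ : β * β = 1) {a : X} (ha : β a = a) (i : ℤ) :
    α (((α * β) ^ i) a) = ((α * β) ^ (1 - i)) a := by
  have h := involution_zpow_right α β hα hβ ha i
  rw [sub_eq_add_neg, zpow_add, zpow_one, Equiv.Perm.mul_apply, ← h, Equiv.Perm.mul_apply,
    ← Equiv.Perm.mul_apply β β, hβ]
  rfl

/-- Both reflections preserve the set of rotates of a fixed point, so its dihedral orbit is just its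
rotation orbit. -/
theorem exists_zpow_of_eqvGen (hα : α * α = 1) (hβ : β * β = 1) {a b : X} (ha : β a = a)
    (h : Relation.EqvGen (fun x y => α x = y ∨ β x = y) a b) : ∃ i : ℤ, ((α * β) ^ i) a = b := by
  refine (eqvGen_closed (P := fun x => ∃ i : ℤ, ((α * β) ^ i) a = x) ?_ h).1 ⟨0, by simp⟩
  have hα' : ∀ x, α (α x) = x := fun x => by rw [← Equiv.Perm.mul_apply, hα]; rfl
  have hβ' : ∀ x, β (β x) = x := fun x => by rw [← Equiv.Perm.mul_apply, hβ]; rfl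
  have key : ∀ x, (∃ i : ℤ, ((α * β) ^ i) a = x) →
      (∃ i : ℤ, ((α * β) ^ i) a = α x) ∧ ∃ i : ℤ, ((α * β) ^ i) a = β x := by
    rintro x ⟨i, rfl⟩
    exact ⟨⟨1 - i, (involution_zpow_left α β hα hβ ha i).symm⟩,
      ⟨-i, (involution_zpow_right α β hα hβ ha i).symm⟩⟩
  rintro x y (rfl | rfl)
  · refine ⟨fun h => (key x h).1, fun h => ?_⟩
    have := (key _ h).1
    rwa [hα'] at this
  · refine ⟨fun h => (key x h).2, fun h => ?_⟩
    have := (key _ h).2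
    rwa [hβ'] at this

theorem zpow_apply_eq_self_iff (σ : Equiv.Perm X) (a : X) (i : ℤ) :
    (σ ^ i) a = a ↔ (Function.minimalPeriod (σ • ·) a : ℤ) ∣ i := by
  rw [← MulAction.zpow_smul_eq_iff_minimalPeriod_dvd]
  rfl

theorem zpow_apply_eq_zpow_apply_iff (σ : Equiv.Perm X) (a : X) (i j : ℤ) :
    (σ ^ i) a = (σ ^ j) a ↔ (Function.minimalPeriod (σ • ·) a : ℤ) ∣ i - j := by
  rw [← zpow_apply_eq_self_iff, sub_eq_neg_add, zpow_add, Equiv.Perm.mul_apply, zpow_neg,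
    Equiv.Perm.inv_eq_iff_eq]

/-- Modulo `n` there is at most one nonzero element killed by 2: here `2 * i` and `2 * j` are odd
multiples of `n`. -/
theorem dvd_sub_of_dvd_two_mul {n i j : ℤ} (hi : n ∣ 2 * i) (hj : n ∣ 2 * j) (hi' : ¬ n ∣ i)
    (hj' : ¬ n ∣ j) : n ∣ i - j := by
  obtain ⟨s, hs⟩ := hi
  obtain ⟨t, ht⟩ := hj
  rcases Int.even_or_odd' s with ⟨s', rfl | rfl⟩
  · exact absurd ⟨s', by linarith⟩ hi'
  rcases Int.even_or_odd' t with ⟨t', rfl | rfl⟩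
  · exact absurd ⟨t', by linarith⟩ hj'
  exact ⟨s' - t', by linarith⟩

/-- The second hypothesis makes 2 invertible modulo `n`. -/
theorem dvd_of_dvd_two_mul_of_dvd {n i j : ℤ} (hi : n ∣ 2 * i) (hj : n ∣ 2 * j - 1) : n ∣ i := by
  obtain ⟨s, hs⟩ := hi
  obtain ⟨t, ht⟩ := hj
  exact ⟨j * s - t * i, by linear_combination j * hs - i * ht⟩

/-- An orbit of the group generated by two involutions contains at most two fixed points. -/
theorem three_fixed (hα : α * α = 1) (hβ : β * β = 1) {a b c : X} (ha : β a = a)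
    (hb : α b = b ∨ β b = b) (hc : α c = c ∨ β c = c)
    (hab : Relation.EqvGen (fun x y => α x = y ∨ β x = y) a b)
    (hac : Relation.EqvGen (fun x y => α x = y ∨ β x = y) a c) (h1 : a ≠ b) (h2 : a ≠ c) :
    b = c := by
  obtain ⟨i, rfl⟩ := exists_zpow_of_eqvGen α β hα hβ ha hab
  obtain ⟨j, rfl⟩ := exists_zpow_of_eqvGen α β hα hβ ha hac
  rw [involution_zpow_left α β hα hβ ha, involution_zpow_right α β hα hβ ha,
    zpow_apply_eq_zpow_apply_iff, zpow_apply_eq_zpow_apply_iff, ← dvd_neg] at hb hc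
  rw [ne_comm, Ne, zpow_apply_eq_self_iff] at h1 h2
  rw [zpow_apply_eq_zpow_apply_iff]
  -- Exponents matter modulo the period `n`. A point with exponent `i` is fixed by `α` when 2i = 1
  -- and by `β` when 2i = 0. Odd `n` admits a nonzero solution only of the first equation, even `n`
  -- only of the second, and in each case at most one.
  generalize (Function.minimalPeriod ((α * β) • ·) a : ℤ) = n at *
  rw [show -(1 - i - i) = 2 * i - 1 by ring, ← dvd_neg (b := -i - i),
    show -(-i - i) = 2 * i by ring] at hb
  rw [show -(1 - j - j) = 2 * j - 1 by ring, ← dvd_neg (b := -j - j),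
    show -(-j - j) = 2 * j by ring] at hc
  rcases hb with hb | hb <;> rcases hc with hc | hc
  · refine dvd_of_dvd_two_mul_of_dvd (j := i) ?_ hb
    have := dvd_sub hb hc
    rwa [show 2 * i - 1 - (2 * j - 1) = 2 * (i - j) by ring] at this
  · exact absurd (dvd_of_dvd_two_mul_of_dvd hc hb) h2
  · exact absurd (dvd_of_dvd_two_mul_of_dvd hb hc) h1
  · exact dvd_sub_of_dvd_two_mul hb hc h1 h2

/-- An orbit of the group generated by two involutions which contains one fixed point contains
another one. -/
theorem exists_fixed [Finite X] (hα : α * α = 1) (hβ : β * β = 1) {a : X} (ha : β a = a)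
    (ha' : α a ≠ a) :
    ∃ b, b ≠ a ∧ Relation.EqvGen (fun x y => α x = y ∨ β x = y) a b ∧
      ((α b = b ∧ β b ≠ b) ∨ β b = b) := by
  have horb : ∀ i : ℕ, Relation.EqvGen (fun x y => α x = y ∨ β x = y) a (((α * β) ^ (i : ℤ)) a) := by
    intro i
    induction i with
    | zero => exact .refl _
    | succ i ih =>
      refine ih.trans _ _ _ ?_
      rw [Nat.cast_succ, add_comm, zpow_add, zpow_one, Equiv.Perm.mul_apply]
      exact .trans _ (β (((α * β) ^ (i : ℤ)) a)) _ (.rel _ _ (.inr rfl)) (.rel _ _ (.inl rfl))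
  have hpos : 0 < Function.minimalPeriod ((α * β) • ·) a := by
    refine Function.minimalPeriod_pos_of_mem_periodicPts ?_
    exact Function.mk_mem_periodicPts (orderOf_pos (α * β)) (by
      rw [Function.IsPeriodicPt, Function.IsFixedPt, smul_iterate, pow_orderOf_eq_one]
      exact one_smul _ a)
  have hone : Function.minimalPeriod ((α * β) • ·) a ≠ 1 := by
    intro h
    have := (zpow_apply_eq_self_iff (α * β) a 1).2 (by rw [h]; rfl)
    rw [zpow_one, Equiv.Perm.mul_apply, ha] at this
    exact ha' this
  have hiff := zpow_apply_eq_self_iff (α * β) a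
  have hiff' := zpow_apply_eq_zpow_apply_iff (α * β) a
  generalize Function.minimalPeriod ((α * β) • ·) a = n at *
  -- The other fixed point is opposite to `a` on the orbit: exponent `m` for period `2 * m`, fixed
  -- by `β` since -m = m, and exponent `m + 1` for period `2 * m + 1`, fixed by `α` since 1 - (m +
  -- 1) = m + 1.
  rcases Nat.even_or_odd' n with ⟨m, rfl | rfl⟩
  · refine ⟨((α * β) ^ (m : ℤ)) a, ?_, horb m, .inr ?_⟩
    · rw [Ne, hiff]
      intro h
      have := Int.le_of_dvd (by omega) h
      omega
    · rw [involution_zpow_right α β hα hβ ha, hiff', ← dvd_neg]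
      exact ⟨1, by push_cast; ring⟩
  · refine ⟨((α * β) ^ ((m + 1 : ℕ) : ℤ)) a, ?_, horb (m + 1), .inl ⟨?_, ?_⟩⟩
    · rw [Ne, hiff]
      intro h
      have := Int.le_of_dvd (by omega) h
      omega
    · rw [involution_zpow_left α β hα hβ ha, hiff', ← dvd_neg]
      exact ⟨1, by push_cast; ring⟩
    · rw [involution_zpow_right α β hα hβ ha, Ne, hiff', ← dvd_neg]
      intro h
      have h1 : ((2 * m + 1 : ℕ) : ℤ) ∣ 1 := by
        have := dvd_sub h (dvd_refl _)
        push_cast at this ⊢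
        rwa [show (-(-((m : ℤ) + 1) - (m + 1)) - (2 * m + 1)) = 1 by ring] at this
      have := Int.le_of_dvd one_pos h1
      omega

/-- The involution of a matching moves an element to its partner or, if it is free, not at all; so
both relations have the same classes, and free elements are fixed points. -/
theorem eqvGen_perm {r s : X → X → Prop} (hr : Matching r) (hs : Matching s) {a b : X} :
    Relation.EqvGen (fun x y => hr.perm x = y ∨ hs.perm x = y) a b ↔
      Relation.EqvGen (fun x y => r x y ∨ s x y) a b := by
  have key : ∀ {r' : X → X → Prop} (hr' : Matching r') x, r' x (hr'.perm x) ∨ hr'.perm x = x := by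
    intro r' hr' x
    by_cases h : Free r' x
    · exact .inr (hr'.partner_eq_self_iff.2 h)
    · obtain ⟨y, hy⟩ := not_free.1 h
      left
      rw [hr'.perm_apply, hr'.partner_eq hy]
      exact hy
  constructor
  · refine eqvGen_map id ?_
    rintro x _ (rfl | rfl)
    · rcases key hr x with h | h
      · exact .rel _ _ (.inl h)
      · rw [h]; exact .refl _
    · rcases key hs x with h | h
      · exact .rel _ _ (.inr h)
      · rw [h]; exact .refl _
  · refine eqvGen_map id ?_
    rintro x y (h | h)
    · exact .rel _ _ (.inl (hr.partner_eq h))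
    · exact .rel _ _ (.inr (hs.partner_eq h))

/-- A connected component of the union of two matchings has at most two ends. -/
theorem three_ends {r s : X → X → Prop} (hr : Matching r) (hs : Matching s) {a b c : X}
    (ha : Free r a ∨ Free s a) (hb : Free r b ∨ Free s b) (hc : Free r c ∨ Free s c)
    (hab : Relation.EqvGen (fun x y => r x y ∨ s x y) a b)
    (hac : Relation.EqvGen (fun x y => r x y ∨ s x y) a c) (h1 : a ≠ b) (h2 : a ≠ c) : b = c := by
  rw [← hr.partner_eq_self_iff, ← hs.partner_eq_self_iff] at ha hb hc
  rw [← eqvGen_perm hr hs] at hab hac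
  rcases ha with ha | ha
  · have hsw : (fun x y => hr.perm x = y ∨ hs.perm x = y) =
        fun x y => hs.perm x = y ∨ hr.perm x = y := by
      ext x y; exact or_comm
    rw [hsw] at hab hac
    exact three_fixed _ _ hs.perm_mul_self hr.perm_mul_self ha hb.symm hc.symm hab hac h1 h2
  · exact three_fixed _ _ hr.perm_mul_self hs.perm_mul_self ha hb hc hab hac h1 h2

/-- A path in the union of two matchings does not end at an element free in the first one only. -/
theorem exists_end [Finite X] {r s : X → X → Prop} (hr : Matching r) (hs : Matching s) {a : X}
    (ha : Free s a) (ha' : ¬ Free r a)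
    (h : ∀ b, Relation.EqvGen (fun x y => r x y ∨ s x y) a b → ¬ Free s b → ¬ Free r b) :
    ∃ b, b ≠ a ∧ Relation.EqvGen (fun x y => r x y ∨ s x y) a b ∧ Free s b := by
  obtain ⟨b, hba, hab, hb⟩ := exists_fixed hr.perm hs.perm hr.perm_mul_self hs.perm_mul_self
    (hs.partner_eq_self_iff.2 ha) (fun h => ha' (hr.partner_eq_self_iff.1 h))
  rw [eqvGen_perm] at hab
  refine ⟨b, hba, hab, ?_⟩
  rcases hb with ⟨hb, hb'⟩ | hb
  · exact absurd (hr.partner_eq_self_iff.1 hb)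
      (h b hab fun h => hb' (hs.partner_eq_self_iff.2 h))
  · exact hs.partner_eq_self_iff.1 hb

end Dihedral

end HalfEdge

/-! ### Components, bridges and chains for edge relations on a fixed set of half-edges. -/

namespace HalfEdge

variable {H V : Type}

/-- The equivalence relation on vertices generated by the edges `{a, b}` with `R a b`. -/
def Joined (vert : H → V) (R : H → H → Prop) : V → V → Prop :=
  Relation.EqvGen (fun v w => ∃ a b, R a b ∧ vert a = v ∧ vert b = w)

namespace Joined

variable {vert : H → V} {R S : H → H → Prop}

theorem refl (v : V) : Joined vert R v v := Relation.EqvGen.refl v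

theorem symm {v w : V} (h : Joined vert R v w) : Joined vert R w v := Relation.EqvGen.symm _ _ h

theorem trans {u v w : V} (h : Joined vert R u v) (h' : Joined vert R v w) : Joined vert R u w :=
  Relation.EqvGen.trans _ _ _ h h'

theorem of_rel {a b : H} (h : R a b) : Joined vert R (vert a) (vert b) :=
  .rel _ _ ⟨a, b, h, rfl, rfl⟩

theorem of_eq {v w : V} (h : v = w) : Joined vert R v w := h ▸ refl v

theorem closed {P : V → Prop} (h : ∀ a b, R a b → (P (vert a) ↔ P (vert b))) {v w : V}
    (hvw : Joined vert R v w) : P v ↔ P w :=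
  eqvGen_closed (by rintro v w ⟨a, b, hab, rfl, rfl⟩; exact h a b hab) hvw

theorem bind (h : ∀ a b, R a b → Joined vert S (vert a) (vert b)) {v w : V}
    (hvw : Joined vert R v w) : Joined vert S v w :=
  eqvGen_map id (by rintro v w ⟨a, b, hab, rfl, rfl⟩; exact h a b hab) hvw

theorem mono (h : ∀ a b, R a b → S a b) {v w : V} (hvw : Joined vert R v w) : Joined vert S v w :=
  hvw.bind fun a b hab => of_rel (h a b hab)

end Joined

/-- The number of free half-edges in the component of a vertex. -/
noncomputable def legs (vert : H → V) (R : H → H → Prop) (v : V) : ℕ :=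
  Nat.card {h // Free R h ∧ Joined vert R (vert h) v}

theorem legs_congr {vert : H → V} {R : H → H → Prop} {v w : V} (h : Joined vert R v w) :
    legs vert R v = legs vert R w :=
  Nat.card_congr (Equiv.subtypeEquivRight fun _ =>
    and_congr_right fun _ => ⟨fun h' => h'.trans h, fun h' => h'.trans h.symm⟩)

/-- The two free half-edges of a component with two free half-edges. -/
def Bridge (vert : H → V) (A : H → H → Prop) (a b : H) : Prop :=
  a ≠ b ∧ Free A a ∧ Free A b ∧ Joined vert A (vert a) (vert b) ∧ legs vert A (vert a) = 2

/-- The free half-edges of components with three free half-edges. -/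
def End (vert : H → V) (A : H → H → Prop) (h : H) : Prop :=
  Free A h ∧ legs vert A (vert h) = 3

/-- Half-edges connected by a chain of edges of `B` outside `A` and of components of `A` with two
free half-edges. -/
def Linked (vert : H → V) (B A : H → H → Prop) : H → H → Prop :=
  Relation.EqvGen (fun a b => (B a b ∧ ¬ A a b) ∨ Bridge vert A a b)

/-- The axioms of Feynman graphs, where components without loops are allowed. -/
structure Semi (vert : H → V) (B : H → H → Prop) : Prop extends Matching B where
  tri : ∀ v, Nat.card {h // vert h = v} = 3
  legs_eq : ∀ v, legs vert B v = 2 ∨ legs vert B v = 3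
  onePI : ∀ a b, B a b → Joined vert (fun x y => B x y ∧ x ≠ a ∧ x ≠ b) (vert a) (vert b)

/-- Chains in `B` through the components of `A` never stop inside a component. -/
def Good (vert : H → V) (B A : H → H → Prop) : Prop :=
  ∀ a b, Bridge vert A a b → ¬ Free B a → ¬ Free B b ∧ ∃ k, End vert A k ∧ Linked vert B A a k

section Basic

variable {vert : H → V} {A B : H → H → Prop}

theorem Semi.exists_vert (h : Semi vert B) (v : V) : ∃ a, vert a = v := by
  have : Nonempty {h // vert h = v} := (Nat.card_pos_iff.1 (by rw [h.tri]; norm_num)).1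
  exact ⟨this.some.1, this.some.2⟩

theorem Free.mono (hle : ∀ a b, A a b → B a b) {h : H} (hh : Free B h) : Free A h :=
  fun k hk => hh k (hle _ _ hk)

theorem card_two_unique {P : H → Prop} (h : Nat.card {x // P x} = 2) {a b c : H} (ha : P a)
    (hb : P b) (hc : P c) (hab : a ≠ b) (hac : a ≠ c) : b = c := by
  by_contra hbc
  have : Finite {x // P x} := Nat.finite_of_card_ne_zero (by omega)
  have := Fintype.ofFinite {x // P x}
  classical
  rw [Nat.card_eq_fintype_card] at h
  have h3 : ({⟨a, ha⟩, ⟨b, hb⟩, ⟨c, hc⟩} : Finset {x // P x}).card = 3 := by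
    rw [Finset.card_eq_three]
    exact ⟨_, _, _, by simpa using hab, by simpa using hac, by simpa using hbc, rfl⟩
  have := Finset.card_le_univ ({⟨a, ha⟩, ⟨b, hb⟩, ⟨c, hc⟩} : Finset {x // P x})
  omega

theorem exists_ne_of_card_two {P : H → Prop} (h : Nat.card {x // P x} = 2) (a : H) :
    ∃ b, P b ∧ a ≠ b := by
  by_contra! hn
  have : Subsingleton {x // P x} := ⟨fun x y => Subtype.ext ((hn _ x.2).symm.trans (hn _ y.2))⟩
  have := Finite.card_le_one_iff_subsingleton.2 this
  omega

theorem Bridge.symm {a b : H} (h : Bridge vert A a b) : Bridge vert A b a :=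
  ⟨h.1.symm, h.2.2.1, h.2.1, h.2.2.2.1.symm, (legs_congr h.2.2.2.1).symm.trans h.2.2.2.2⟩

/-- A component with exactly two legs pairs these two and no others. So `Linked` is generated by two
matchings, edges of `B` outside `A` and bridges, and the results on alternating chains apply to it.
-/
theorem bridge_matching : Matching (Bridge vert A) where
  symm h := h.symm
  irrefl _ h := h.1 rfl
  unique h h' := card_two_unique h.2.2.2.2 ⟨h.2.1, .refl _⟩ ⟨h.2.2.1, h.2.2.2.1.symm⟩
    ⟨h'.2.2.1, h'.2.2.2.1.symm⟩ h.1 h'.1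

theorem End.free_bridge {h : H} (hh : End vert A h) : Free (Bridge vert A) h := by
  intro k hk
  have := hk.2.2.2.2
  rw [hh.2] at this
  omega

theorem End.of_joined {a b : H} (h : End vert A a) (hb : Free A b)
    (hab : Joined vert A (vert a) (vert b)) : End vert A b :=
  ⟨hb, (legs_congr hab).symm.trans h.2⟩

theorem end_or_bridge (hA : Semi vert A) {h : H} (hh : Free A h) :
    End vert A h ∨ ∃ k, Bridge vert A h k := by
  rcases hA.legs_eq (vert h) with h2 | h3
  · right
    obtain ⟨b, hb, hne⟩ := exists_ne_of_card_two h2 h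
    exact ⟨b, hne, hh, hb.1, hb.2.symm, h2⟩
  · exact .inl ⟨hh, h3⟩

theorem bridge_of_legs_two {a b : H} (h2 : legs vert A (vert a) = 2) (ha : Free A a) (hb : Free A b)
    (hab : Joined vert A (vert a) (vert b)) (hne : a ≠ b) : Bridge vert A a b :=
  ⟨hne, ha, hb, hab, h2⟩

theorem free_of_rel (hB : Matching B) (hle : ∀ a b, A a b → B a b) {a b : H} (h : B a b)
    (h' : ¬ A a b) : Free A a := by
  intro c hc
  rw [hB.unique (hle _ _ hc) h] at hc
  exact h' hc

theorem diff_matching (hB : Matching B) (hA : Matching A) : Matching (fun a b => B a b ∧ ¬ A a b) where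
  symm h := ⟨hB.symm h.1, fun h' => h.2 (hA.symm h')⟩
  irrefl _ h := hB.irrefl _ h.1
  unique h h' := hB.unique h.1 h'.1

namespace Linked

theorem refl (a : H) : Linked vert B A a a := Relation.EqvGen.refl a

theorem symm {a b : H} (h : Linked vert B A a b) : Linked vert B A b a := Relation.EqvGen.symm _ _ h

theorem trans {a b c : H} (h : Linked vert B A a b) (h' : Linked vert B A b c) : Linked vert B A a c :=
  Relation.EqvGen.trans _ _ _ h h'

theorem of_rel {a b : H} (h : B a b) (h' : ¬ A a b) : Linked vert B A a b := .rel _ _ (.inl ⟨h, h'⟩)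

theorem of_bridge {a b : H} (h : Bridge vert A a b) : Linked vert B A a b := .rel _ _ (.inr h)

theorem joined (hle : ∀ a b, A a b → B a b) {a b : H} (h : Linked vert B A a b) :
    Joined vert B (vert a) (vert b) := by
  induction h with
  | rel x y h =>
    rcases h with h | h
    · exact .of_rel h.1
    · exact h.2.2.2.1.mono hle
  | refl x => exact .refl _
  | symm x y _ ih => exact ih.symm
  | trans x y z _ _ ih ih' => exact ih.trans ih'

end Linked

/-- A leg of a three-legged component has no bridge, so it terminates its chain. -/
theorem linked_ends_unique (hB : Matching B) (hA : Matching A) {a b c : H} (ha : End vert A a)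
    (hb : End vert A b) (hc : End vert A c) (hab : Linked vert B A a b) (hac : Linked vert B A a c)
    (h1 : a ≠ b) (h2 : a ≠ c) : b = c :=
  three_ends (diff_matching hB hA) bridge_matching (.inr ha.free_bridge) (.inr hb.free_bridge)
    (.inr hc.free_bridge) hab hac h1 h2

/-- Such a half-edge is free in both matchings, so its chain is a single point. -/
theorem linked_eq_of_free {a b : H} (hB : Matching B) (ha : End vert A a) (haB : Free B a)
    (hab : Linked vert B A a b) : b = a := by
  refine (eqvGen_closed (P := fun x => x = a) ?_ hab).1 rfl
  rintro x y (⟨h, -⟩ | h)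
  · constructor
    · rintro rfl; exact absurd h (haB _)
    · rintro rfl; exact absurd (hB.symm h) (haB _)
  · constructor
    · rintro rfl; exact absurd h (ha.free_bridge _)
    · rintro rfl; exact absurd h.symm (ha.free_bridge _)

theorem Good.bridge_iff (hG : Good vert B A) {a b : H} (h : Bridge vert A a b) :
    Free B a ↔ Free B b := by
  constructor
  · intro ha
    by_contra hb
    exact (hG b a h.symm hb).1 ha
  · intro hb
    by_contra ha
    exact (hG a b h ha).1 hb

theorem Good.exists_end (hG : Good vert B A) (hA : Semi vert A) {a : H} (ha : Free A a)
    (haB : ¬ Free B a) : ∃ k, End vert A k ∧ Linked vert B A a k := by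
  rcases end_or_bridge hA ha with h | ⟨b, hb⟩
  · exact ⟨a, h, .refl _⟩
  · exact (hG a b hb haB).2

theorem linked_free_iff (hG : Good vert B A) (hB : Matching B) {a b : H}
    (hab : Linked vert B A a b) : Free B a ↔ Free B b := by
  refine eqvGen_closed (P := Free B) ?_ hab
  rintro x y (⟨h, -⟩ | h)
  · exact ⟨fun hx => absurd h (hx _), fun hy => absurd (hB.symm h) (hy _)⟩
  · exact hG.bridge_iff h

theorem linked_free_iff' (hB : Matching B) (hA : Matching A) (hle : ∀ a b, A a b → B a b) {a b : H}
    (hab : Linked vert B A a b) : Free A a ↔ Free A b := by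
  refine eqvGen_closed (P := Free A) ?_ hab
  rintro x y (⟨h, h'⟩ | h)
  · exact ⟨fun _ => free_of_rel hB hle (hB.symm h) fun h'' => h' (hA.symm h''),
      fun _ => free_of_rel hB hle h h'⟩
  · exact iff_of_true h.2.1 h.2.2.1

/-- Along the chain every half-edge is free in `A` and none is free in `B`, so each one has a
partner by an edge of `B` outside `A`. The chain can stop only for lack of a bridge, that is at an
`End`; by finiteness it has a second terminal point. -/
theorem exists_linked_end [Finite H] (hB : Matching B) (hA : Semi vert A)
    (hle : ∀ a b, A a b → B a b) (hG : Good vert B A) {a : H} (ha : End vert A a) (haB : ¬ Free B a) :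
    ∃ b, b ≠ a ∧ Linked vert B A a b ∧ End vert A b := by
  have hd : ∀ b, Linked vert B A a b → ¬ Free (fun a b => B a b ∧ ¬ A a b) b := by
    intro b hab
    rw [linked_free_iff hG hB hab] at haB
    obtain ⟨c, hc⟩ := not_free.1 haB
    have hb := (linked_free_iff' hB hA.toMatching hle hab).1 ha.1
    exact not_free.2 ⟨c, hc, hb c⟩
  obtain ⟨b, hba, hab, hb⟩ := exists_end (diff_matching hB hA.toMatching) bridge_matching ha.free_bridge
    (hd a (.refl _)) fun b hab _ => hd b hab
  refine ⟨b, hba, hab, ?_⟩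
  rcases end_or_bridge hA ((linked_free_iff' hB hA.toMatching hle hab).1 ha.1) with h | ⟨k, hk⟩
  · exact h
  · exact absurd hk (hb k)

/-- If no free half-edge of a component of `A` is adjacent to another one, the component of `A` is a
component of `B`. -/
theorem joined_of_whole (hB : Matching B) (hA : Matching A) (hle : ∀ a b, A a b → B a b) {v w : V}
    (h : ∀ k, Free A k → Joined vert A (vert k) v → Free B k) (hvw : Joined vert B v w) :
    Joined vert A v w := by
  refine (hvw.closed (P := fun w => Joined vert A v w) ?_).1 (.refl _)
  intro a b hab
  by_cases hA' : A a b
  · exact ⟨fun h => h.trans (.of_rel hA'), fun h => h.trans (Joined.of_rel hA').symm⟩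
  · have ha := free_of_rel hB hle hab hA'
    have hb := free_of_rel hB hle (hB.symm hab) fun h => hA' (hA.symm h)
    exact ⟨fun h' => absurd hab (h a ha h'.symm _), fun h' => absurd (hB.symm hab) (h b hb h'.symm _)⟩

/-- If just one of the two legs of a component of `A` were on an edge of `B`, that edge would be its
only exit, and removing it would disconnect `B`. If the chain never met a three-legged component,
the components of `A` on it would fill a component of `B`. The latter has a leg, which would lie on
the chain, although no half-edge of the chain is free in `B`. -/
theorem Semi.good [Finite H] (hB : Semi vert B) (hA : Semi vert A) (hle : ∀ a b, A a b → B a b) :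
    Good vert B A := by
  have h1 : ∀ a b, Bridge vert A a b → ¬ Free B a → ¬ Free B b := by
    intro a b hab ha hb
    obtain ⟨a', haa⟩ := not_free.1 ha
    have hleg : ∀ x, Free A x → Joined vert A (vert a) (vert x) → x = a ∨ x = b := by
      intro x hx hj
      by_contra! hn
      exact hn.2 (bridge_matching.unique hab (bridge_of_legs_two hab.2.2.2.2 hab.2.1 hx hj hn.1.symm)).symm
    have hna : ¬ A a a' := hab.2.1 a'
    have hfa' := free_of_rel hB.toMatching hle (hB.symm haa) fun h => hna (hA.symm h)
    -- A path from `a` to `a'` that avoids this edge cannot leave the component of `a` in `A`: the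
    -- only other exit would be `b`, which is free in `B`.
    have key := ((hB.onePI a a' haa).closed (P := fun w => Joined vert A (vert a) w) ?_).1 (.refl _)
    · rcases hleg a' hfa' key with rfl | rfl
      · exact hB.irrefl _ haa
      · exact hb _ (hB.symm haa)
    · have step : ∀ x y, B x y → x ≠ a → Joined vert A (vert a) (vert x) →
          Joined vert A (vert a) (vert y) := by
        intro x y hxy hxa hj
        by_cases hxyA : A x y
        · exact hj.trans (.of_rel hxyA)
        · rcases hleg x (free_of_rel hB.toMatching hle hxy hxyA) hj with rfl | rfl
          · exact absurd rfl hxa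
          · exact absurd hxy (hb _)
      rintro x y ⟨hxy, hxa, hxa'⟩
      refine ⟨step x y hxy hxa, step y x (hB.symm hxy) ?_⟩
      rintro rfl
      exact hxa' (hB.unique (hB.symm hxy) haa)
  intro a b hab ha
  refine ⟨h1 a b hab ha, ?_⟩
  by_contra! hno
  have hbr : ∀ h k, Free A h → Free A k → Joined vert A (vert h) (vert k) → Linked vert B A a h →
      Linked vert B A a k := by
    intro h k hh hk hj hl
    by_cases hhk : h = k
    · exact hhk ▸ hl
    rcases hA.legs_eq (vert h) with h2 | h3
    · exact hl.trans (.of_bridge (bridge_of_legs_two h2 hh hk hj hhk))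
    · exact absurd hl (hno h ⟨hh, h3⟩)
  -- The components of `A` with a leg on the chain are closed under adjacency in `B`: entering one
  -- by a leg puts all its legs on the chain.
  have hT : ∀ w, Joined vert B (vert a) w →
      ∃ h, Free A h ∧ Joined vert A (vert h) w ∧ Linked vert B A a h := by
    intro w hw
    refine (hw.closed (P := fun w => ∃ h, Free A h ∧ Joined vert A (vert h) w ∧ Linked vert B A a h)
      ?_).1 ⟨a, hab.2.1, .refl _, .refl _⟩
    have step : ∀ x y, B x y → (∃ h, Free A h ∧ Joined vert A (vert h) (vert x) ∧ Linked vert B A a h) →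
        ∃ h, Free A h ∧ Joined vert A (vert h) (vert y) ∧ Linked vert B A a h := by
      rintro x y hxy ⟨h, hh, hj, hl⟩
      by_cases hxyA : A x y
      · exact ⟨h, hh, hj.trans (.of_rel hxyA), hl⟩
      · refine ⟨y, free_of_rel hB.toMatching hle (hB.symm hxy) fun h => hxyA (hA.symm h), .refl _, ?_⟩
        exact (hbr h x hh (free_of_rel hB.toMatching hle hxy hxyA) hj hl).trans (.of_rel hxy hxyA)
    exact fun x y hxy => ⟨step x y hxy, step y x (hB.symm hxy)⟩
  have hpos : 0 < legs vert B (vert a) := by rcases hB.legs_eq (vert a) with h | h <;> omega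
  obtain ⟨⟨h, hh, hj⟩⟩ := (Nat.card_pos_iff.1 hpos).1
  obtain ⟨h', hh', hj', hl'⟩ := hT _ hj.symm
  have hl := hbr h' h hh' (hh.mono hle) hj' hl'
  have : ¬ Free B h := by
    refine (eqvGen_closed (P := fun x => ¬ Free B x) ?_ hl).1 ha
    rintro x y (⟨hxy, -⟩ | hxy)
    · exact iff_of_true (fun h => h _ hxy) (fun h => h _ (hB.symm hxy))
    · exact ⟨h1 x y hxy, h1 y x hxy.symm⟩
  exact this hh

end Basic

end HalfEdge

/-! ### Quotients, and descent of the axioms to them. -/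

namespace HalfEdge

variable {H V H' V' : Type}

/-- The map `u` presents the graph `(vert', B')` as the quotient of `(vert, B)` by the subgraph with
edges `A`, up to components of `A` which are components of `B`. -/
structure Model (vert : H → V) (A B : H → H → Prop) (vert' : H' → V') (B' : H' → H' → Prop)
    (u : H' → H) : Prop where
  inj : Function.Injective u
  surj : Function.Surjective vert'
  isEnd : ∀ a, End vert A (u a)
  cover : ∀ h, End vert A h → ¬ Free B h → ∃ a, u a = h
  closed : ∀ a h, Free A h → Joined vert A (vert h) (vert (u a)) → ∃ b, u b = h
  vert_iff : ∀ a b, vert' a = vert' b ↔ Joined vert A (vert (u a)) (vert (u b))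
  adj_iff : ∀ a b, B' a b ↔ a ≠ b ∧ Linked vert B A (u a) (u b)

namespace Model

variable {vert : H → V} {A B : H → H → Prop} {vert' : H' → V'} {B' : H' → H' → Prop} {u : H' → H}

theorem ends_eq (m : Model vert A B vert' B' u) (hB : Matching B) (hA : Matching A) {a b c : H'}
    (hab : B' a b) (hac : Linked vert B A (u a) (u c)) (hne : a ≠ c) : b = c := by
  rw [m.adj_iff] at hab
  exact m.inj (linked_ends_unique hB hA (m.isEnd a) (m.isEnd b) (m.isEnd c) hab.2 hac
    (fun h => hab.1 (m.inj h)) (fun h => hne (m.inj h)))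

theorem matching (m : Model vert A B vert' B' u) (hB : Matching B) (hA : Matching A) :
    Matching B' where
  symm h := by
    rw [m.adj_iff] at h ⊢
    exact ⟨h.1.symm, h.2.symm⟩
  irrefl a h := ((m.adj_iff _ _).1 h).1 rfl
  unique h h' := m.ends_eq hB hA h ((m.adj_iff _ _).1 h').2 ((m.adj_iff _ _).1 h').1

/-- If `u a` lies on an edge of `B`, its chain has a second end, and `cover` makes this end a
half-edge of the quotient. Otherwise the chain of `u a` is trivial. -/
theorem free_iff [Finite H] (m : Model vert A B vert' B' u) (hB : Matching B) (hA : Semi vert A)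
    (hle : ∀ a b, A a b → B a b) (hG : Good vert B A) (a : H') : Free B' a ↔ Free B (u a) := by
  constructor
  · intro h
    by_contra hu
    obtain ⟨b, hba, hab, hb⟩ := exists_linked_end hB hA hle hG (m.isEnd a) hu
    obtain ⟨b, rfl⟩ := m.cover b hb (by rwa [← linked_free_iff hG hB hab])
    exact h b ((m.adj_iff _ _).2 ⟨fun h => hba (h ▸ rfl), hab⟩)
  · intro h b hb
    rw [m.adj_iff] at hb
    exact hb.1 (m.inj (linked_eq_of_free hB (m.isEnd a) h hb.2)).symm

theorem tri (m : Model vert A B vert' B' u) (x : V') : Nat.card {a // vert' a = x} = 3 := by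
  obtain ⟨a, rfl⟩ := m.surj x
  rw [← (m.isEnd a).2, legs]
  refine Nat.card_congr (Equiv.ofBijective
    (fun b => ⟨u b.1, (m.isEnd _).1, (m.vert_iff _ _).1 b.2⟩) ⟨?_, ?_⟩)
  · intro b c h
    exact Subtype.ext (m.inj (congrArg Subtype.val h))
  · rintro ⟨h, hh, hj⟩
    obtain ⟨b, rfl⟩ := m.closed a h hh hj
    exact ⟨⟨b, (m.vert_iff _ _).2 hj⟩, rfl⟩

/-- A set of vertices of the quotient lifts to a set of vertices of the graph. The chains in `Ex` are
not crossed. -/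
theorem lift (m : Model vert A B vert' B' u) (hB : Matching B) (hA : Semi vert A)
    (S : V' → Prop) (Ex : H → Prop)
    (hEx : ∀ x y, Linked vert B A x y → (Ex x → Ex y))
    (hS : ∀ k k', B' k k' → ¬ Ex (u k) → S (vert' k) → S (vert' k')) :
    ∃ T : V → Prop,
      (∀ x, Free A x → (T (vert x) ↔ ((∃ k, x = u k ∧ S (vert' k)) ∨
        (¬ Ex x ∧ ∃ k, Linked vert B A x (u k) ∧ S (vert' k))))) ∧
      ∀ x y, A x y → (T (vert x) ↔ T (vert y)) := by
  -- `P` selects the legs that belong to `S`, either as half-edges of the quotient or through a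
  -- chain. The first alternative stays separate because a half-edge of the quotient must follow its
  -- own vertex even if its chain is excluded by `Ex`. A vertex is put in `T` when its component of
  -- `A` has a leg satisfying `P`.
  set P : H → Prop := fun x => (∃ k, x = u k ∧ S (vert' k)) ∨
        (¬ Ex x ∧ ∃ k, Linked vert B A x (u k) ∧ S (vert' k)) with hP
  refine ⟨fun v => ∃ h, Free A h ∧ Joined vert A (vert h) v ∧ P h, ?_, ?_⟩
  · intro x hx
    refine ⟨?_, fun h => ⟨x, hx, .refl _, h⟩⟩
    rintro ⟨h, hh, hj, hPh⟩
    by_cases hhx : h = x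
    · exact hhx ▸ hPh
    have hcl : ∀ k, h = u k → S (vert' k) → P x := by
      rintro k rfl hk
      obtain ⟨k', rfl⟩ := m.closed k x hx hj.symm
      exact .inl ⟨k', rfl, by rwa [(m.vert_iff k' k).2 hj.symm]⟩
    rcases hPh with ⟨k, rfl, hk⟩ | ⟨hE, k, hl, hk⟩
    · exact hcl k rfl hk
    rcases hA.legs_eq (vert h) with h2 | h3
    · have hbr : Linked vert B A h x := .of_bridge (bridge_of_legs_two h2 hh hx hj hhx)
      exact .inr ⟨fun hx => hE (hEx _ _ hbr.symm hx), k, hbr.symm.trans hl, hk⟩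
    · have he : End vert A h := ⟨hh, h3⟩
      by_cases hhk : h = u k
      · exact hcl k hhk hk
      have hne : ¬ Free B h := fun hf => hhk (linked_eq_of_free hB he hf hl).symm
      obtain ⟨k0, rfl⟩ := m.cover h he hne
      refine hcl k0 rfl (hS k k0 ?_ (fun h => hE (hEx _ _ hl.symm h)) hk)
      exact (m.adj_iff _ _).2 ⟨fun h => hhk (h ▸ rfl), hl.symm⟩
  · intro x y hxy
    constructor
    · rintro ⟨h, hh, hj, hPh⟩
      exact ⟨h, hh, hj.trans (.of_rel hxy), hPh⟩
    · rintro ⟨h, hh, hj, hPh⟩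
      exact ⟨h, hh, hj.trans (.of_rel (hA.symm hxy)), hPh⟩

/-- Edges of the quotient are chains, hence paths in `B`. Conversely, `lift` turns the set of
vertices reachable in the quotient into a set closed under all of `B`, so that paths in `B` need not
be projected step by step. -/
theorem joined_iff (m : Model vert A B vert' B' u) (hB : Matching B) (hA : Semi vert A)
    (hle : ∀ a b, A a b → B a b) (a b : H') :
    Joined vert' B' (vert' a) (vert' b) ↔ Joined vert B (vert (u a)) (vert (u b)) := by
  constructor
  · intro h
    have := (h.closed (P := fun x => ∀ b, vert' b = x → Joined vert B (vert (u a)) (vert (u b))) ?_).1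
    · exact this (fun b hb => ((m.vert_iff _ _).1 hb.symm).mono hle) b rfl
    · have step : ∀ c d, B' c d → (∀ b, vert' b = vert' c → Joined vert B (vert (u a)) (vert (u b))) →
          ∀ b, vert' b = vert' d → Joined vert B (vert (u a)) (vert (u b)) := by
        intro c d hcd h b hb
        refine (h c rfl).trans ((((m.adj_iff _ _).1 hcd).2.joined hle).trans ?_)
        exact ((m.vert_iff _ _).1 hb.symm).mono hle
      exact fun c d hcd => ⟨step c d hcd, step d c ((m.matching hB hA.toMatching).symm hcd)⟩
  · intro h
    obtain ⟨T, hT, hTA⟩ := m.lift hB hA (fun x => Joined vert' B' (vert' a) x) (fun _ => False)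
      (fun _ _ _ h => h) (fun k k' hk _ h => h.trans (.of_rel hk))
    simp only [not_false_eq_true, true_and] at hT
    have key := (h.closed (P := T) ?_).1 ((hT _ (m.isEnd a).1).2 (.inl ⟨a, rfl, .refl _⟩))
    · rcases (hT _ (m.isEnd b).1).1 key with ⟨k, hk, hj⟩ | ⟨k, hk, hj⟩
      · exact m.inj hk ▸ hj
      · by_cases hbk : k = b
        · exact hbk ▸ hj
        · exact hj.trans (.of_rel ((m.adj_iff _ _).2 ⟨hbk, hk.symm⟩))
    · have step : ∀ x y, B x y → ¬ A x y → T (vert x) → T (vert y) := by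
        intro x y hxy hxyA hx
        have hxf := free_of_rel hB hle hxy hxyA
        have hyf := free_of_rel hB hle (hB.symm hxy) fun h => hxyA (hA.symm h)
        rw [hT _ hyf]
        have hl : Linked vert B A y x := (Linked.of_rel hxy hxyA).symm
        rcases (hT _ hxf).1 hx with ⟨k, rfl, hk⟩ | ⟨k, hk, hj⟩
        · exact .inr ⟨k, hl, hk⟩
        · exact .inr ⟨k, hl.trans hk, hj⟩
      intro x y hxy
      by_cases hxyA : A x y
      · exact hTA x y hxyA
      · exact ⟨step x y hxy hxyA, step y x (hB.symm hxy) fun h => hxyA (hA.symm h)⟩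

/-- The point is that every leg of such a component of `B` survives in the quotient. If its
component of `A` is a component of `B`, it contains `u a` and `closed` applies. Otherwise some leg
of that component is not free in `B`; by `Good` the component cannot have just two legs, so it
becomes a vertex. -/
theorem legs_eq [Finite H] (m : Model vert A B vert' B' u) (hB : Matching B) (hA : Semi vert A)
    (hle : ∀ a b, A a b → B a b) (hG : Good vert B A) (a : H') :
    legs vert' B' (vert' a) = legs vert B (vert (u a)) := by
  refine Nat.card_congr (Equiv.ofBijective
    (fun b => ⟨u b.1, (m.free_iff hB hA hle hG _).1 b.2.1, (m.joined_iff hB hA hle _ _).1 b.2.2⟩)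
    ⟨?_, ?_⟩)
  · intro b c h
    exact Subtype.ext (m.inj (congrArg Subtype.val h))
  · rintro ⟨h, hh, hj⟩
    have hr : ∃ b, u b = h := by
      have hhA := hh.mono hle
      by_cases hw : ∀ k, Free A k → Joined vert A (vert k) (vert h) → Free B k
      · exact m.closed a h hhA (joined_of_whole hB hA.toMatching hle hw hj)
      · push Not at hw
        obtain ⟨k, hk, hkj, hkB⟩ := hw
        rcases end_or_bridge hA hhA with he | ⟨k', hk'⟩
        · obtain ⟨k, rfl⟩ := m.cover k (he.of_joined hk hkj.symm) hkB
          exact m.closed k h hhA hkj.symm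
        · have hne : h ≠ k := by rintro rfl; exact hkB hh
          have := (hG.bridge_iff (bridge_of_legs_two hk'.2.2.2.2 hhA hk hkj.symm hne)).1 hh
          exact absurd this hkB
    obtain ⟨b, rfl⟩ := hr
    exact ⟨⟨b, (m.free_iff hB hA hle hG _).2 hh, (m.joined_iff hB hA hle _ _).2 hj⟩, rfl⟩

/-- Quotients satisfy the axioms. -/
theorem semi [Finite H] (m : Model vert A B vert' B' u) (hB : Semi vert B) (hA : Semi vert A)
    (hle : ∀ a b, A a b → B a b) (hG : Good vert B A) : Semi vert' B' where
  toMatching := m.matching hB.toMatching hA.toMatching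
  tri := m.tri
  legs_eq v := by
    obtain ⟨a, rfl⟩ := m.surj v
    rw [m.legs_eq hB.toMatching hA hle hG]
    exact hB.legs_eq _
  onePI a b hab := by
    by_contra hnot
    have hM := m.matching hB.toMatching hA.toMatching
    -- Assume that cutting `{a, b}` separates its two sides. The side of `a` is lifted with the
    -- whole chain from `u a` to `u b` excluded. The lift is then closed under all edges of `B`
    -- except the one at `u a`, since following the chain from its other end would require `b` to be
    -- on the side of `a`. This contradicts irreducibility of `B` at that single edge.
    obtain ⟨T, hT, hTA⟩ := m.lift hB.toMatching hA
      (fun x => Joined vert' (fun x y => B' x y ∧ x ≠ a ∧ x ≠ b) (vert' a) x)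
      (fun x => Linked vert B A x (u a)) (fun _ _ h h' => h.symm.trans h') (by
        intro k k' hk hE hj
        refine hj.trans (.of_rel ⟨hk, ?_, ?_⟩)
        · rintro rfl
          exact hE (.refl _)
        · rintro rfl
          exact hE ((m.adj_iff _ _).1 hab).2.symm)
    have huf : ¬ Free B (u a) := by
      rw [← m.free_iff hB.toMatching hA hle hG]
      exact not_free.2 ⟨b, hab⟩
    obtain ⟨a1, ha1⟩ := not_free.1 huf
    have hnA : ¬ A (u a) a1 := (m.isEnd a).1 a1
    have hnA' : ¬ A a1 (u a) := fun h => hnA (hA.symm h)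
    have hl1 : Linked vert B A (u a) a1 := .of_rel ha1 hnA
    have key := ((hB.onePI _ _ ha1).closed (P := T) ?_).1
      ((hT _ (m.isEnd a).1).2 (.inl ⟨a, rfl, .refl _⟩))
    · rcases (hT _ (free_of_rel hB.toMatching hle (hB.symm ha1) hnA')).1 key with
        ⟨k, rfl, hk⟩ | ⟨hE, -⟩
      · have hak : a ≠ k := by
          rintro rfl
          exact hB.irrefl _ ha1
        have hbk := m.ends_eq hB.toMatching hA.toMatching hab hl1 hak
        subst hbk
        exact hnot hk
      · exact hE hl1.symm
    · have step : ∀ x y, B x y → x ≠ u a → ¬ A x y → T (vert x) → T (vert y) := by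
        intro x y hxy hxa hxyA hx
        have hxf := free_of_rel hB.toMatching hle hxy hxyA
        have hyf := free_of_rel hB.toMatching hle (hB.symm hxy) fun h => hxyA (hA.symm h)
        have hl : Linked vert B A y x := (Linked.of_rel hxy hxyA).symm
        rw [hT _ hyf]
        right
        rcases (hT _ hxf).1 hx with ⟨k, rfl, hk⟩ | ⟨hE, k, hk, hj⟩
        · refine ⟨fun hya => ?_, k, hl, hk⟩
          have hak : a ≠ k := by
            rintro rfl
            exact hxa rfl
          have hbk := m.ends_eq hB.toMatching hA.toMatching hab (hya.symm.trans hl) hak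
          subst hbk
          exact hnot hk
        · exact ⟨fun h => hE (hl.symm.trans h), k, hl.trans hk, hj⟩
      rintro x y ⟨hxy, hxa, hxa1⟩
      by_cases hxyA : A x y
      · exact hTA x y hxyA
      · refine ⟨step x y hxy hxa hxyA, step y x (hB.symm hxy) ?_ fun h => hxyA (hA.symm h)⟩
        rintro rfl
        exact hxa1 (hB.unique (hB.symm hxy) ha1)

/-- After deletion of all steps within `{p, q}`, two equivalent points either remain equivalent, or
each of them is still equivalent to `p` or to `q`. -/
theorem eqvGen_remove {X : Type*} {r s : X → X → Prop} {p q : X}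
    (hrs : ∀ x y, r x y → s x y ∨ ((x = p ∨ x = q) ∧ (y = p ∨ y = q))) {a x : X}
    (h : Relation.EqvGen r a x) :
    Relation.EqvGen s a x ∨ ((Relation.EqvGen s p a ∨ Relation.EqvGen s q a) ∧
      (Relation.EqvGen s p x ∨ Relation.EqvGen s q x)) := by
  induction h with
  | rel x y hxy =>
    rcases hrs x y hxy with h | ⟨hx, hy⟩
    · exact .inl (.rel _ _ h)
    · right
      constructor
      · rcases hx with rfl | rfl
        · exact .inl (.refl _)
        · exact .inr (.refl _)
      · rcases hy with rfl | rfl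
        · exact .inl (.refl _)
        · exact .inr (.refl _)
  | refl x => exact .inl (.refl _)
  | symm x y _ ih => exact ih.imp (fun h => .symm _ _ h) And.symm
  | trans x y z _ _ ih ih' =>
    rcases ih with h | ⟨h1, h2⟩ <;> rcases ih' with h' | ⟨h1', h2'⟩
    · exact .inl (.trans _ _ _ h h')
    · exact .inr ⟨h1'.imp (fun g => .trans _ _ _ g (.symm _ _ h)) fun g => .trans _ _ _ g (.symm _ _ h), h2'⟩
    · exact .inr ⟨h1, h2.imp (fun g => .trans _ _ _ g h') fun g => .trans _ _ _ g h'⟩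
    · exact .inr ⟨h1, h2'⟩

/-- An edge of `A` is handled inside `A`. Any other edge `{p, q}` lies on the chain of some quotient
edge `{k, k'}`. Cutting it leaves `p` and `q` linked to different ends of that chain, and
irreducibility of the quotient joins `k` to `k'` through the remaining chains, none of which uses
`{p, q}`. -/
theorem onePI_of_quotient [Finite H] (m : Model vert A B vert' B' u) (hB : Matching B) (hA : Semi vert A)
    (hle : ∀ a b, A a b → B a b) (hG : Good vert B A) (hB' : Semi vert' B') (p q : H) (hpq : B p q) :
    Joined vert (fun x y => B x y ∧ x ≠ p ∧ x ≠ q) (vert p) (vert q) := by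
  by_cases hpqA : A p q
  · exact (hA.onePI p q hpqA).mono fun a b h => ⟨hle _ _ h.1, h.2⟩
  have hqpA : ¬ A q p := fun h => hpqA (hA.symm h)
  have hp := free_of_rel hB hle hpq hpqA
  have hq := free_of_rel hB hle (hB.symm hpq) hqpA
  have hpB : ¬ Free B p := not_free.2 ⟨q, hpq⟩
  set B₁ : H → H → Prop := fun x y => B x y ∧ x ≠ p ∧ x ≠ q with hB₁
  have hAB₁ : ∀ x y, A x y → B₁ x y := by
    intro x y h
    refine ⟨hle _ _ h, ?_, ?_⟩
    · rintro rfl; exact hp _ h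
    · rintro rfl; exact hq _ h
  have hB₁m : Matching B₁ := by
    refine ⟨fun {a b} h => ⟨hB.symm h.1, ?_, ?_⟩, fun a h => hB.irrefl _ h.1,
      fun h h' => hB.unique h.1 h'.1⟩
    · rintro rfl; exact h.2.2 (hB.unique (hB.symm h.1) hpq)
    · rintro rfl; exact h.2.1 (hB.unique (hB.symm h.1) (hB.symm hpq))
  have hrs : ∀ x y, ((B x y ∧ ¬ A x y) ∨ Bridge vert A x y) →
      (((B₁ x y ∧ ¬ A x y) ∨ Bridge vert A x y) ∨ ((x = p ∨ x = q) ∧ (y = p ∨ y = q))) := by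
    rintro x y (⟨h, h'⟩ | h)
    · by_cases hxp : x = p
      · subst hxp
        exact .inr ⟨.inl rfl, .inr (hB.unique h hpq)⟩
      by_cases hxq : x = q
      · subst hxq
        exact .inr ⟨.inr rfl, .inl (hB.unique h (hB.symm hpq))⟩
      exact .inl (.inl ⟨⟨h, hxp, hxq⟩, h'⟩)
    · exact .inl (.inr h)
  have hsplit : ∀ {a x}, Linked vert B A a x → Linked vert B₁ A a x ∨
      ((Linked vert B₁ A p a ∨ Linked vert B₁ A q a) ∧
        (Linked vert B₁ A p x ∨ Linked vert B₁ A q x)) := fun h => eqvGen_remove hrs h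
  obtain ⟨k, hk, hpk⟩ := hG.exists_end hA hp hpB
  have hkB : ¬ Free B k := by rwa [← linked_free_iff hG hB hpk]
  obtain ⟨k, rfl⟩ := m.cover k hk hkB
  have hkB' : ¬ Free B' k := by rwa [m.free_iff hB hA hle hG]
  obtain ⟨k', hkk'⟩ := not_free.1 hkB'
  have hkk := (m.adj_iff _ _).1 hkk'
  have hM := m.matching hB hA.toMatching
  have hside : ∀ x, Linked vert B A p x → Linked vert B₁ A p x ∨ Linked vert B₁ A q x := fun x h =>
    (hsplit h).elim .inl And.right
  have hjoin : Joined vert B₁ (vert (u k)) (vert (u k')) := by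
    have h := hB'.onePI k k' hkk'
    have := (h.closed (P := fun x => ∀ b, vert' b = x → Joined vert B₁ (vert (u k)) (vert (u b))) ?_).1
    · exact this (fun b hb => ((m.vert_iff _ _).1 hb.symm).mono hAB₁) k' rfl
    · have step : ∀ c d, B' c d → c ≠ k → c ≠ k' →
          (∀ b, vert' b = vert' c → Joined vert B₁ (vert (u k)) (vert (u b))) →
          ∀ b, vert' b = vert' d → Joined vert B₁ (vert (u k)) (vert (u b)) := by
        intro c d hcd hck hck' h b hb
        refine (h c rfl).trans (Joined.trans ?_ (((m.vert_iff _ _).1 hb.symm).mono hAB₁))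
        have hl := (m.adj_iff _ _).1 hcd
        rcases hsplit hl.2 with h1 | ⟨h1, -⟩
        · exact h1.joined hAB₁
        · exfalso
          have hmono : ∀ x y, Linked vert B₁ A x y → Linked vert B A x y := fun x y h =>
            eqvGen_map id (by
              rintro x y (h | h)
              · exact .rel _ _ (.inl ⟨h.1.1, h.2⟩)
              · exact .rel _ _ (.inr h)) h
          have hpc : Linked vert B A p (u c) := by
            rcases h1 with h1 | h1
            · exact hmono _ _ h1
            · exact (Linked.of_rel hpq hpqA).trans (hmono _ _ h1)
          exact hck' (m.ends_eq hB hA.toMatching hkk' (hpk.symm.trans hpc) hck.symm).symm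
      rintro c d ⟨hcd, h1, h2⟩
      refine ⟨step c d hcd h1 h2, step d c (hM.symm hcd) ?_ ?_⟩
      · rintro rfl; exact h2 (hM.unique (hM.symm hcd) hkk')
      · rintro rfl; exact h1 (hM.unique (hM.symm hcd) (hM.symm hkk'))
  -- Otherwise the cut chain would have three ends: the cut point and both `u k` and `u k'`.
  have hsame : ∀ p, (Free (fun x y => B₁ x y ∧ ¬ A x y) p) → Linked vert B₁ A p (u k) →
      Linked vert B₁ A p (u k') → False := by
    intro p hfree h1 h2
    have hne' : u k ≠ u k' := fun h => hkk.1 (m.inj h)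
    have hbb : Matching (fun x y => B₁ x y ∧ ¬ A x y) := diff_matching hB₁m hA.toMatching
    have hself : ∀ k k', u k ≠ u k' → Linked vert B₁ A p (u k') → p ≠ u k := by
      rintro k k' hkk' h rfl
      refine hkk' ((eqvGen_closed (P := fun x => x = u k) ?_ h).1 rfl).symm
      rintro x y (h | h)
      · constructor
        · rintro rfl; exact absurd h (hfree _)
        · rintro rfl; exact absurd (hbb.symm h) (hfree _)
      · constructor
        · rintro rfl; exact absurd h ((m.isEnd k).free_bridge _)
        · rintro rfl; exact absurd h.symm ((m.isEnd k).free_bridge _)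
    exact hne' (three_ends hbb bridge_matching (.inl hfree) (.inr (m.isEnd k).free_bridge)
      (.inr (m.isEnd k').free_bridge) h1 h2 (hself _ _ hne' h2) (hself _ _ hne'.symm h1))
  have hfp : Free (fun x y => B₁ x y ∧ ¬ A x y) p := fun _ h => h.1.2.1 rfl
  have hfq : Free (fun x y => B₁ x y ∧ ¬ A x y) q := fun _ h => h.1.2.2 rfl
  have hjl : ∀ {x y}, Linked vert B₁ A x y → Joined vert B₁ (vert x) (vert y) := fun h => h.joined hAB₁
  rcases hside _ hpk with h1 | h1 <;> rcases hside _ (hpk.trans hkk.2) with h2 | h2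
  · exact (hsame p hfp h1 h2).elim
  · exact (hjl h1).trans (hjoin.trans (hjl h2).symm)
  · exact (hjl h2).trans (hjoin.symm.trans (hjl h1).symm)
  · exact (hsame q hfq h1 h2).elim

end Model
end HalfEdge

/-! ### Full embeddings, and restriction of relations to unions of components. -/

namespace HalfEdge

/-- An embedding of graphs which is full at its vertices. -/
structure OpenEmb {H₁ V₁ H V : Type} (vert₁ : H₁ → V₁) (vert : H → V) (i : H₁ → H) (j : V₁ → V) :
    Prop where
  inj : Function.Injective i
  injV : Function.Injective j
  comm : ∀ a, vert (i a) = j (vert₁ a)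
  full : ∀ a x, vert a = j x → ∃ b, i b = a

/-- `R₁` is the restriction of the symmetric relation `R` to a union of components. -/
structure Restr {H₁ H : Type} (i : H₁ → H) (R₁ : H₁ → H₁ → Prop) (R : H → H → Prop) : Prop where
  symm : ∀ a b, R a b → R b a
  iff : ∀ a b, R₁ a b ↔ R (i a) (i b)
  closed : ∀ a y, R (i a) y → ∃ b, i b = y

namespace OpenEmb

variable {H₁ V₁ H V : Type} {vert₁ : H₁ → V₁} {vert : H → V} {i : H₁ → H} {j : V₁ → V}
  {R₁ B₁ : H₁ → H₁ → Prop} {R B : H → H → Prop}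

/-- A path that starts in the image never leaves it: all half-edges at image vertices are in the
image, and `R` does not lead out of it. -/
theorem joined_aux (e : OpenEmb vert₁ vert i j) (r : Restr i R₁ R) {x : V₁} {w : V}
    (h : Joined vert R (j x) w) : ∃ y, j y = w ∧ Joined vert₁ R₁ x y := by
  refine (h.closed (P := fun w => ∃ y, j y = w ∧ Joined vert₁ R₁ x y) ?_).1 ⟨x, rfl, .refl _⟩
  have step : ∀ a b, R a b → (∃ y, j y = vert a ∧ Joined vert₁ R₁ x y) →
      ∃ y, j y = vert b ∧ Joined vert₁ R₁ x y := by
    rintro a b hab ⟨y, hy, hj⟩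
    obtain ⟨a, rfl⟩ := e.full a y hy.symm
    obtain ⟨b, rfl⟩ := r.closed a b hab
    rw [e.comm] at hy
    obtain rfl := e.injV hy
    exact ⟨vert₁ b, (e.comm b).symm, hj.trans (.of_rel ((r.iff _ _).2 hab))⟩
  exact fun a b hab => ⟨step a b hab, step b a (r.symm _ _ hab)⟩

theorem joined_range (e : OpenEmb vert₁ vert i j) (r : Restr i R₁ R) {x : V₁} {w : V}
    (h : Joined vert R (j x) w) : ∃ y, j y = w :=
  (e.joined_aux r h).imp fun _ => And.left

theorem joined_iff (e : OpenEmb vert₁ vert i j) (r : Restr i R₁ R) {x y : V₁} :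
    Joined vert₁ R₁ x y ↔ Joined vert R (j x) (j y) := by
  constructor
  · refine eqvGen_map j ?_
    rintro _ _ ⟨a, b, hab, rfl, rfl⟩
    exact .rel _ _ ⟨i a, i b, (r.iff _ _).1 hab, e.comm a, e.comm b⟩
  · intro h
    obtain ⟨y', hy, h'⟩ := e.joined_aux r h
    exact e.injV hy ▸ h'

theorem free_iff (r : Restr i R₁ R) {a : H₁} : Free R₁ a ↔ Free R (i a) := by
  constructor
  · intro h k hk
    obtain ⟨b, rfl⟩ := r.closed a k hk
    exact h b ((r.iff _ _).2 hk)
  · exact fun h k hk => h (i k) ((r.iff _ _).1 hk)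

theorem legs_eq (e : OpenEmb vert₁ vert i j) (r : Restr i R₁ R) (x : V₁) :
    legs vert₁ R₁ x = legs vert R (j x) := by
  refine Nat.card_congr (Equiv.ofBijective (fun b => ⟨i b.1, (free_iff r).1 b.2.1, ?_⟩) ⟨?_, ?_⟩)
  · rw [e.comm]
    exact (e.joined_iff r).1 b.2.2
  · intro b c h
    exact Subtype.ext (e.inj (congrArg Subtype.val h))
  · rintro ⟨h, hh, hj⟩
    obtain ⟨y, hy⟩ := e.joined_range r hj.symm
    obtain ⟨b, rfl⟩ := e.full h y hy.symm
    rw [e.comm] at hj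
    exact ⟨⟨b, (free_iff r).2 hh, (e.joined_iff r).2 hj⟩, rfl⟩

theorem end_iff (e : OpenEmb vert₁ vert i j) (r : Restr i R₁ R) {a : H₁} :
    End vert₁ R₁ a ↔ End vert R (i a) := by
  rw [End, End, free_iff r, e.legs_eq r, e.comm]

theorem bridge_iff (e : OpenEmb vert₁ vert i j) (r : Restr i R₁ R) {a b : H₁} :
    Bridge vert₁ R₁ a b ↔ Bridge vert R (i a) (i b) := by
  rw [Bridge, Bridge, free_iff r, free_iff r, e.legs_eq r, e.joined_iff r, e.comm, e.comm,
    e.inj.ne_iff]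

theorem bridge_range (e : OpenEmb vert₁ vert i j) (r : Restr i R₁ R) {a : H₁} {y : H}
    (h : Bridge vert R (i a) y) : ∃ b, i b = y := by
  have hj := h.2.2.2.1
  rw [e.comm] at hj
  obtain ⟨x, hx⟩ := e.joined_range r hj
  exact e.full y x hx.symm

theorem linked_aux (e : OpenEmb vert₁ vert i j) (r : Restr i R₁ R) (s : Restr i B₁ B) {a : H₁} {y : H}
    (h : Linked vert B R (i a) y) : ∃ b, i b = y ∧ Linked vert₁ B₁ R₁ a b := by
  refine (eqvGen_closed (P := fun y => ∃ b, i b = y ∧ Linked vert₁ B₁ R₁ a b) ?_ h).1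
    ⟨a, rfl, .refl _⟩
  have step : ∀ x y, ((B x y ∧ ¬ R x y) ∨ Bridge vert R x y) →
      (∃ b, i b = x ∧ Linked vert₁ B₁ R₁ a b) → ∃ b, i b = y ∧ Linked vert₁ B₁ R₁ a b := by
    rintro x y hxy ⟨b, rfl, hb⟩
    rcases hxy with ⟨hxy, hxy'⟩ | hxy
    · obtain ⟨c, rfl⟩ := s.closed _ _ hxy
      exact ⟨c, rfl, hb.trans (.of_rel ((s.iff _ _).2 hxy) fun h => hxy' ((r.iff _ _).1 h))⟩
    · obtain ⟨c, rfl⟩ := e.bridge_range r hxy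
      exact ⟨c, rfl, hb.trans (.of_bridge ((e.bridge_iff r).2 hxy))⟩
  refine fun x y hxy => ⟨step x y hxy, step y x ?_⟩
  rcases hxy with ⟨hxy, hxy'⟩ | hxy
  · exact .inl ⟨s.symm _ _ hxy, fun h => hxy' (r.symm _ _ h)⟩
  · exact .inr hxy.symm

theorem linked_iff (e : OpenEmb vert₁ vert i j) (r : Restr i R₁ R) (s : Restr i B₁ B) {a b : H₁} :
    Linked vert₁ B₁ R₁ a b ↔ Linked vert B R (i a) (i b) := by
  constructor
  · refine eqvGen_map i ?_
    rintro a b (⟨h, h'⟩ | h)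
    · exact .rel _ _ (.inl ⟨(s.iff _ _).1 h, fun h'' => h' ((r.iff _ _).2 h'')⟩)
    · exact .rel _ _ (.inr ((e.bridge_iff r).1 h))
  · intro h
    obtain ⟨b', hb, h'⟩ := e.linked_aux r s h
    exact e.inj hb ▸ h'

theorem card_fiber (e : OpenEmb vert₁ vert i j) (x : V₁) :
    Nat.card {h // vert₁ h = x} = Nat.card {h // vert h = j x} := by
  refine Nat.card_congr (Equiv.ofBijective (fun b => ⟨i b.1, by rw [e.comm, b.2]⟩) ⟨?_, ?_⟩)
  · intro b c h
    exact Subtype.ext (e.inj (congrArg Subtype.val h))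
  · rintro ⟨h, hh⟩
    obtain ⟨b, rfl⟩ := e.full h x hh
    rw [e.comm] at hh
    exact ⟨⟨b, e.injV hh⟩, rfl⟩

theorem matching_restr (e : OpenEmb vert₁ vert i j) (r : Restr i R₁ R) (h : Matching R) :
    Matching R₁ where
  symm hab := (r.iff _ _).2 (h.symm ((r.iff _ _).1 hab))
  irrefl _ ha := h.irrefl _ ((r.iff _ _).1 ha)
  unique hab hac := e.inj (h.unique ((r.iff _ _).1 hab) ((r.iff _ _).1 hac))

theorem restr_remove (e : OpenEmb vert₁ vert i j) (r : Restr i R₁ R) (h : Matching R) {a b : H₁}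
    (hab : R₁ a b) : Restr i (fun x y => R₁ x y ∧ x ≠ a ∧ x ≠ b)
      (fun x y => R x y ∧ x ≠ i a ∧ x ≠ i b) where
  symm x y hxy := by
    have hab := (r.iff _ _).1 hab
    refine ⟨h.symm hxy.1, ?_, ?_⟩
    · rintro rfl; exact hxy.2.2 (h.unique (h.symm hxy.1) hab)
    · rintro rfl; exact hxy.2.1 (h.unique (h.symm hxy.1) (h.symm hab))
  iff x y := by rw [r.iff, e.inj.ne_iff, e.inj.ne_iff]
  closed x y hxy := r.closed x y hxy.1

theorem semi_restr (e : OpenEmb vert₁ vert i j) (r : Restr i R₁ R) (h : Semi vert R) :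
    Semi vert₁ R₁ where
  toMatching := e.matching_restr r h.toMatching
  tri x := by rw [e.card_fiber, h.tri]
  legs_eq x := by rw [e.legs_eq r]; exact h.legs_eq _
  onePI a b hab := by
    rw [e.joined_iff (e.restr_remove r h.toMatching hab), ← e.comm, ← e.comm]
    exact h.onePI _ _ ((r.iff _ _).1 hab)

theorem legs_of_untouched {R : H → H → Prop} (hR : ∀ a b, R a b → R b a) {v : V}
    (hv : ∀ a, vert a = v → Free R a) : legs vert R v = Nat.card {h // vert h = v} := by
  refine Nat.card_congr (Equiv.subtypeEquivRight fun h => ⟨?_, ?_⟩)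
  · rintro ⟨-, hj⟩
    refine (hj.symm.closed (P := fun w => w = v) ?_).1 rfl
    exact fun _ _ hab => ⟨fun ha => absurd hab (hv _ ha _), fun hb => absurd (hR _ _ hab) (hv _ hb _)⟩
  · rintro rfl
    exact ⟨hv h rfl, .refl _⟩

/-- A graph whose edges all lie in a full subgraph satisfies the axioms if the subgraph does. -/
theorem semi_extend (e : OpenEmb vert₁ vert i j) (r : Restr i R₁ R)
    (hR : ∀ a b, R a b → ∃ c, i c = a) (htri : ∀ v, Nat.card {h // vert h = v} = 3)
    (h : Semi vert₁ R₁) : Semi vert R := by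
  have hm : Matching R := by
    refine ⟨fun {a b} hab => r.symm a b hab, fun a ha => ?_, fun {a b c} hab hac => ?_⟩
    · obtain ⟨a, rfl⟩ := hR a a ha
      exact h.irrefl a ((r.iff _ _).2 ha)
    · obtain ⟨a, rfl⟩ := hR a b hab
      obtain ⟨b, rfl⟩ := r.closed _ _ hab
      obtain ⟨c, rfl⟩ := r.closed _ _ hac
      rw [h.unique ((r.iff _ _).2 hab) ((r.iff _ _).2 hac)]
  refine ⟨hm, htri, fun v => ?_, fun a b hab => ?_⟩
  -- An untouched vertex is a component with three legs. It is admissible because `Semi` asks for no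
  -- loops.
  · by_cases hv : ∀ a, vert a = v → Free R a
    · rw [legs_of_untouched r.symm hv, htri]
      exact .inr rfl
    · push Not at hv
      obtain ⟨a, rfl, ha⟩ := hv
      obtain ⟨b, hb⟩ := not_free.1 ha
      obtain ⟨a, rfl⟩ := hR a b hb
      rw [e.comm, ← e.legs_eq r]
      exact h.legs_eq _
  · obtain ⟨a, rfl⟩ := hR a b hab
    obtain ⟨b, rfl⟩ := r.closed _ _ hab
    have hab' := (r.iff _ _).2 hab
    rw [e.comm, e.comm, ← e.joined_iff (e.restr_remove r hm hab')]
    exact h.onePI a b hab'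

/-- A graph covered by two full subgraphs satisfies the axioms if the subgraphs do. -/
theorem semi_union {H₂ V₂ : Type} {vert₂ : H₂ → V₂} {i₂ : H₂ → H} {j₂ : V₂ → V}
    {R₂ : H₂ → H₂ → Prop} (e : OpenEmb vert₁ vert i j) (r : Restr i R₁ R)
    (e₂ : OpenEmb vert₂ vert i₂ j₂) (r₂ : Restr i₂ R₂ R)
    (hV : ∀ v, (∃ x, j x = v) ∨ ∃ x, j₂ x = v) (h : Semi vert₁ R₁) (h₂ : Semi vert₂ R₂) :
    Semi vert R := by
  have hH : ∀ a, (∃ x, i x = a) ∨ ∃ x, i₂ x = a := fun a => by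
    rcases hV (vert a) with ⟨x, hx⟩ | ⟨x, hx⟩
    · exact .inl (e.full a x hx.symm)
    · exact .inr (e₂.full a x hx.symm)
  have hm : Matching R := by
    refine ⟨fun {a b} hab => r.symm a b hab, fun a ha => ?_, fun {a b c} hab hac => ?_⟩
    · rcases hH a with ⟨a, rfl⟩ | ⟨a, rfl⟩
      · exact h.irrefl a ((r.iff _ _).2 ha)
      · exact h₂.irrefl a ((r₂.iff _ _).2 ha)
    · rcases hH a with ⟨a, rfl⟩ | ⟨a, rfl⟩
      · obtain ⟨b, rfl⟩ := r.closed _ _ hab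
        obtain ⟨c, rfl⟩ := r.closed _ _ hac
        rw [h.unique ((r.iff _ _).2 hab) ((r.iff _ _).2 hac)]
      · obtain ⟨b, rfl⟩ := r₂.closed _ _ hab
        obtain ⟨c, rfl⟩ := r₂.closed _ _ hac
        rw [h₂.unique ((r₂.iff _ _).2 hab) ((r₂.iff _ _).2 hac)]
  refine ⟨hm, fun v => ?_, fun v => ?_, fun a b hab => ?_⟩
  · rcases hV v with ⟨x, rfl⟩ | ⟨x, rfl⟩
    · rw [← e.card_fiber, h.tri]
    · rw [← e₂.card_fiber, h₂.tri]
  · rcases hV v with ⟨x, rfl⟩ | ⟨x, rfl⟩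
    · rw [← e.legs_eq r]; exact h.legs_eq _
    · rw [← e₂.legs_eq r₂]; exact h₂.legs_eq _
  · rcases hH a with ⟨a, rfl⟩ | ⟨a, rfl⟩
    · obtain ⟨b, rfl⟩ := r.closed _ _ hab
      have hab' := (r.iff _ _).2 hab
      rw [e.comm, e.comm, ← e.joined_iff (e.restr_remove r hm hab')]
      exact h.onePI a b hab'
    · obtain ⟨b, rfl⟩ := r₂.closed _ _ hab
      have hab' := (r₂.iff _ _).2 hab
      rw [e₂.comm, e₂.comm, ← e₂.joined_iff (e₂.restr_remove r₂ hm hab')]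
      exact h₂.onePI a b hab'

end OpenEmb

theorem card_eq_mul_of_fibers {X Y : Type*} [Finite X] [Finite Y] (f : X → Y) (k : ℕ)
    (h : ∀ y, Nat.card {x // f x = y} = k) : Nat.card X = k * Nat.card Y := by
  have := Fintype.ofFinite Y
  rw [← Nat.card_congr (Equiv.sigmaFiberEquiv f), Nat.card_sigma]
  simp [h, mul_comm]

end HalfEdge

/-! ### The Feynman axioms in terms of half-edges. -/

namespace PreGraph

open HalfEdge

variable {Γ : PreGraph}

theorem isGraph_iff : Γ.IsGraph ↔ Matching Γ.Adj :=
  ⟨fun h => ⟨fun {a b} => h.symm a b, h.irrefl, fun {a b c} => h.unique a b c⟩,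
    fun h => ⟨fun _ _ => h.symm, h.irrefl, fun _ _ _ => h.unique⟩⟩

theorem comp_eq_iff {v w : Γ.V} : Γ.comp v = Γ.comp w ↔ HalfEdge.Joined Γ.vert Γ.Adj v w :=
  Quotient.eq

theorem legs_comp (v : Γ.V) : Γ.legs (Γ.comp v) = HalfEdge.legs Γ.vert Γ.Adj v := by
  refine Nat.card_congr ((Equiv.subtypeSubtypeEquivSubtypeInter Γ.IsExternal
    (fun h => Γ.comp (Γ.vert h) = Γ.comp v)).trans (Equiv.subtypeEquivRight fun h => ?_))
  exact and_congr Iff.rfl comp_eq_iff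

/-- It suffices to reconnect the two endpoints of the removed edge: any other path can take this
detour. -/
theorem onePI_iff (h : Matching Γ.Adj) : (∀ a b, Γ.Adj a b → ∀ v w, Γ.Joined Γ.Adj v w →
    Γ.Joined (fun x y => Γ.Adj x y ∧ x ≠ a ∧ x ≠ b) v w) ↔
    ∀ a b, Γ.Adj a b →
      HalfEdge.Joined Γ.vert (fun x y => Γ.Adj x y ∧ x ≠ a ∧ x ≠ b) (Γ.vert a) (Γ.vert b) := by
  constructor
  · exact fun H a b hab => H a b hab _ _ (HalfEdge.Joined.of_rel hab)
  · intro H a b hab v w hvw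
    refine HalfEdge.Joined.bind (fun x y hxy => ?_) hvw
    by_cases hxa : x = a
    · subst hxa
      rw [h.unique hxy hab]
      exact H _ _ hab
    by_cases hxb : x = b
    · subst hxb
      rw [h.unique hxy (h.symm hab)]
      exact (H _ _ hab).symm
    exact .of_rel ⟨hxy, hxa, hxb⟩

/-- Counting half-edges of a component gives legs + 2E = 3V, so E - V + 1 = (V - legs)/2 + 1. With
two or three legs this fails to be positive only for V = 1, E = 0, the isolated vertex. -/
theorem loopNumber_pos_iff (h : Semi Γ.vert Γ.Adj) :
    (∀ C, 0 < Γ.loopNumber C) ↔ ∀ v, ∃ a, Γ.vert a = v ∧ ¬ Free Γ.Adj a := by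
  have hcount : ∀ C : Γ.Component,
      Γ.legs C + 2 * Nat.card {e : Γ.IntEdge // ∀ h ∈ e.1, Γ.comp (Γ.vert h) = C} =
        3 * Nat.card {v : Γ.V // Γ.comp v = C} := by
    intro C
    have h1 : Nat.card {a : Γ.H // Γ.comp (Γ.vert a) = C} =
        3 * Nat.card {v : Γ.V // Γ.comp v = C} := by
      refine card_eq_mul_of_fibers (fun a => ⟨Γ.vert a.1, a.2⟩) 3 ?_
      rintro ⟨v, hv⟩
      rw [← h.tri v]
      refine Nat.card_congr ⟨fun a => ⟨a.1.1, congrArg Subtype.val a.2⟩,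
        fun a => ⟨⟨a.1, by rw [a.2, hv]⟩, Subtype.ext a.2⟩, fun _ => rfl, fun _ => rfl⟩
    have h2 : Nat.card {a : Γ.H // Γ.comp (Γ.vert a) = C ∧ ¬ Free Γ.Adj a} =
        2 * Nat.card {e : Γ.IntEdge // ∀ h ∈ e.1, Γ.comp (Γ.vert h) = C} := by
      have hp : ∀ a : {a : Γ.H // Γ.comp (Γ.vert a) = C ∧ ¬ Free Γ.Adj a},
          Γ.Adj a.1 (Matching.partner Γ.Adj a.1) := by
        rintro ⟨a, -, ha⟩
        obtain ⟨b, hb⟩ := not_free.1 ha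
        rw [h.partner_eq hb]
        exact hb
      have hq : ∀ a : {a : Γ.H // Γ.comp (Γ.vert a) = C ∧ ¬ Free Γ.Adj a},
          ∀ x ∈ ({a.1, Matching.partner Γ.Adj a.1} : Set Γ.H), Γ.comp (Γ.vert x) = C := by
        rintro a x (rfl | rfl)
        · exact a.2.1
        · exact (comp_eq_iff.2 (HalfEdge.Joined.of_rel (hp a)).symm).trans a.2.1
      refine card_eq_mul_of_fibers (fun a => ⟨⟨{a.1, Matching.partner Γ.Adj a.1}, _, _, hp a, rfl⟩,
        hq a⟩) 2 ?_
      · rintro ⟨⟨e, a, b, hab, rfl⟩, he⟩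
        have ha := h.partner_eq hab
        have hb := h.partner_eq (h.symm hab)
        rw [Nat.card_eq_two_iff]
        refine ⟨⟨⟨a, he a (by simp), not_free.2 ⟨_, hab⟩⟩, ?_⟩,
          ⟨⟨b, he b (by simp), not_free.2 ⟨_, h.symm hab⟩⟩, ?_⟩, ?_, ?_⟩
        · simp [ha]
        · simp [hb, Set.pair_comm]
        · intro heq
          have : a = b := congrArg (fun x => x.1.1) heq
          exact h.irrefl a (by rw [← this] at hab; exact hab)
        · ext ⟨⟨x, hx1, hx2⟩, hx⟩
          simp only [Set.mem_insert_iff, Set.mem_singleton_iff, Set.mem_univ, iff_true,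
            Subtype.mk.injEq]
          have h3 : x ∈ ({a, b} : Set Γ.H) := by
            have h4 : ({x, Matching.partner Γ.Adj x} : Set Γ.H) = {a, b} :=
              congrArg (fun e => e.1.1) hx
            rw [← h4]
            simp
          exact h3
    have h3 : Γ.legs C = Nat.card {a : Γ.H // Γ.comp (Γ.vert a) = C ∧ Free Γ.Adj a} :=
      Nat.card_congr ((Equiv.subtypeSubtypeEquivSubtypeInter Γ.IsExternal
        (fun h => Γ.comp (Γ.vert h) = C)).trans (Equiv.subtypeEquivRight fun h => and_comm))
    rw [← h1, ← h2, h3, ← Nat.card_sum]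
    refine Nat.card_congr (Equiv.trans (Equiv.sumCongr
      (Equiv.subtypeSubtypeEquivSubtypeInter (fun a => Γ.comp (Γ.vert a) = C) (fun a => Free Γ.Adj a)).symm
      (Equiv.subtypeSubtypeEquivSubtypeInter (fun a => Γ.comp (Γ.vert a) = C) (fun a => ¬ Free Γ.Adj a)).symm) ?_)
    classical
    exact Equiv.sumCompl (fun a : {a : Γ.H // Γ.comp (Γ.vert a) = C} => Free Γ.Adj a.1)
  constructor
  · intro hl v
    by_contra! hv
    have hu := OpenEmb.legs_of_untouched (R := Γ.Adj) (fun _ _ => h.symm) hv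
    rw [h.tri, ← legs_comp] at hu
    have hone : Nat.card {w : Γ.V // Γ.comp w = Γ.comp v} = 1 := by
      rw [Nat.card_eq_one_iff_unique]
      refine ⟨⟨fun x y => Subtype.ext ?_⟩, ⟨⟨v, rfl⟩⟩⟩
      have : ∀ w, Γ.comp w = Γ.comp v → w = v := by
        intro w hw
        refine ((comp_eq_iff.1 hw).symm.closed (P := fun w => w = v) ?_).1 rfl
        exact fun a b hab => ⟨fun ha => absurd hab (hv a ha _), fun hb => absurd (h.symm hab) (hv b hb _)⟩
      rw [this _ x.2, this _ y.2]
    have h1 := hcount (Γ.comp v)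
    have h2 := hl (Γ.comp v)
    rw [loopNumber] at h2
    omega
  · intro hv C
    obtain ⟨v, rfl⟩ := Quotient.exists_rep C
    change 0 < Γ.loopNumber (Γ.comp v)
    have h1 := hcount (Γ.comp v)
    have hpos : 0 < Nat.card {w : Γ.V // Γ.comp w = Γ.comp v} := by
      rw [Nat.card_pos_iff]
      exact ⟨⟨⟨v, rfl⟩⟩, inferInstance⟩
    have hE : 0 < Nat.card {e : Γ.IntEdge // ∀ h ∈ e.1, Γ.comp (Γ.vert h) = Γ.comp v} := by
      obtain ⟨a, rfl, ha⟩ := hv v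
      obtain ⟨b, hab⟩ := not_free.1 ha
      rw [Nat.card_pos_iff]
      refine ⟨⟨⟨⟨{a, b}, a, b, hab, rfl⟩, ?_⟩⟩, inferInstance⟩
      rintro x (rfl | rfl)
      · rfl
      · exact comp_eq_iff.2 (HalfEdge.Joined.of_rel hab).symm
    have h2 : Γ.legs (Γ.comp v) = 2 ∨ Γ.legs (Γ.comp v) = 3 := by
      rw [legs_comp]; exact h.legs_eq v
    rw [loopNumber]
    omega

/-- This separates the part of the axioms that tolerates isolated vertices, and hence can be stated
for the edges of a subgraph on all vertices of the ambient graph, from a condition on single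
vertices. -/
theorem isFeynman_iff : Γ.IsFeynman ↔
    Semi Γ.vert Γ.Adj ∧ ∀ v, ∃ a, Γ.vert a = v ∧ ¬ Free Γ.Adj a := by
  constructor
  · intro h
    have hm := isGraph_iff.1 h.toIsGraph
    have hs : Semi Γ.vert Γ.Adj :=
      ⟨hm, h.trivalent, fun v => by rw [← legs_comp]; exact h.legs_eq _, (onePI_iff hm).1 h.onePI⟩
    exact ⟨hs, (loopNumber_pos_iff hs).1 h.loop⟩
  · rintro ⟨hs, hv⟩
    refine ⟨isGraph_iff.2 hs.toMatching, hs.tri, fun C => ?_, (onePI_iff hs.toMatching).2 hs.onePI,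
      (loopNumber_pos_iff hs).2 hv⟩
    obtain ⟨v, rfl⟩ := Quotient.exists_rep C
    change Γ.legs (Γ.comp v) = 2 ∨ Γ.legs (Γ.comp v) = 3
    rw [legs_comp]
    exact hs.legs_eq v

theorem IsFeynman.semi (h : Γ.IsFeynman) : Semi Γ.vert Γ.Adj := (isFeynman_iff.1 h).1

theorem IsFeynman.touched (h : Γ.IsFeynman) (v : Γ.V) : ∃ a, Γ.vert a = v ∧ ¬ Free Γ.Adj a :=
  (isFeynman_iff.1 h).2 v

end PreGraph

/-! ### Graphs presented inside a set of half-edges; subgraphs and quotients. -/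

namespace PreGraph

open HalfEdge

/-- The map `u` presents `Γ` as a graph with set of half-edges `S`, with incidence and adjacency given by
`E` and `B`. -/
structure Presents (Γ : PreGraph) {X : Type} (u : Γ.H → X) (S : X → Prop) (E B : X → X → Prop) :
    Prop where
  inj : Function.Injective u
  surj : Function.Surjective Γ.vert
  range : ∀ x, (∃ a, u a = x) ↔ S x
  vert_iff : ∀ a b, Γ.vert a = Γ.vert b ↔ E (u a) (u b)
  adj_iff : ∀ a b, Γ.Adj a b ↔ B (u a) (u b)

theorem Iso.ext_of_eH {Γ Γ' : PreGraph} (hs : Function.Surjective Γ.vert) {e e' : Iso Γ Γ'}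
    (h : ∀ a, e.eH a = e'.eH a) : e = e' := by
  obtain ⟨eV, eH, h1, h2⟩ := e
  obtain ⟨eV', eH', h1', h2'⟩ := e'
  obtain rfl : eH = eH' := Equiv.ext h
  obtain rfl : eV = eV' := Equiv.ext fun v => by
    obtain ⟨a, rfl⟩ := hs v
    rw [← h1, ← h1']
  rfl

instance (Γ Γ' : PreGraph) : Finite (Iso Γ Γ') := by
  refine Finite.of_injective (fun e : Iso Γ Γ' => ((e.eV : Γ.V → Γ'.V), (e.eH : Γ.H → Γ'.H))) ?_
  rintro ⟨eV, eH, h1, h2⟩ ⟨eV', eH', h1', h2'⟩ h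
  simp only [Prod.mk.injEq, DFunLike.coe_fn_eq] at h
  obtain ⟨rfl, rfl⟩ := h
  rfl

theorem Iso.vert_eq_iff {Γ Γ' : PreGraph} (e : Iso Γ Γ') (a b : Γ.H) :
    Γ'.vert (e.eH a) = Γ'.vert (e.eH b) ↔ Γ.vert a = Γ.vert b := by
  rw [e.vert_eq, e.vert_eq, e.eV.apply_eq_iff_eq]

/-- An isomorphism is given by a bijection of half-edges. -/
noncomputable def Iso.ofEquiv {Γ Γ' : PreGraph} (hs : Function.Surjective Γ.vert)
    (hs' : Function.Surjective Γ'.vert) (e : Γ.H ≃ Γ'.H)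
    (hv : ∀ a b, Γ.vert a = Γ.vert b ↔ Γ'.vert (e a) = Γ'.vert (e b))
    (ha : ∀ a b, Γ'.Adj (e a) (e b) ↔ Γ.Adj a b) : Iso Γ Γ' where
  eV := Equiv.ofBijective (fun v => Γ'.vert (e (Function.surjInv hs v))) (by
    constructor
    · intro v w h
      have := (hv _ _).2 h
      rwa [Function.surjInv_eq hs, Function.surjInv_eq hs] at this
    · intro w
      obtain ⟨b, rfl⟩ := hs' w
      refine ⟨Γ.vert (e.symm b), ?_⟩
      have := (hv (Function.surjInv hs (Γ.vert (e.symm b))) (e.symm b)).1 (Function.surjInv_eq _ _)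
      rwa [e.apply_symm_apply] at this)
  eH := e
  vert_eq h := (hv _ _).1 (Function.surjInv_eq hs _).symm
  adj_iff := ha

namespace Presents

variable {Γ Γ' : PreGraph} {X Y : Type} {u : Γ.H → X} {u' : Γ'.H → X} {S S' : X → Prop}
  {E B E' B' : X → X → Prop}

theorem congr (p : Presents Γ u S E B) (hS : ∀ x, S x ↔ S' x)
    (hE : ∀ x y, S x → S y → (E x y ↔ E' x y)) (hB : ∀ x y, S x → S y → (B x y ↔ B' x y)) :
    Presents Γ u S' E' B' :=
  ⟨p.inj, p.surj, fun x => (p.range x).trans (hS x),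
    fun a b => (p.vert_iff a b).trans (hE _ _ ((p.range _).1 ⟨a, rfl⟩) ((p.range _).1 ⟨b, rfl⟩)),
    fun a b => (p.adj_iff a b).trans (hB _ _ ((p.range _).1 ⟨a, rfl⟩) ((p.range _).1 ⟨b, rfl⟩))⟩

/-- Every vertex carries a half-edge, so a graph is determined by its half-edges, their incidence
and their adjacency. The isomorphisms between restricted, contracted and transported graphs are
obtained by comparing two such presentations. -/
theorem exists_iso (p : Presents Γ u S E B) (p' : Presents Γ' u' S E B) :
    ∃ e : Iso Γ Γ', ∀ a, u' (e.eH a) = u a := by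
  have h1 : ∀ a, ∃ b, u' b = u a := fun a => (p'.range _).2 ((p.range _).1 ⟨a, rfl⟩)
  choose f hf using h1
  have hbij : Function.Bijective f := by
    constructor
    · intro a b hab
      apply p.inj
      rw [← hf, ← hf, hab]
    · intro b
      obtain ⟨a, ha⟩ := (p.range _).2 ((p'.range _).1 ⟨b, rfl⟩)
      exact ⟨a, p'.inj ((hf a).trans ha)⟩
  refine ⟨Iso.ofEquiv p.surj p'.surj (Equiv.ofBijective f hbij) (fun a b => ?_) (fun a b => ?_), ?_⟩
  · rw [p.vert_iff, p'.vert_iff]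
    simp [hf]
  · rw [p.adj_iff, p'.adj_iff]
    simp [hf]
  · exact hf

theorem comp_emb (p : Presents Γ u S E B) {v : X → Y} {S₁ : Y → Prop} {E₁ B₁ : Y → Y → Prop}
    (hv : Function.Injective v) (hS : ∀ y, S₁ y ↔ ∃ x, S x ∧ v x = y)
    (hE : ∀ x x', S x → S x' → (E x x' ↔ E₁ (v x) (v x')))
    (hB : ∀ x x', S x → S x' → (B x x' ↔ B₁ (v x) (v x'))) : Presents Γ (v ∘ u) S₁ E₁ B₁ where
  inj := hv.comp p.inj
  surj := p.surj
  range y := by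
    rw [hS]
    constructor
    · rintro ⟨a, rfl⟩
      exact ⟨u a, (p.range _).1 ⟨a, rfl⟩, rfl⟩
    · rintro ⟨x, hx, rfl⟩
      obtain ⟨a, rfl⟩ := (p.range _).2 hx
      exact ⟨a, rfl⟩
  vert_iff a b := (p.vert_iff a b).trans (hE _ _ ((p.range _).1 ⟨a, rfl⟩) ((p.range _).1 ⟨b, rfl⟩))
  adj_iff a b := (p.adj_iff a b).trans (hB _ _ ((p.range _).1 ⟨a, rfl⟩) ((p.range _).1 ⟨b, rfl⟩))

end Presents

theorem IsFeynman.surj {Γ : PreGraph} (h : Γ.IsFeynman) : Function.Surjective Γ.vert :=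
  h.semi.exists_vert

/-- A vertex at an edge of `A`. -/
def Touched {H V : Type} (vert : H → V) (A : H → H → Prop) (v : V) : Prop :=
  ∃ a, vert a = v ∧ ¬ Free A a

section Sub

variable {Γ : PreGraph}

theorem PreSubgraph.openEmb (γ : Γ.PreSubgraph) :
    OpenEmb γ.toGraph.vert Γ.vert (Subtype.val : γ.toGraph.H → Γ.H) (Subtype.val : γ.toGraph.V → Γ.V) where
  inj := Subtype.val_injective
  injV := Subtype.val_injective
  comm _ := rfl
  full a x h := ⟨⟨a, h ▸ x.2⟩, rfl⟩

theorem PreSubgraph.restr (γ : Γ.PreSubgraph) (hs : ∀ a b, γ.adj a b → γ.adj b a) :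
    Restr (Subtype.val : γ.toGraph.H → Γ.H) γ.toGraph.Adj γ.adj where
  symm := hs
  iff _ _ := Iff.rfl
  closed _ y h := ⟨⟨y, (γ.adj_le _ _ h).2.2⟩, rfl⟩

theorem PreSubgraph.symm_of_toGraph (γ : Γ.PreSubgraph)
    (hs : ∀ a b, γ.toGraph.Adj a b → γ.toGraph.Adj b a) (a b : Γ.H) (h : γ.adj a b) : γ.adj b a :=
  hs ⟨a, (γ.adj_le _ _ h).2.1⟩ ⟨b, (γ.adj_le _ _ h).2.2⟩ h

/-- Subgraphs thus become edge relations satisfying `Semi` on the whole of `Γ`: the vertices outside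
`γ` count as isolated components, and the vertex set of `γ` is recovered from its edges. -/
theorem PreSubgraph.isFeynman_iff (hΓ : ∀ v, Nat.card {h : Γ.H // Γ.vert h = v} = 3)
    (γ : Γ.PreSubgraph) : γ.toGraph.IsFeynman ↔
      Semi Γ.vert γ.adj ∧ ∀ v, v ∈ γ.verts ↔ Touched Γ.vert γ.adj v := by
  have hsub : ∀ v, Touched Γ.vert γ.adj v → v ∈ γ.verts := by
    rintro v ⟨a, rfl, ha⟩
    obtain ⟨b, hb⟩ := not_free.1 ha
    exact (γ.adj_le _ _ hb).2.1
  constructor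
  · intro h
    have r := γ.restr (γ.symm_of_toGraph fun _ _ => h.semi.symm)
    refine ⟨γ.openEmb.semi_extend r (fun a b hab => ⟨⟨a, (γ.adj_le _ _ hab).2.1⟩, rfl⟩) hΓ h.semi,
      fun v => ⟨fun hv => ?_, hsub v⟩⟩
    obtain ⟨a, ha, ha'⟩ := h.touched ⟨v, hv⟩
    exact ⟨a.1, congrArg Subtype.val ha, fun h => ha' ((OpenEmb.free_iff r).2 h)⟩
  · rintro ⟨hs, hv⟩
    have r := γ.restr fun _ _ => hs.symm
    refine PreGraph.isFeynman_iff.2 ⟨γ.openEmb.semi_restr r hs, fun v => ?_⟩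
    obtain ⟨a, ha, ha'⟩ := (hv v.1).1 v.2
    exact ⟨⟨a, ha ▸ v.2⟩, Subtype.ext ha, fun h => ha' ((OpenEmb.free_iff r).1 h)⟩

namespace Subgraph

theorem semi (hΓ : Γ.IsFeynman) (γ : Γ.Subgraph) : Semi Γ.vert γ.1.adj :=
  ((PreSubgraph.isFeynman_iff hΓ.trivalent γ.1).1 γ.2).1

theorem mem_verts (hΓ : Γ.IsFeynman) (γ : Γ.Subgraph) (v : Γ.V) :
    v ∈ γ.1.verts ↔ Touched Γ.vert γ.1.adj v :=
  ((PreSubgraph.isFeynman_iff hΓ.trivalent γ.1).1 γ.2).2 v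

theorem adj_le (γ : Γ.Subgraph) (a b : Γ.H) (h : γ.1.adj a b) : Γ.Adj a b := (γ.1.adj_le a b h).1

theorem ext_adj (hΓ : Γ.IsFeynman) {γ γ' : Γ.Subgraph} (h : ∀ a b, γ.1.adj a b ↔ γ'.1.adj a b) :
    γ = γ' := by
  have hadj : γ.1.adj = γ'.1.adj := by ext a b; exact h a b
  have hv : γ.1.verts = γ'.1.verts := by
    ext v
    rw [γ.mem_verts hΓ, γ'.mem_verts hΓ, hadj]
  obtain ⟨⟨v, a, h1⟩, h2⟩ := γ
  obtain ⟨⟨v', a', h1'⟩, h2'⟩ := γ'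
  obtain rfl : v = v' := hv
  obtain rfl : a = a' := hadj
  rfl

/-- The subgraph with edges `A`. -/
def ofAdj (hΓ : Γ.IsFeynman) (A : Γ.H → Γ.H → Prop) (hA : Semi Γ.vert A)
    (hle : ∀ a b, A a b → Γ.Adj a b) : Γ.Subgraph :=
  ⟨⟨{v | Touched Γ.vert A v}, A, fun a b h => ⟨hle a b h, ⟨a, rfl, not_free.2 ⟨b, h⟩⟩,
    ⟨b, rfl, not_free.2 ⟨a, hA.symm h⟩⟩⟩⟩,
    (PreSubgraph.isFeynman_iff hΓ.trivalent _).2 ⟨hA, fun _ => Iff.rfl⟩⟩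

theorem good (hΓ : Γ.IsFeynman) (γ : Γ.Subgraph) : Good Γ.vert Γ.Adj γ.1.adj :=
  hΓ.semi.good (γ.semi hΓ) γ.adj_le

theorem restr (γ : Γ.Subgraph) :
    Restr (Subtype.val : γ.1.toGraph.H → Γ.H) γ.1.toGraph.Adj γ.1.adj :=
  γ.1.restr (γ.1.symm_of_toGraph fun _ _ => γ.2.semi.symm)

theorem presents (hΓ : Γ.IsFeynman) (γ : Γ.Subgraph) :
    Presents γ.toGraph γ.val (fun h => Touched Γ.vert γ.1.adj (Γ.vert h))
      (fun a b => Γ.vert a = Γ.vert b) γ.1.adj where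
  inj := Subtype.val_injective
  surj := γ.2.surj
  range x := by
    rw [← γ.mem_verts hΓ]
    exact ⟨fun ⟨a, ha⟩ => ha ▸ a.2, fun h => ⟨⟨x, h⟩, rfl⟩⟩
  vert_iff a b := Subtype.ext_iff
  adj_iff _ _ := Iff.rfl

theorem comp_eq_iff (γ : Γ.Subgraph) {v w : γ.toGraph.V} :
    γ.toGraph.comp v = γ.toGraph.comp w ↔ HalfEdge.Joined Γ.vert γ.1.adj v.1 w.1 :=
  PreGraph.comp_eq_iff.trans (γ.1.openEmb.joined_iff γ.restr)

theorem legs_comp (γ : Γ.Subgraph) (v : γ.toGraph.V) :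
    γ.toGraph.legs (γ.toGraph.comp v) = HalfEdge.legs Γ.vert γ.1.adj v.1 :=
  (PreGraph.legs_comp v).trans (γ.1.openEmb.legs_eq γ.restr v)

theorem free_iff (γ : Γ.Subgraph) (h : γ.toGraph.H) :
    γ.toGraph.IsExternal h ↔ Free γ.1.adj h.1 := OpenEmb.free_iff γ.restr

theorem mem_of_joined (γ : Γ.Subgraph) {v w : Γ.V} (hv : v ∈ γ.1.verts)
    (h : HalfEdge.Joined Γ.vert γ.1.adj v w) : w ∈ γ.1.verts := by
  obtain ⟨w, rfl⟩ := γ.1.openEmb.joined_range γ.restr (x := ⟨v, hv⟩) h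
  exact w.2

theorem legs_of_not_mem (hΓ : Γ.IsFeynman) (γ : Γ.Subgraph) {v : Γ.V} (hv : v ∉ γ.1.verts) :
    HalfEdge.legs Γ.vert γ.1.adj v = 3 := by
  rw [OpenEmb.legs_of_untouched (fun _ _ => (γ.semi hΓ).symm), hΓ.trivalent]
  rintro a rfl b hab
  exact hv (γ.1.adj_le _ _ hab).2.1

theorem free_of_not_mem (γ : Γ.Subgraph) {a : Γ.H} (ha : Γ.vert a ∉ γ.1.verts) : Free γ.1.adj a :=
  fun _ hab => ha (γ.1.adj_le _ _ hab).2.1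

theorem joined_of_not_mem (γ : Γ.Subgraph) {v w : Γ.V} (hv : v ∉ γ.1.verts)
    (h : HalfEdge.Joined Γ.vert γ.1.adj v w) : v = w := by
  refine ((h.closed (P := fun w => v = w) ?_).1 rfl)
  intro a b hab
  constructor
  · rintro rfl; exact absurd (γ.1.adj_le _ _ hab).2.1 hv
  · rintro rfl; exact absurd (γ.1.adj_le _ _ hab).2.2 hv

theorem bridged_iff (hΓ : Γ.IsFeynman) (γ : Γ.Subgraph) (a b : Γ.H) :
    γ.Bridged a b ↔ Bridge Γ.vert γ.1.adj a b := by
  constructor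
  · rintro ⟨a', b', rfl, rfl, hne, hc, hl⟩
    rw [comp_eq_iff] at hc
    rw [legs_comp] at hl
    exact ⟨fun h => hne (Subtype.ext (Subtype.ext h)), (γ.free_iff _).1 a'.2, (γ.free_iff _).1 b'.2,
      hc, hl⟩
  · rintro ⟨hne, ha, hb, hj, hl⟩
    have hav : Γ.vert a ∈ γ.1.verts := by
      by_contra hv
      rw [γ.legs_of_not_mem hΓ hv] at hl
      omega
    have hbv := γ.mem_of_joined hav hj
    refine ⟨⟨⟨a, hav⟩, (γ.free_iff _).2 ha⟩, ⟨⟨b, hbv⟩, (γ.free_iff _).2 hb⟩, rfl, rfl, ?_, ?_, ?_⟩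
    · exact fun h => hne (congrArg (fun x => x.1.1) h)
    · exact γ.comp_eq_iff.2 hj
    · exact (γ.legs_comp _).trans hl

theorem linked_iff (hΓ : Γ.IsFeynman) (γ : Γ.Subgraph) (a b : Γ.H) :
    γ.Linked a b ↔ HalfEdge.Linked Γ.vert Γ.Adj γ.1.adj a b := by
  rw [Linked, HalfEdge.Linked]
  simp_rw [γ.bridged_iff hΓ]

theorem isWhole_iff (γ : Γ.Subgraph) (v : γ.toGraph.V) :
    γ.IsWhole (γ.toGraph.comp v) ↔
      ∀ k, Free γ.1.adj k → HalfEdge.Joined Γ.vert γ.1.adj (Γ.vert k) v.1 → Free Γ.Adj k := by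
  constructor
  · intro h k hk hj
    exact h ⟨⟨k, γ.mem_of_joined v.2 hj.symm⟩, (γ.free_iff _).2 hk⟩ (γ.comp_eq_iff.2 hj)
  · intro h k hk
    exact h _ ((γ.free_iff _).1 k.2) (γ.comp_eq_iff.1 hk)

end Subgraph

/-- The half-edges of the quotient of `B` by `A`. -/
def Kept {H V : Type} (vert : H → V) (B A : H → H → Prop) (h : H) : Prop :=
  End vert A h ∧ ∃ k, Free A k ∧ HalfEdge.Joined vert A (vert k) (vert h) ∧ ¬ Free B k

namespace Subgraph

/-- The half-edge of `Γ` underlying a half-edge of the quotient. -/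
def up (γ : Γ.Subgraph) : (Γ.quotient γ).H → Γ.H := QuotH.under

/-- The two kinds of half-edges of a quotient have one description. A vertex outside `γ` is itself a
three-legged component of the edges of `γ`, and it is not a component of `Γ` because it is at an
edge of `Γ`. -/
theorem range_up (hΓ : Γ.IsFeynman) (γ : Γ.Subgraph) (h : Γ.H) :
    (∃ a, γ.up a = h) ↔ Kept Γ.vert Γ.Adj γ.1.adj h := by
  constructor
  · rintro ⟨a | a, rfl⟩
    · refine ⟨⟨γ.free_of_not_mem a.2, γ.legs_of_not_mem hΓ a.2⟩, ?_⟩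
      obtain ⟨k, hk, hk'⟩ := hΓ.touched (Γ.vert a.1)
      exact ⟨k, γ.free_of_not_mem (by rw [hk]; exact a.2), .of_eq hk, hk'⟩
    · obtain ⟨h3, hw⟩ := a.2
      rw [isWhole_iff] at hw
      push Not at hw
      exact ⟨⟨(γ.free_iff _).1 a.1.2, (γ.legs_comp _).symm.trans h3⟩, hw⟩
  · rintro ⟨⟨hf, h3⟩, k, hk, hj, hkB⟩
    by_cases hv : Γ.vert h ∈ γ.1.verts
    · refine ⟨.inr ⟨⟨⟨h, hv⟩, (γ.free_iff _).2 hf⟩, (γ.legs_comp _).trans h3, ?_⟩, rfl⟩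
      intro hw
      rw [isWhole_iff] at hw
      exact hkB (hw k hk hj)
    · exact ⟨.inl ⟨h, hv⟩, rfl⟩

theorem up_injective (γ : Γ.Subgraph) : Function.Injective γ.up := by
  rintro (a | a) (b | b) h
  · exact congrArg Sum.inl (Subtype.ext h)
  · have h : a.1 = b.1.1.1 := h
    exact absurd b.1.1.2 (h ▸ a.2)
  · have h : a.1.1.1 = b.1 := h
    exact absurd a.1.1.2 (h ▸ b.2)
  · exact congrArg Sum.inr (Subtype.ext (Subtype.ext (Subtype.ext h)))

theorem quotient_vert_iff (γ : Γ.Subgraph) (a b : (Γ.quotient γ).H) :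
    (Γ.quotient γ).vert a = (Γ.quotient γ).vert b ↔
      HalfEdge.Joined Γ.vert γ.1.adj (Γ.vert (γ.up a)) (Γ.vert (γ.up b)) := by
  rcases a with a | a <;> rcases b with b | b
  · refine Iff.trans (b := Γ.vert a.1 = Γ.vert b.1) ?_ ⟨fun h => .of_eq h, γ.joined_of_not_mem a.2⟩
    exact Sum.inl_injective.eq_iff.trans Subtype.ext_iff
  · refine iff_of_false (fun h => by cases h) fun h => a.2 (γ.mem_of_joined b.1.1.2 h.symm)
  · refine iff_of_false (fun h => by cases h) fun h => b.2 (γ.mem_of_joined a.1.1.2 h)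
  · exact (Sum.inr_injective.eq_iff.trans Subtype.ext_iff).trans γ.comp_eq_iff

theorem quotient_surj (hΓ : Γ.IsFeynman) (γ : Γ.Subgraph) :
    Function.Surjective (Γ.quotient γ).vert := by
  rintro (⟨v, hv⟩ | ⟨C, hC⟩)
  · obtain ⟨a, rfl⟩ := hΓ.surj v
    exact ⟨.inl ⟨a, hv⟩, rfl⟩
  · have hpos : 0 < γ.toGraph.legs C := by rw [hC.1]; norm_num
    obtain ⟨⟨a, rfl⟩⟩ := (Nat.card_pos_iff.1 hpos).1
    exact ⟨.inr ⟨a, hC⟩, rfl⟩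

theorem model (hΓ : Γ.IsFeynman) (γ : Γ.Subgraph) :
    Model Γ.vert γ.1.adj Γ.Adj (Γ.quotient γ).vert (Γ.quotient γ).Adj γ.up where
  inj := γ.up_injective
  surj := γ.quotient_surj hΓ
  isEnd a := ((γ.range_up hΓ _).1 ⟨a, rfl⟩).1
  cover h hh hB := (γ.range_up hΓ _).2 ⟨hh, h, hh.1, .refl _, hB⟩
  closed a h hh hj := by
    obtain ⟨he, k, hk, hkj, hkB⟩ := (γ.range_up hΓ _).1 ⟨a, rfl⟩
    exact (γ.range_up hΓ _).2 ⟨he.of_joined hh hj.symm, k, hk, hkj.trans hj.symm, hkB⟩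
  vert_iff := γ.quotient_vert_iff
  adj_iff a b := and_congr_right fun _ => γ.linked_iff hΓ _ _

theorem quotient_presents (hΓ : Γ.IsFeynman) (γ : Γ.Subgraph) :
    Presents (Γ.quotient γ) γ.up (Kept Γ.vert Γ.Adj γ.1.adj)
      (fun a b => HalfEdge.Joined Γ.vert γ.1.adj (Γ.vert a) (Γ.vert b))
      (fun a b => a ≠ b ∧ HalfEdge.Linked Γ.vert Γ.Adj γ.1.adj a b) where
  inj := γ.up_injective
  surj := γ.quotient_surj hΓ
  range := γ.range_up hΓ
  vert_iff := γ.quotient_vert_iff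
  adj_iff a b := by
    rw [(γ.model hΓ).adj_iff, γ.up_injective.ne_iff]

/-- Quotients of Feynman graphs are Feynman graphs. -/
theorem quotient_isFeynman (hΓ : Γ.IsFeynman) (γ : Γ.Subgraph) : (Γ.quotient γ).IsFeynman := by
  have m := γ.model hΓ
  refine PreGraph.isFeynman_iff.2 ⟨m.semi hΓ.semi (γ.semi hΓ) γ.adj_le (γ.good hΓ), fun v => ?_⟩
  obtain ⟨a, rfl⟩ := γ.quotient_surj hΓ v
  obtain ⟨he, k, hk, hkj, hkB⟩ := (γ.range_up hΓ _).1 ⟨a, rfl⟩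
  obtain ⟨b, rfl⟩ := m.closed a k hk hkj
  refine ⟨b, (m.vert_iff _ _).2 hkj, ?_⟩
  rwa [m.free_iff hΓ.semi.toMatching (γ.semi hΓ) γ.adj_le (γ.good hΓ)]

end Subgraph

end Sub

end PreGraph

/-! ### Ascent of the axioms from a subgraph and its quotient. -/

namespace HalfEdge.Model

variable {H V H' V' : Type} {vert : H → V} {A B : H → H → Prop} {vert' : H' → V'}
  {B' : H' → H' → Prop} {u : H' → H}

theorem legs_of_whole (hB : Matching B) (hA : Matching A) (hle : ∀ a b, A a b → B a b) {v : V}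
    (h : ∀ k, Free A k → Joined vert A (vert k) v → Free B k) : legs vert B v = legs vert A v := by
  refine Nat.card_congr (Equiv.subtypeEquivRight fun k => ⟨?_, ?_⟩)
  · rintro ⟨hk, hj⟩
    exact ⟨hk.mono hle, (joined_of_whole hB hA hle h hj.symm).symm⟩
  · rintro ⟨hk, hj⟩
    exact ⟨h k hk hj, hj.mono hle⟩

theorem exists_joined (m : Model vert A B vert' B' u) (hB : Matching B) (hA : Semi vert A)
    (hle : ∀ a b, A a b → B a b) (hG : Good vert B A) {v : V} {k : H} (hk : Free A k)
    (hkv : Joined vert A (vert k) v) (hkB : ¬ Free B k) : ∃ a, Joined vert B (vert (u a)) v := by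
  obtain ⟨e, he, hke⟩ := hG.exists_end hA hk hkB
  obtain ⟨a, rfl⟩ := m.cover e he (by rwa [← linked_free_iff hG hB hke])
  exact ⟨a, (hke.joined hle).symm.trans (hkv.mono hle)⟩

/-- A graph satisfies the axioms if a subgraph and the quotient do. -/
theorem semi_of_quotient [Finite H] (m : Model vert A B vert' B' u) (hB : Matching B)
    (hA : Semi vert A) (hle : ∀ a b, A a b → B a b) (hG : Good vert B A) (hB' : Semi vert' B') :
    Semi vert B where
  toMatching := hB
  tri := hA.tri
  legs_eq v := by
    -- Either the component of `v` in `A` is a component of `B` and has the same legs, or it has an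
    -- exit whose chain leads to a vertex of the quotient, where the legs have been counted.
    by_cases hw : ∀ k, Free A k → Joined vert A (vert k) v → Free B k
    · rw [legs_of_whole hB hA.toMatching hle hw]
      exact hA.legs_eq v
    · push Not at hw
      obtain ⟨k, hk, hkv, hkB⟩ := hw
      obtain ⟨a, ha⟩ := m.exists_joined hB hA hle hG hk hkv hkB
      rw [← legs_congr ha, ← m.legs_eq hB hA hle hG]
      exact hB'.legs_eq _
  onePI := m.onePI_of_quotient hB hA hle hG hB'

end HalfEdge.Model

/-! ### Disjoint unions and insertions at vertices. -/

namespace PreGraph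

open HalfEdge

theorem IsConnected.legs_eq {Γ : PreGraph} (h : Γ.IsConnected) (v : Γ.V) :
    HalfEdge.legs Γ.vert Γ.Adj v = Nat.card Γ.Ex :=
  Nat.card_congr (Equiv.subtypeEquivRight fun _ => and_iff_left (h.2 _ _))

section Sum

variable (Γ Γ' : PreGraph)

theorem sum_openEmb_inl : OpenEmb Γ.vert (Γ.sum Γ').vert Sum.inl Sum.inl where
  inj := Sum.inl_injective
  injV := Sum.inl_injective
  comm _ := rfl
  full a x h := by
    rcases a with a | a
    · exact ⟨a, rfl⟩
    · cases h

theorem sum_openEmb_inr : OpenEmb Γ'.vert (Γ.sum Γ').vert Sum.inr Sum.inr where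
  inj := Sum.inr_injective
  injV := Sum.inr_injective
  comm _ := rfl
  full a x h := by
    rcases a with a | a
    · cases h
    · exact ⟨a, rfl⟩

theorem liftRel_restr_inl {X Y : Type} {R : X → X → Prop} {S : Y → Y → Prop}
    (hR : ∀ a b, R a b → R b a) (hS : ∀ a b, S a b → S b a) :
    Restr (Sum.inl : X → X ⊕ Y) R (Sum.LiftRel R S) where
  symm a b h := by
    cases h with
    | inl h => exact .inl (hR _ _ h)
    | inr h => exact .inr (hS _ _ h)
  iff a b := Sum.liftRel_inl_inl.symm
  closed a y h := by
    cases h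
    exact ⟨_, rfl⟩

theorem liftRel_restr_inr {X Y : Type} {R : X → X → Prop} {S : Y → Y → Prop}
    (hR : ∀ a b, R a b → R b a) (hS : ∀ a b, S a b → S b a) :
    Restr (Sum.inr : Y → X ⊕ Y) S (Sum.LiftRel R S) where
  symm := (liftRel_restr_inl hR hS).symm
  iff a b := Sum.liftRel_inr_inr.symm
  closed a y h := by
    cases h
    exact ⟨_, rfl⟩

theorem liftRel_semi {R : Γ.H → Γ.H → Prop} {S : Γ'.H → Γ'.H → Prop} (hR : Semi Γ.vert R)
    (hS : Semi Γ'.vert S) : Semi (Γ.sum Γ').vert (Sum.LiftRel R S) :=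
  (Γ.sum_openEmb_inl Γ').semi_union (liftRel_restr_inl (fun _ _ => hR.symm) fun _ _ => hS.symm)
    (Γ.sum_openEmb_inr Γ') (liftRel_restr_inr (fun _ _ => hR.symm) fun _ _ => hS.symm)
    (by rintro (v | v); exacts [.inl ⟨v, rfl⟩, .inr ⟨v, rfl⟩]) hR hS

/-- Disjoint unions of Feynman graphs are Feynman graphs. -/
theorem sum_isFeynman {Γ Γ' : PreGraph} (h : Γ.IsFeynman) (h' : Γ'.IsFeynman) :
    (Γ.sum Γ').IsFeynman := by
  refine isFeynman_iff.2 ⟨Γ.liftRel_semi Γ' h.semi h'.semi, ?_⟩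
  rintro (v | v)
  · obtain ⟨a, rfl, ha⟩ := h.touched v
    obtain ⟨b, hb⟩ := not_free.1 ha
    exact ⟨.inl a, rfl, not_free.2 ⟨.inl b, .inl hb⟩⟩
  · obtain ⟨a, rfl, ha⟩ := h'.touched v
    obtain ⟨b, hb⟩ := not_free.1 ha
    exact ⟨.inr a, rfl, not_free.2 ⟨.inr b, .inr hb⟩⟩

end Sum

section InsertVertex

variable {Γ₂ Γ₁ : PreGraph} (v : Γ₂.V) (f : Γ₁.Ex ≃ {h : Γ₂.H // Γ₂.vert h = v})

open Classical in
/-- The inclusion of the half-edges of the inserted graph. -/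
noncomputable def vertexIncl (h : Γ₁.H) : (Γ₂.insertVertex Γ₁ v f).H :=
  if hx : Γ₁.IsExternal h then .inl (f ⟨h, hx⟩).1 else .inr ⟨h, hx⟩

/-- The edges of the inserted graph. -/
def vertexAdj : (Γ₂.insertVertex Γ₁ v f).H → (Γ₂.insertVertex Γ₁ v f).H → Prop :=
  Sum.LiftRel (fun _ _ => False) (fun a b => Γ₁.Adj a.1 b.1)

theorem vertexIncl_ext (x : Γ₁.Ex) : vertexIncl v f x.1 = .inl (f x).1 := dif_pos x.2

theorem vertexIncl_int (h : {h // ¬ Γ₁.IsExternal h}) : vertexIncl v f h.1 = .inr h := dif_neg h.2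

theorem insertVertex_vert_inl_of_eq (a : Γ₂.H) (ha : Γ₂.vert a = v) :
    (Γ₂.insertVertex Γ₁ v f).vert (.inl a) = .inr (Γ₁.vert (f.symm ⟨a, ha⟩).1) := dif_pos ha

theorem insertVertex_vert_inl_of_ne (a : Γ₂.H) (ha : Γ₂.vert a ≠ v) :
    (Γ₂.insertVertex Γ₁ v f).vert (.inl a) = .inl ⟨Γ₂.vert a, ha⟩ := dif_neg ha

theorem vertex_openEmb : OpenEmb Γ₁.vert (Γ₂.insertVertex Γ₁ v f).vert (vertexIncl v f) Sum.inr where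
  inj a b h := by
    by_cases ha : Γ₁.IsExternal a <;> by_cases hb : Γ₁.IsExternal b
    · rw [vertexIncl_ext v f ⟨a, ha⟩, vertexIncl_ext v f ⟨b, hb⟩] at h
      exact congrArg Subtype.val (f.injective (Subtype.ext (Sum.inl_injective h)))
    · rw [vertexIncl_ext v f ⟨a, ha⟩, vertexIncl_int v f ⟨b, hb⟩] at h
      cases h
    · rw [vertexIncl_int v f ⟨a, ha⟩, vertexIncl_ext v f ⟨b, hb⟩] at h
      cases h
    · rw [vertexIncl_int v f ⟨a, ha⟩, vertexIncl_int v f ⟨b, hb⟩] at h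
      exact congrArg Subtype.val (Sum.inr_injective h)
  injV := Sum.inr_injective
  comm a := by
    by_cases ha : Γ₁.IsExternal a
    · rw [vertexIncl_ext v f ⟨a, ha⟩, insertVertex_vert_inl_of_eq v f _ (f ⟨a, ha⟩).2]
      simp only [Subtype.coe_eta, Equiv.symm_apply_apply]
      rfl
    · rw [vertexIncl_int v f ⟨a, ha⟩]
      rfl
  full a x h := by
    rcases a with a | a
    · by_cases ha : Γ₂.vert a = v
      · refine ⟨(f.symm ⟨a, ha⟩).1, ?_⟩
        rw [vertexIncl_ext v f (f.symm ⟨a, ha⟩)]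
        simp only [Equiv.apply_symm_apply]
        rfl
      · rw [insertVertex_vert_inl_of_ne v f a ha] at h
        cases h
    · exact ⟨a.1, vertexIncl_int v f a⟩

theorem vertex_restr (h₁ : Matching Γ₁.Adj) :
    Restr (vertexIncl v f) Γ₁.Adj (vertexAdj v f) where
  symm a b h := by
    cases h with
    | inl h => exact h.elim
    | inr h => exact .inr (h₁.symm h)
  iff a b := by
    by_cases ha : Γ₁.IsExternal a
    · rw [vertexIncl_ext v f ⟨a, ha⟩]
      refine iff_of_false (ha b) ?_
      intro h
      generalize vertexIncl v f b = y at h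
      cases h with
      | inl h => exact h
    by_cases hb : Γ₁.IsExternal b
    · rw [vertexIncl_ext v f ⟨b, hb⟩]
      refine iff_of_false (fun h => hb a (h₁.symm h)) ?_
      intro h
      generalize vertexIncl v f a = y at h
      cases h with
      | inl h => exact h
    rw [vertexIncl_int v f ⟨a, ha⟩, vertexIncl_int v f ⟨b, hb⟩]
    exact ⟨fun h => .inr h, fun h => by cases h with | inr h => exact h⟩
  closed a y h := by
    generalize vertexIncl v f a = x at h
    cases h with
    | inl h => exact h.elim
    | @inr c d h => exact ⟨d.1, vertexIncl_int v f d⟩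

theorem vertexAdj_le (a b) (h : vertexAdj v f a b) : (Γ₂.insertVertex Γ₁ v f).Adj a b := by
  cases h with
  | inl h => exact h.elim
  | inr h => exact .inr h

theorem insertVertex_matching (h₁ : Matching Γ₁.Adj) (h₂ : Matching Γ₂.Adj) :
    Matching (Γ₂.insertVertex Γ₁ v f).Adj where
  symm h := by
    cases h with
    | inl h => exact .inl (h₂.symm h)
    | inr h => exact .inr (h₁.symm h)
  irrefl a h := by
    cases h with
    | inl h => exact h₂.irrefl _ h
    | inr h => exact h₁.irrefl _ h
  unique h h' := by
    cases h with
    | inl h =>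
      cases h' with
      | inl h' => rw [h₂.unique h h']
    | inr h =>
      cases h' with
      | inr h' => rw [Subtype.ext (h₁.unique h h')]

theorem insertVertex_tri (h₁ : Semi Γ₁.vert Γ₁.Adj) (h₂ : Semi Γ₂.vert Γ₂.Adj)
    (w : (Γ₂.insertVertex Γ₁ v f).V) :
    Nat.card {h // (Γ₂.insertVertex Γ₁ v f).vert h = w} = 3 := by
  rcases w with w | w
  · rw [← h₂.tri w.1]
    have hw : ∀ b : {h // Γ₂.vert h = w.1},
        (Γ₂.insertVertex Γ₁ v f).vert (.inl b.1) = .inl w := fun b => by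
      rw [insertVertex_vert_inl_of_ne v f b.1 (by rw [b.2]; exact w.2)]
      exact congrArg Sum.inl (Subtype.ext b.2)
    refine (Nat.card_congr (Equiv.ofBijective (fun b => ⟨.inl b.1, hw b⟩) ⟨?_, ?_⟩)).symm
    · intro b c h
      exact Subtype.ext (Sum.inl_injective (congrArg Subtype.val h))
    · rintro ⟨b | b, hb⟩
      · by_cases hv : Γ₂.vert b = v
        · rw [insertVertex_vert_inl_of_eq v f b hv] at hb
          cases hb
        · have hb' := hb
          rw [insertVertex_vert_inl_of_ne v f b hv] at hb'
          exact ⟨⟨b, congrArg Subtype.val (Sum.inl_injective hb')⟩, rfl⟩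
      · cases hb
  · exact ((vertex_openEmb v f).card_fiber w).symm.trans (h₁.tri w)

theorem vertexAdj_semi (h₁ : Semi Γ₁.vert Γ₁.Adj) (h₂ : Semi Γ₂.vert Γ₂.Adj) :
    Semi (Γ₂.insertVertex Γ₁ v f).vert (vertexAdj v f) := by
  refine (vertex_openEmb v f).semi_extend (vertex_restr v f h₁.toMatching) ?_
    (insertVertex_tri v f h₁ h₂) h₁
  intro a b h
  cases h with
  | inl h => exact h.elim
  | @inr c d h => exact ⟨c.1, vertexIncl_int v f c⟩

theorem vertexAdj_free_inl (a : Γ₂.H) : Free (vertexAdj (Γ₁ := Γ₁) v f) (.inl a) := by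
  intro k h
  cases h with
  | inl h => exact h

theorem vertexAdj_legs (h₁ : Semi Γ₁.vert Γ₁.Adj) (h₂ : Semi Γ₂.vert Γ₂.Adj)
    (hc : Γ₁.IsConnected) (w : (Γ₂.insertVertex Γ₁ v f).V) :
    HalfEdge.legs (Γ₂.insertVertex Γ₁ v f).vert (vertexAdj v f) w = 3 := by
  rcases w with w | w
  · refine (OpenEmb.legs_of_untouched (fun _ _ => (vertexAdj_semi v f h₁ h₂).symm) ?_).trans
      (insertVertex_tri v f h₁ h₂ _)
    rintro (a | a) ha
    · exact vertexAdj_free_inl v f a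
    · cases ha
  · refine ((vertex_openEmb v f).legs_eq (vertex_restr v f h₁.toMatching) w).symm.trans ?_
    rw [hc.legs_eq, Nat.card_congr f, h₂.tri]

theorem vertexAdj_joined_iff (h₁ : Semi Γ₁.vert Γ₁.Adj) (hc : Γ₁.IsConnected) (a b : Γ₂.H) :
    Γ₂.vert a = Γ₂.vert b ↔ HalfEdge.Joined (Γ₂.insertVertex Γ₁ v f).vert (vertexAdj v f)
      ((Γ₂.insertVertex Γ₁ v f).vert (.inl a)) ((Γ₂.insertVertex Γ₁ v f).vert (.inl b)) := by
  have r := vertex_restr v f h₁.toMatching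
  have e := vertex_openEmb v f
  have hout : ∀ a b : Γ₂.H, Γ₂.vert a = v → HalfEdge.Joined (Γ₂.insertVertex Γ₁ v f).vert
      (vertexAdj v f) ((Γ₂.insertVertex Γ₁ v f).vert (.inl a))
      ((Γ₂.insertVertex Γ₁ v f).vert (.inl b)) → Γ₂.vert b = v := by
    intro a b ha h
    rw [insertVertex_vert_inl_of_eq v f a ha] at h
    obtain ⟨y, hy⟩ := e.joined_range r h
    by_contra hb
    rw [insertVertex_vert_inl_of_ne v f b hb] at hy
    cases hy
  by_cases ha : Γ₂.vert a = v
  · constructor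
    · intro h
      rw [insertVertex_vert_inl_of_eq v f a ha, insertVertex_vert_inl_of_eq v f b (h ▸ ha)]
      exact (e.joined_iff r).1 (hc.2 _ _)
    · intro h
      rw [ha, hout a b ha h]
  · by_cases hb : Γ₂.vert b = v
    · exact iff_of_false (fun h => ha (h.trans hb)) fun h => ha (hout b a hb h.symm)
    · rw [insertVertex_vert_inl_of_ne v f a ha, insertVertex_vert_inl_of_ne v f b hb]
      constructor
      · exact fun h => .of_eq (congrArg Sum.inl (Subtype.ext h))
      · intro h
        have := (h.closed (P := fun w => Sum.inl ⟨Γ₂.vert a, ha⟩ = w) (by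
          intro x y hxy
          cases hxy with
          | inl h => exact h.elim
          | inr h => exact iff_of_false (fun h => by cases h) (fun h => by cases h))).1 rfl
        exact congrArg Subtype.val (Sum.inl_injective this)

/-- Contracting the inserted copy of `Γ₁` gives back `Γ₂`. All components of the inserted edges have
three legs, so there are no bridges and chains are single edges; that the insertion is a Feynman
graph then follows from the ascent of the axioms. -/
theorem vertex_model (h₁ : Semi Γ₁.vert Γ₁.Adj) (h₂ : Semi Γ₂.vert Γ₂.Adj) (hc : Γ₁.IsConnected) :
    Model (Γ₂.insertVertex Γ₁ v f).vert (vertexAdj v f) (Γ₂.insertVertex Γ₁ v f).Adj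
      Γ₂.vert Γ₂.Adj Sum.inl := by
  have hE : ∀ a : Γ₂.H, End (Γ₂.insertVertex Γ₁ v f).vert (vertexAdj v f) (.inl a) := fun a =>
    ⟨vertexAdj_free_inl v f a, vertexAdj_legs v f h₁ h₂ hc _⟩
  have hA := vertexAdj_semi v f h₁ h₂
  have hB := insertVertex_matching v f h₁.toMatching h₂.toMatching
  have hr : ∀ h, Free (vertexAdj v f) h → ∃ a, Sum.inl a = h := by
    rintro (a | a) h
    · exact ⟨a, rfl⟩
    · obtain ⟨b, hb⟩ := not_free.1 a.2
      exact absurd (.inr hb) (h (.inr ⟨b, not_free.2 ⟨_, h₁.symm hb⟩⟩))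
  refine ⟨Sum.inl_injective, h₂.exists_vert, hE, fun h hh _ => hr h hh.1, fun _ h hh _ => hr h hh,
    vertexAdj_joined_iff v f h₁ hc, fun a b => ?_⟩
  have hl : ∀ a b, Γ₂.Adj a b → HalfEdge.Linked (Γ₂.insertVertex Γ₁ v f).vert
      (Γ₂.insertVertex Γ₁ v f).Adj (vertexAdj v f) (.inl a) (.inl b) := fun a b h =>
    .of_rel (.inl h) (vertexAdj_free_inl v f a _)
  constructor
  · rintro h
    exact ⟨fun hab => h₂.irrefl a (by rw [← hab] at h; exact h), hl a b h⟩
  · rintro ⟨hne, h⟩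
    have hf : ¬ Free (Γ₂.insertVertex Γ₁ v f).Adj (.inl a) := fun hf =>
      hne (Sum.inl_injective (linked_eq_of_free hB (hE a) hf h)).symm
    obtain ⟨c, hc⟩ := not_free.1 hf
    cases hc with
    | @inl _ c hc =>
      have hac : a ≠ c := fun hac => h₂.irrefl a (by rw [← hac] at hc; exact hc)
      have := linked_ends_unique hB hA.toMatching (hE a) (hE b) (hE c) h (hl a c hc)
        (fun h => hne (Sum.inl_injective h)) (fun h => hac (Sum.inl_injective h))
      exact Sum.inl_injective this ▸ hc

theorem vertex_good (h₁ : Semi Γ₁.vert Γ₁.Adj) (h₂ : Semi Γ₂.vert Γ₂.Adj) (hc : Γ₁.IsConnected) :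
    Good (Γ₂.insertVertex Γ₁ v f).vert (Γ₂.insertVertex Γ₁ v f).Adj (vertexAdj v f) := by
  intro a b hab
  have := hab.2.2.2.2
  rw [vertexAdj_legs v f h₁ h₂ hc] at this
  omega

/-- Insertions at vertices are connected Feynman graphs. -/
theorem insertVertex_closed (h₁ : Γ₁.IsFeynman) (hc₁ : Γ₁.IsConnected) (h₂ : Γ₂.IsFeynman)
    (hc₂ : Γ₂.IsConnected) :
    (Γ₂.insertVertex Γ₁ v f).IsFeynman ∧ (Γ₂.insertVertex Γ₁ v f).IsConnected := by
  have m := vertex_model v f h₁.semi h₂.semi hc₁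
  have hA := vertexAdj_semi v f h₁.semi h₂.semi
  have hB := insertVertex_matching v f h₁.semi.toMatching h₂.semi.toMatching
  have hG := vertex_good v f h₁.semi h₂.semi hc₁
  have r := vertex_restr v f h₁.semi.toMatching
  constructor
  · refine isFeynman_iff.2 ⟨m.semi_of_quotient hB hA (vertexAdj_le v f) hG h₂.semi, ?_⟩
    rintro (w | w)
    · obtain ⟨a, ha, ha'⟩ := h₂.touched w.1
      refine ⟨.inl a, ?_, fun hf => ha' ((m.free_iff hB hA (vertexAdj_le v f) hG a).2 hf)⟩
      rw [insertVertex_vert_inl_of_ne v f a (ha ▸ w.2)]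
      exact congrArg Sum.inl (Subtype.ext ha)
    · obtain ⟨a, ha, ha'⟩ := h₁.touched w
      refine ⟨vertexIncl v f a, ?_, fun hf => ha' ((OpenEmb.free_iff r).2
        (hf.mono (vertexAdj_le v f)))⟩
      rw [(vertex_openEmb v f).comm, ha]
  · have hj : ∀ x, ∃ a : Γ₂.H, HalfEdge.Joined (Γ₂.insertVertex Γ₁ v f).vert
        (Γ₂.insertVertex Γ₁ v f).Adj ((Γ₂.insertVertex Γ₁ v f).vert (.inl a)) x := by
      rintro (w | w)
      · obtain ⟨a, ha⟩ := h₂.surj w.1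
        refine ⟨a, .of_eq ?_⟩
        rw [insertVertex_vert_inl_of_ne v f a (ha ▸ w.2)]
        exact congrArg Sum.inl (Subtype.ext ha)
      · obtain ⟨a, ha⟩ := h₂.surj v
        refine ⟨a, ?_⟩
        rw [insertVertex_vert_inl_of_eq v f a ha]
        exact (((vertex_openEmb v f).joined_iff r).1 (hc₁.2 _ w)).mono (vertexAdj_le v f)
    refine ⟨⟨.inr hc₁.1.some⟩, fun x y => ?_⟩
    obtain ⟨a, ha⟩ := hj x
    obtain ⟨b, hb⟩ := hj y
    exact ha.symm.trans (((m.joined_iff hB hA (vertexAdj_le v f) a b).1 (hc₂.2 _ _)).trans hb)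

end InsertVertex

end PreGraph

/-! ### Insertions at edges. -/

namespace PreGraph

open HalfEdge

theorem IntEdge.exists_adj {Γ : PreGraph} (h : Matching Γ.Adj) (e : Γ.IntEdge) {a : Γ.H}
    (ha : a ∈ e.1) : ∃ b ∈ e.1, Γ.Adj a b := by
  obtain ⟨_, p, q, hpq, rfl⟩ := e
  rcases ha with rfl | rfl
  · exact ⟨q, .inr rfl, hpq⟩
  · exact ⟨p, .inl rfl, h.symm hpq⟩

theorem IntEdge.mem_of_adj {Γ : PreGraph} (h : Matching Γ.Adj) (e : Γ.IntEdge) {a b : Γ.H}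
    (ha : a ∈ e.1) (hab : Γ.Adj a b) : b ∈ e.1 := by
  obtain ⟨c, hc, hac⟩ := e.exists_adj h ha
  rwa [h.unique hab hac]

theorem IntEdge.card {Γ : PreGraph} (h : Matching Γ.Adj) (e : Γ.IntEdge) :
    Nat.card {h : Γ.H // h ∈ e.1} = 2 := by
  obtain ⟨_, p, q, hpq, rfl⟩ := e
  have hne : p ≠ q := by rintro rfl; exact h.irrefl _ hpq
  exact (Nat.card_coe_set_eq _).trans (Set.ncard_pair hne)

section InsertEdge

variable {Γ₂ Γ₁ : PreGraph} (e : Γ₂.IntEdge) (f : Γ₁.Ex ≃ {h : Γ₂.H // h ∈ e.1})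

/-- The edges of the inserted graph. -/
def edgeAdj : (Γ₂.insertEdge Γ₁ e f).H → (Γ₂.insertEdge Γ₁ e f).H → Prop :=
  Sum.LiftRel (fun _ _ => False) Γ₁.Adj

theorem edge_openEmb :
    OpenEmb Γ₁.vert (Γ₂.insertEdge Γ₁ e f).vert (Sum.inr : Γ₁.H → _) (Sum.inr : Γ₁.V → _) where
  inj := Sum.inr_injective
  injV := Sum.inr_injective
  comm _ := rfl
  full a x h := by
    rcases a with a | a
    · cases h
    · exact ⟨a, rfl⟩

theorem edge_openEmb' :
    OpenEmb Γ₂.vert (Γ₂.insertEdge Γ₁ e f).vert (Sum.inl : Γ₂.H → _) (Sum.inl : Γ₂.V → _) where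
  inj := Sum.inl_injective
  injV := Sum.inl_injective
  comm _ := rfl
  full a x h := by
    rcases a with a | a
    · exact ⟨a, rfl⟩
    · cases h

theorem edge_restr (h₁ : Matching Γ₁.Adj) : Restr (Sum.inr : Γ₁.H → _) Γ₁.Adj (edgeAdj e f) :=
  liftRel_restr_inr (fun _ _ h => h) fun _ _ h => h₁.symm h

theorem edgeAdj_le (a b) (h : edgeAdj e f a b) : (Γ₂.insertEdge Γ₁ e f).Adj a b := by
  cases h with
  | inl h => exact h.elim
  | inr h => exact h

theorem insertEdge_matching (h₁ : Matching Γ₁.Adj) (h₂ : Matching Γ₂.Adj) :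
    Matching (Γ₂.insertEdge Γ₁ e f).Adj where
  symm {a b} h := by
    rcases a with a | a <;> rcases b with b | b
    · exact ⟨h₂.symm h.1, fun h' => h.2 h'.symm⟩
    · exact h
    · exact h
    · exact h₁.symm h
  irrefl a h := by
    rcases a with a | a
    · exact h₂.irrefl _ h.1
    · exact h₁.irrefl _ h
  unique {a b c} h h' := by
    have key : ∀ {a b : Γ₂.H} {x : Γ₁.H}, Γ₂.Adj a b ∧ ¬ (a ∈ e.1 ∧ b ∈ e.1) →
        ¬ ∃ hx : Γ₁.IsExternal x, (f ⟨x, hx⟩).1 = a := by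
      rintro a b x ⟨hab, hn⟩ ⟨hx, rfl⟩
      exact hn ⟨(f ⟨x, hx⟩).2, e.mem_of_adj h₂ (f ⟨x, hx⟩).2 hab⟩
    rcases a with a | a <;> rcases b with b | b <;> rcases c with c | c
    · exact congrArg Sum.inl (h₂.unique h.1 h'.1)
    · exact absurd h' (key h)
    · exact absurd h (key h')
    · obtain ⟨hb, hb'⟩ := h
      obtain ⟨hc, hc'⟩ := h'
      exact congrArg Sum.inr (congrArg Subtype.val (f.injective (Subtype.ext (hb'.trans hc'.symm))))
    · obtain ⟨hb, hb'⟩ := h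
      obtain ⟨hc, hc'⟩ := h'
      exact congrArg Sum.inl (hb'.symm.trans hc')
    · exact absurd h' (h.1 c)
    · exact absurd h (h'.1 b)
    · exact congrArg Sum.inr (h₁.unique h h')

theorem insertEdge_tri (h₁ : Semi Γ₁.vert Γ₁.Adj) (h₂ : Semi Γ₂.vert Γ₂.Adj)
    (w : (Γ₂.insertEdge Γ₁ e f).V) :
    Nat.card {h // (Γ₂.insertEdge Γ₁ e f).vert h = w} = 3 := by
  rcases w with w | w
  · exact ((edge_openEmb' e f).card_fiber w).symm.trans (h₂.tri w)
  · exact ((edge_openEmb e f).card_fiber w).symm.trans (h₁.tri w)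

theorem edgeAdj_semi (h₁ : Semi Γ₁.vert Γ₁.Adj) (h₂ : Semi Γ₂.vert Γ₂.Adj) :
    Semi (Γ₂.insertEdge Γ₁ e f).vert (edgeAdj e f) := by
  refine (edge_openEmb e f).semi_extend (edge_restr e f h₁.toMatching) ?_
    (insertEdge_tri e f h₁ h₂) h₁
  intro a b h
  cases h with
  | inl h => exact h.elim
  | @inr c d h => exact ⟨c, rfl⟩

theorem edgeAdj_free_inl (a : Γ₂.H) : Free (edgeAdj (Γ₁ := Γ₁) e f) (.inl a) := by
  intro k h
  cases h with
  | inl h => exact h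

theorem edgeAdj_legs_inl (h₁ : Semi Γ₁.vert Γ₁.Adj) (h₂ : Semi Γ₂.vert Γ₂.Adj) (w : Γ₂.V) :
    HalfEdge.legs (Γ₂.insertEdge Γ₁ e f).vert (edgeAdj e f) (.inl w) = 3 := by
  refine (OpenEmb.legs_of_untouched (fun _ _ => (edgeAdj_semi e f h₁ h₂).symm) ?_).trans
    (insertEdge_tri e f h₁ h₂ _)
  rintro (a | a) ha
  · exact edgeAdj_free_inl e f a
  · cases ha

theorem edgeAdj_legs_inr (h₁ : Matching Γ₁.Adj) (h₂ : Matching Γ₂.Adj) (hc : Γ₁.IsConnected)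
    (w : Γ₁.V) : HalfEdge.legs (Γ₂.insertEdge Γ₁ e f).vert (edgeAdj e f) (.inr w) = 2 := by
  refine ((edge_openEmb e f).legs_eq (edge_restr e f h₁) w).symm.trans ?_
  rw [hc.legs_eq, Nat.card_congr f, e.card h₂]

theorem edgeAdj_bridge (h₁ : Matching Γ₁.Adj) (h₂ : Matching Γ₂.Adj) (hc : Γ₁.IsConnected)
    {x y : Γ₁.H} (hx : Γ₁.IsExternal x) (hy : Γ₁.IsExternal y) (hne : x ≠ y) :
    Bridge (Γ₂.insertEdge Γ₁ e f).vert (edgeAdj e f) (.inr x) (.inr y) := by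
  have r := edge_restr e f h₁
  exact ⟨fun h => hne (Sum.inr_injective h), (OpenEmb.free_iff r).1 hx, (OpenEmb.free_iff r).1 hy,
    ((edge_openEmb e f).joined_iff r).1 (hc.2 _ _), edgeAdj_legs_inr e f h₁ h₂ hc _⟩

theorem edgeAdj_joined_inl {w : Γ₂.V} {y : (Γ₂.insertEdge Γ₁ e f).V}
    (h : HalfEdge.Joined (Γ₂.insertEdge Γ₁ e f).vert (edgeAdj e f) (.inl w) y) : .inl w = y :=
  (h.closed (P := fun y => Sum.inl w = y) (by
    intro x y hxy
    cases hxy with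
    | inl h => exact h.elim
    | inr h => exact iff_of_false (fun h => by cases h) (fun h => by cases h))).1 rfl

/-- The cut edge survives as a chain: from one half of `e` to a leg of `Γ₁`, across the two-legged
`Γ₁`, and out to the other half. -/
theorem edge_linked (h₁ : Matching Γ₁.Adj) (h₂ : Matching Γ₂.Adj) (hc : Γ₁.IsConnected) {a b : Γ₂.H}
    (h : Γ₂.Adj a b) : HalfEdge.Linked (Γ₂.insertEdge Γ₁ e f).vert (Γ₂.insertEdge Γ₁ e f).Adj
      (edgeAdj e f) (.inl a) (.inl b) := by
  by_cases ha : a ∈ e.1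
  · have hb := e.mem_of_adj h₂ ha h
    have hA : (Γ₂.insertEdge Γ₁ e f).Adj (.inl a) (.inr (f.symm ⟨a, ha⟩).1) :=
      ⟨(f.symm ⟨a, ha⟩).2, by simp⟩
    have hB : (Γ₂.insertEdge Γ₁ e f).Adj (.inr (f.symm ⟨b, hb⟩).1) (.inl b) :=
      ⟨(f.symm ⟨b, hb⟩).2, by simp⟩
    have hne : (f.symm ⟨a, ha⟩).1 ≠ (f.symm ⟨b, hb⟩).1 := by
      intro hab
      have := congrArg Subtype.val (f.symm.injective (Subtype.ext hab))
      have hab : a = b := this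
      subst hab
      exact h₂.irrefl _ h
    refine (Linked.of_rel hA (edgeAdj_free_inl e f a _)).trans (.trans (.of_bridge
      (edgeAdj_bridge e f h₁ h₂ hc (f.symm ⟨a, ha⟩).2 (f.symm ⟨b, hb⟩).2 hne)) (.of_rel hB ?_))
    intro h
    cases h
  · exact .of_rel ⟨h, fun h => ha h.1⟩ (edgeAdj_free_inl e f a _)

/-- Since `Γ₁` has two legs, it contributes no ends, and the ends are exactly the half-edges of
`Γ₂`. A chain between two of them is one constructed in `edge_linked`, by uniqueness of the second
end. -/
theorem edge_model (h₁ : Semi Γ₁.vert Γ₁.Adj) (h₂ : Semi Γ₂.vert Γ₂.Adj) (hc : Γ₁.IsConnected) :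
    Model (Γ₂.insertEdge Γ₁ e f).vert (edgeAdj e f) (Γ₂.insertEdge Γ₁ e f).Adj
      Γ₂.vert Γ₂.Adj Sum.inl := by
  have hE : ∀ a : Γ₂.H, End (Γ₂.insertEdge Γ₁ e f).vert (edgeAdj e f) (.inl a) := fun a =>
    ⟨edgeAdj_free_inl e f a, edgeAdj_legs_inl e f h₁ h₂ _⟩
  have hA := edgeAdj_semi e f h₁ h₂
  have hB := insertEdge_matching e f h₁.toMatching h₂.toMatching
  refine ⟨Sum.inl_injective, h₂.exists_vert, hE, ?_, ?_, fun a b => ⟨fun h => ?_, fun h => ?_⟩,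
    fun a b => ?_⟩
  · rintro (a | a) hh -
    · exact ⟨a, rfl⟩
    · have := hh.2
      rw [show (Γ₂.insertEdge Γ₁ e f).vert (.inr a) = .inr (Γ₁.vert a) from rfl,
        edgeAdj_legs_inr e f h₁.toMatching h₂.toMatching hc] at this
      omega
  · rintro a (b | b) - hj
    · exact ⟨b, rfl⟩
    · cases edgeAdj_joined_inl e f hj.symm
  · exact .of_eq (congrArg Sum.inl h)
  · exact Sum.inl_injective (edgeAdj_joined_inl e f h)
  have hl := fun a b h => edge_linked e f h₁.toMatching h₂.toMatching hc (a := a) (b := b) h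
  constructor
  · rintro h
    exact ⟨fun hab => h₂.irrefl a (by rw [← hab] at h; exact h), hl a b h⟩
  · rintro ⟨hne, h⟩
    have hf : ¬ Free (Γ₂.insertEdge Γ₁ e f).Adj (.inl a) := fun hf =>
      hne (Sum.inl_injective (linked_eq_of_free hB (hE a) hf h)).symm
    have hc : ∃ c, Γ₂.Adj a c := by
      obtain ⟨c | x, hc⟩ := not_free.1 hf
      · exact ⟨c, hc.1⟩
      · obtain ⟨hx, rfl⟩ := hc
        obtain ⟨c, -, hc⟩ := e.exists_adj h₂.toMatching (f ⟨x, hx⟩).2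
        exact ⟨c, hc⟩
    obtain ⟨c, hc⟩ := hc
    have hac : a ≠ c := fun hac => h₂.irrefl a (by rw [← hac] at hc; exact hc)
    have := linked_ends_unique hB hA.toMatching (hE a) (hE b) (hE c) h (hl a c hc)
      (fun h => hne (Sum.inl_injective h)) (fun h => hac (Sum.inl_injective h))
    exact Sum.inl_injective this ▸ hc

/-- The only bridges are those across `Γ₁`, and both legs of `Γ₁` are attached to half-edges of
`Γ₂`, which are ends. -/
theorem edge_good (h₁ : Semi Γ₁.vert Γ₁.Adj) (h₂ : Semi Γ₂.vert Γ₂.Adj) :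
    Good (Γ₂.insertEdge Γ₁ e f).vert (Γ₂.insertEdge Γ₁ e f).Adj (edgeAdj e f) := by
  have hE : ∀ a : Γ₂.H, End (Γ₂.insertEdge Γ₁ e f).vert (edgeAdj e f) (.inl a) := fun a =>
    ⟨edgeAdj_free_inl e f a, edgeAdj_legs_inl e f h₁ h₂ _⟩
  have r := edge_restr e f h₁.toMatching
  have hx : ∀ a b, Bridge (Γ₂.insertEdge Γ₁ e f).vert (edgeAdj e f) a b →
      ∃ k : Γ₂.H, (Γ₂.insertEdge Γ₁ e f).Adj a (.inl k) := by
    rintro (a | x) b hab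
    · exact absurd hab ((hE a).free_bridge b)
    · have hx : Γ₁.IsExternal x := (OpenEmb.free_iff r).2 hab.2.1
      exact ⟨(f ⟨x, hx⟩).1, hx, rfl⟩
  intro a b hab _
  obtain ⟨k, hk⟩ := hx a b hab
  obtain ⟨k', hk'⟩ := hx b a hab.symm
  exact ⟨not_free.2 ⟨_, hk'⟩, _, hE k, .of_rel hk (hab.2.1 _)⟩

/-- Insertions at edges are connected Feynman graphs. -/
theorem insertEdge_closed (h₁ : Γ₁.IsFeynman) (hc₁ : Γ₁.IsConnected) (h₂ : Γ₂.IsFeynman)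
    (hc₂ : Γ₂.IsConnected) :
    (Γ₂.insertEdge Γ₁ e f).IsFeynman ∧ (Γ₂.insertEdge Γ₁ e f).IsConnected := by
  have m := edge_model e f h₁.semi h₂.semi hc₁
  have hA := edgeAdj_semi e f h₁.semi h₂.semi
  have hB := insertEdge_matching e f h₁.semi.toMatching h₂.semi.toMatching
  have hG := edge_good e f h₁.semi h₂.semi
  have r := edge_restr e f h₁.semi.toMatching
  constructor
  · refine isFeynman_iff.2 ⟨m.semi_of_quotient hB hA (edgeAdj_le e f) hG h₂.semi, ?_⟩
    rintro (w | w)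
    · obtain ⟨a, ha, ha'⟩ := h₂.touched w
      exact ⟨.inl a, congrArg Sum.inl ha,
        fun hf => ha' ((m.free_iff hB hA (edgeAdj_le e f) hG a).2 hf)⟩
    · obtain ⟨a, ha, ha'⟩ := h₁.touched w
      exact ⟨.inr a, congrArg Sum.inr ha,
        fun hf => ha' ((OpenEmb.free_iff r).2 (hf.mono (edgeAdj_le e f)))⟩
  · have hj : ∀ x, ∃ a : Γ₂.H, HalfEdge.Joined (Γ₂.insertEdge Γ₁ e f).vert
        (Γ₂.insertEdge Γ₁ e f).Adj ((Γ₂.insertEdge Γ₁ e f).vert (.inl a)) x := by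
      rintro (w | w)
      · obtain ⟨a, ha⟩ := h₂.surj w
        exact ⟨a, .of_eq (congrArg Sum.inl ha)⟩
      · have hpos : 0 < Nat.card {h : Γ₂.H // h ∈ e.1} := by
          rw [e.card h₂.semi.toMatching]; norm_num
        have a := (Nat.card_pos_iff.1 hpos).1.some
        have hA : (Γ₂.insertEdge Γ₁ e f).Adj (.inl a.1) (.inr (f.symm a).1) :=
          ⟨(f.symm a).2, by simp⟩
        exact ⟨a.1, (HalfEdge.Joined.of_rel hA).trans
          ((((edge_openEmb e f).joined_iff r).1 (hc₁.2 _ w)).mono (edgeAdj_le e f))⟩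
    refine ⟨⟨.inr hc₁.1.some⟩, fun x y => ?_⟩
    obtain ⟨a, ha⟩ := hj x
    obtain ⟨b, hb⟩ := hj y
    exact ha.symm.trans (((m.joined_iff hB hA (edgeAdj_le e f) a b).1 (hc₂.2 _ _)).trans hb)

end InsertEdge

end PreGraph

theorem insertionClosed : InsertionClosed :=
  ⟨fun Γ₂ Γ₁ v f => PreGraph.insertVertex_closed v f Γ₁.2.1 Γ₁.2.2 Γ₂.2.1 Γ₂.2.2,
    fun Γ₂ Γ₁ e f => PreGraph.insertEdge_closed e f Γ₁.2.1 Γ₁.2.2 Γ₂.2.1 Γ₂.2.2⟩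

/-! ### Subgraphs of a quotient and intermediate subgraphs. -/

namespace HalfEdge

/-- `A` is a union of `A'` and of chains of `B` through the components of `A'`. -/
structure Saturated {H V : Type} (vert : H → V) (A' A B : H → H → Prop) : Prop where
  symm : ∀ {a b}, A a b → A b a
  le₁ : ∀ a b, A' a b → A a b
  le₂ : ∀ a b, A a b → B a b
  bridge : ∀ a b, Bridge vert A' a b → ¬ Free A a → ¬ Free A b

namespace Saturated

variable {H V : Type} {vert : H → V} {A' A B : H → H → Prop}

theorem of_semi [Finite H] (hA' : Semi vert A') (hA : Semi vert A) (h₁ : ∀ a b, A' a b → A a b)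
    (h₂ : ∀ a b, A a b → B a b) : Saturated vert A' A B :=
  ⟨hA.symm, h₁, h₂, fun a b hab ha => (hA.good hA' h₁ a b hab ha).1⟩

theorem matching (s : Saturated vert A' A B) (hB : Matching B) : Matching A :=
  ⟨s.symm, fun a h => hB.irrefl a (s.le₂ _ _ h), fun h h' => hB.unique (s.le₂ _ _ h) (s.le₂ _ _ h')⟩

theorem adj_iff (s : Saturated vert A' A B) (hB : Matching B) {p q : H} (hp : ¬ Free A p) :
    A p q ↔ B p q := by
  refine ⟨s.le₂ _ _, fun h => ?_⟩
  obtain ⟨r, hr⟩ := not_free.1 hp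
  rwa [hB.unique h (s.le₂ _ _ hr)]

theorem linked_of_linked (s : Saturated vert A' A B) {p q : H} (h : Linked vert A A' p q) :
    Linked vert B A' p q :=
  eqvGen_map id (by
    rintro a b (h | h)
    · exact .rel _ _ (.inl ⟨s.le₂ _ _ h.1, h.2⟩)
    · exact .rel _ _ (.inr h)) h

/-- A chain of `B` that meets one half-edge on an edge of `A` stays on edges of `A`: partners in `B`
are unique, and `bridge` carries the property across components of `A'`. -/
theorem linked (s : Saturated vert A' A B) (hB : Matching B) (hA' : Matching A') {p q : H}
    (hp : ¬ Free A p) (h : Linked vert B A' p q) : Linked vert A A' p q ∧ ¬ Free A q := by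
  refine (eqvGen_closed (P := fun q => Linked vert A A' p q ∧ ¬ Free A q) ?_ h).1 ⟨.refl _, hp⟩
  have step : ∀ a b, ((B a b ∧ ¬ A' a b) ∨ Bridge vert A' a b) →
      (Linked vert A A' p a ∧ ¬ Free A a) → Linked vert A A' p b ∧ ¬ Free A b := by
    rintro a b (⟨h, h'⟩ | h) ⟨hl, ha⟩
    · have hab := (s.adj_iff hB ha).2 h
      exact ⟨hl.trans (.of_rel hab h'), not_free.2 ⟨a, s.symm hab⟩⟩
    · exact ⟨hl.trans (.of_bridge h), s.bridge a b h ha⟩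
  exact fun a b hab => ⟨step a b hab, step b a (hab.imp
    (fun h => ⟨hB.symm h.1, fun h' => h.2 (hA'.symm h')⟩) Bridge.symm)⟩

theorem good (s : Saturated vert A' A B) (hB : Matching B) (hA' : Matching A')
    (hG : Good vert B A') : Good vert A A' := by
  intro a b hab ha
  refine ⟨s.bridge a b hab ha, ?_⟩
  obtain ⟨k, hk, hl⟩ := (hG a b hab fun h => ha (h.mono s.le₂)).2
  exact ⟨k, hk, (s.linked hB hA' ha hl).1⟩

end Saturated

namespace Model

variable {H V H' V' : Type} {vert : H → V} {A' A B : H → H → Prop} {vert' : H' → V'}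
  {B' D : H' → H' → Prop} {u : H' → H}

/-- The edges of the quotient which come from edges in `A`. -/
def down (u : H' → H) (B' : H' → H' → Prop) (A : H → H → Prop) (a b : H') : Prop :=
  B' a b ∧ ¬ Free A (u a)

/-- The edges of `A'` and those which contribute to edges in `D`. -/
def lifted (vert : H → V) (A' B : H → H → Prop) (u : H' → H) (D : H' → H' → Prop) (p q : H) : Prop :=
  A' p q ∨ (B p q ∧ ∃ a b, D a b ∧ Linked vert B A' p (u a))

/-- The half-edges and vertices of a quotient by `A'` depend on `A'` only up to components that are
deleted, so the same `u` presents the quotient of `A`. This transfers the axioms between `A` and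
`down` in both directions. -/
theorem down_model (m : Model vert A' B vert' B' u) (hB : Matching B) (hA' : Semi vert A')
    (s : Saturated vert A' A B) : Model vert A' A vert' (down u B' A) u where
  inj := m.inj
  surj := m.surj
  isEnd := m.isEnd
  cover h hh hA := m.cover h hh fun hf => hA (hf.mono s.le₂)
  closed := m.closed
  vert_iff := m.vert_iff
  adj_iff a b := by
    rw [down, m.adj_iff]
    constructor
    · rintro ⟨⟨hne, hl⟩, ha⟩
      exact ⟨hne, (s.linked hB hA'.toMatching ha hl).1⟩
    · rintro ⟨hne, hl⟩
      refine ⟨⟨hne, s.linked_of_linked hl⟩, fun hf => hne (m.inj ?_)⟩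
      exact (linked_eq_of_free (s.matching hB) (m.isEnd a) hf hl).symm

theorem lifted_saturated (hB : Matching B) (hA' : Semi vert A')
    (hle : ∀ a b, A' a b → B a b) (hG : Good vert B A') :
    Saturated vert A' (lifted vert A' B u D) B where
  symm {p q} := by
    rintro (h | ⟨h, a, b, hab, hl⟩)
    · exact .inl (hA'.symm h)
    · by_cases h' : A' p q
      · exact .inl (hA'.symm h')
      · exact .inr ⟨hB.symm h, a, b, hab, (Linked.of_rel h h').symm.trans hl⟩
  le₁ _ _ h := .inl h
  le₂ p q := by
    rintro (h | h)
    · exact hle _ _ h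
    · exact h.1
  bridge p q hpq hp := by
    obtain ⟨r, hr | ⟨hr, a, b, hab, hl⟩⟩ := not_free.1 hp
    · exact absurd hr (hpq.2.1 _)
    · obtain ⟨t, ht⟩ := not_free.1 (hG p q hpq (not_free.2 ⟨r, hr⟩)).1
      exact not_free.2 ⟨t, .inr ⟨ht, a, b, hab, (Linked.of_bridge hpq.symm).trans hl⟩⟩

/-- An edge of `A` outside `A'` lies on a chain which, by `Good`, reaches a half-edge of the
quotient; by saturation the quotient edge there comes from `A`. With `down_lifted` this makes `down`
and `lifted` mutually inverse. -/
theorem lifted_down [Finite H] (m : Model vert A' B vert' B' u) (hB : Matching B)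
    (hA' : Semi vert A') (hle : ∀ a b, A' a b → B a b) (hG : Good vert B A')
    (s : Saturated vert A' A B) (p q : H) : lifted vert A' B u (down u B' A) p q ↔ A p q := by
  constructor
  · rintro (h | ⟨h, a, b, hab, hl⟩)
    · exact s.le₁ _ _ h
    · exact (s.adj_iff hB (s.linked hB hA'.toMatching hab.2 hl.symm).2).2 h
  · intro h
    by_cases h' : A' p q
    · exact .inl h'
    have hpA : ¬ Free A p := not_free.2 ⟨q, h⟩
    have hpB : ¬ Free B p := not_free.2 ⟨q, s.le₂ _ _ h⟩
    have hp := free_of_rel hB hle (s.le₂ _ _ h) h'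
    obtain ⟨k, hk, hl⟩ := hG.exists_end hA' hp hpB
    have hkA := (s.linked hB hA'.toMatching hpA hl).2
    obtain ⟨a, rfl⟩ := m.cover k hk fun hf => hkA (hf.mono s.le₂)
    have haB : ¬ Free B' a := by
      rw [m.free_iff hB hA' hle hG]
      exact fun hf => hkA (hf.mono s.le₂)
    obtain ⟨b, hab⟩ := not_free.1 haB
    exact .inr ⟨s.le₂ _ _ h, a, b, ⟨hab, hkA⟩, hl⟩

theorem down_lifted [Finite H] (m : Model vert A' B vert' B' u) (hB : Matching B)
    (hA' : Semi vert A') (hle : ∀ a b, A' a b → B a b) (hG : Good vert B A')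
    (hD : ∀ a b, D a b → D b a) (hDB : ∀ a b, D a b → B' a b) (a b : H') :
    down u B' (lifted vert A' B u D) a b ↔ D a b := by
  have hM := m.matching hB hA'.toMatching
  constructor
  · rintro ⟨hab, h⟩
    obtain ⟨q, hq | ⟨-, c, d, hcd, hl⟩⟩ := not_free.1 h
    · exact absurd hq ((m.isEnd a).1 _)
    by_cases hac : a = c
    · subst hac
      rwa [hM.unique hab (hDB _ _ hcd)]
    · obtain rfl := m.ends_eq hB hA'.toMatching hab hl hac
      rw [hM.unique (hM.symm hab) (hDB _ _ hcd)]
      exact hD _ _ hcd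
  · intro h
    refine ⟨hDB _ _ h, ?_⟩
    have : ¬ Free B (u a) := by
      rw [← m.free_iff hB hA' hle hG]
      exact not_free.2 ⟨b, hDB _ _ h⟩
    obtain ⟨q, hq⟩ := not_free.1 this
    exact not_free.2 ⟨q, .inr ⟨hq, a, b, h, .refl _⟩⟩

theorem semi_down [Finite H] (m : Model vert A' B vert' B' u) (hB : Matching B) (hA' : Semi vert A')
    (h₁ : ∀ a b, A' a b → A a b) (h₂ : ∀ a b, A a b → B a b) (hA : Semi vert A) :
    Semi vert' (down u B' A) :=
  (m.down_model hB hA' (.of_semi hA' hA h₁ h₂)).semi hA hA' h₁ (hA.good hA' h₁)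

/-- As `down` undoes `lifted`, the relation `D` is the quotient of the lift by `A'`, and the axioms
ascend from `A'` and `D`. -/
theorem semi_lifted [Finite H] (m : Model vert A' B vert' B' u) (hB : Matching B)
    (hA' : Semi vert A') (hle : ∀ a b, A' a b → B a b) (hG : Good vert B A') (hD : Semi vert' D)
    (hDB : ∀ a b, D a b → B' a b) : Semi vert (lifted vert A' B u D) := by
  have s := lifted_saturated (u := u) (D := D) hB hA' hle hG
  have m' := m.down_model hB hA' s
  have : down u B' (lifted vert A' B u D) = D := by
    ext a b
    exact m.down_lifted hB hA' hle hG (fun _ _ => hD.symm) hDB a b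
  rw [this] at m'
  exact m'.semi_of_quotient (s.matching hB) hA' s.le₁ (s.good hB hA'.toMatching hG) hD

/-- The half-edges of the quotient by `A` are half-edges of the quotient by `A'`. -/
theorem exists_of_kept (m : Model vert A' B vert' B' u) (hB : Matching B) (hA' : Semi vert A')
    (hA : Semi vert A) (h₁ : ∀ a b, A' a b → A a b) (h₂ : ∀ a b, A a b → B a b)
    (hG : Good vert A A') {h k : H} (hh : End vert A h) (hk : Free A k)
    (hkh : Joined vert A (vert k) (vert h)) (hkB : ¬ Free B k) : ∃ a, u a = h := by
  have hhA' := hh.1.mono h₁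
  have hE : End vert A' h := by
    rcases end_or_bridge hA' hhA' with he | ⟨k', hk'⟩
    · exact he
    · exfalso
      have h3 := hh.2
      rw [legs_of_whole hA.toMatching hA'.toMatching h₁, hk'.2.2.2.2] at h3
      · omega
      · intro k hk hkh
        by_cases hne : h = k
        · exact hne ▸ hh.1
        · exact (hG.bridge_iff (bridge_of_legs_two hk'.2.2.2.2 hhA' hk hkh.symm hne)).1 hh.1
  by_cases hw : ∀ k, Free A' k → Joined vert A' (vert k) (vert h) → Free B k
  · exact absurd (hw k (hk.mono h₁)
      (joined_of_whole hB hA'.toMatching (fun a b hab => h₂ _ _ (h₁ _ _ hab)) hw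
        (hkh.symm.mono h₂)).symm) hkB
  · push Not at hw
    obtain ⟨k, hk, hkh, hkB⟩ := hw
    obtain ⟨b, rfl⟩ := m.cover k (hE.of_joined hk hkh.symm) hkB
    exact m.closed b h hhA' hkh.symm

/-- Chains in the quotient by `A'` are chains. -/
theorem linked_of_linked [Finite H] (m : Model vert A' B vert' B' u) (hB : Matching B)
    (hA' : Semi vert A') (hA : Semi vert A) (h₁ : ∀ a b, A' a b → A a b)
    (h₂ : ∀ a b, A a b → B a b) {a b : H'}
    (h : Linked vert' B' (down u B' A) a b) : Linked vert B A (u a) (u b) := by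
  have s : Saturated vert A' A B := .of_semi hA' hA h₁ h₂
  have hG := hA.good hA' h₁
  have md := m.down_model hB hA' s
  refine eqvGen_map u ?_ h
  rintro a b (⟨hab, hn⟩ | hab)
  · have haf : Free A (u a) := by
      by_contra hf
      exact hn ⟨hab, hf⟩
    -- The chain behind a quotient edge not coming from `A` stays among half-edges free in `A`. A
    -- component of `A'` crossed by it therefore has both legs free in `A`, so it is a component of
    -- `A` and its bridge is a bridge of `A`.
    have := (eqvGen_closed (P := fun x => Free A x ∧ Linked vert B A (u a) x) ?_
      ((m.adj_iff a b).1 hab).2).1 ⟨haf, .refl _⟩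
    · exact this.2
    have step : ∀ x y, ((B x y ∧ ¬ A' x y) ∨ Bridge vert A' x y) →
        (Free A x ∧ Linked vert B A (u a) x) → Free A y ∧ Linked vert B A (u a) y := by
      rintro x y (⟨hxy, -⟩ | hxy) ⟨hx, hl⟩
      · refine ⟨free_of_rel hB h₂ (hB.symm hxy) fun h => hx _ (hA.symm h), ?_⟩
        exact hl.trans (.of_rel hxy (hx _))
      · have hy := (hG.bridge_iff hxy).1 hx
        refine ⟨hy, hl.trans (.of_bridge (bridge_of_legs_two ?_ hx hy
          (hxy.2.2.2.1.mono h₁) hxy.1))⟩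
        rw [legs_of_whole hA.toMatching hA'.toMatching h₁, hxy.2.2.2.2]
        intro k hk hkx
        by_cases hne : x = k
        · exact hne ▸ hx
        · exact (hG.bridge_iff (bridge_of_legs_two hxy.2.2.2.2 hxy.2.1 hk hkx.symm hne)).1 hx
    exact fun x y hxy => ⟨step x y hxy, step y x (hxy.imp
      (fun h => ⟨hB.symm h.1, fun h' => h.2 (hA'.symm h')⟩) Bridge.symm)⟩
  · refine .rel _ _ (.inr ⟨fun h => hab.1 (m.inj h), ?_, ?_, ?_, ?_⟩)
    · exact (md.free_iff hA.toMatching hA' h₁ hG a).1 hab.2.1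
    · exact (md.free_iff hA.toMatching hA' h₁ hG b).1 hab.2.2.1
    · exact (md.joined_iff hA.toMatching hA' h₁ a b).1 hab.2.2.2.1
    · rw [← md.legs_eq hA.toMatching hA' h₁ hG]
      exact hab.2.2.2.2

/-- For the converse no chain has to be projected: the chain of `a` in the quotient has a second end
`c`, its lift joins `u a` to `u c`, and a chain has only one second end, so `c = b`. -/
theorem linked_iff_linked [Finite H] [Finite H'] (m : Model vert A' B vert' B' u) (hB : Semi vert B)
    (hA' : Semi vert A') (hA : Semi vert A) (h₁ : ∀ a b, A' a b → A a b)
    (h₂ : ∀ a b, A a b → B a b) {a b : H'} (ha : End vert A (u a)) (hb : End vert A (u b))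
    (hne : a ≠ b) : Linked vert' B' (down u B' A) a b ↔ Linked vert B A (u a) (u b) := by
  refine ⟨m.linked_of_linked hB.toMatching hA' hA h₁ h₂, fun h => ?_⟩
  have hle : ∀ a b, A' a b → B a b := fun a b hab => h₂ _ _ (h₁ _ _ hab)
  have hG' := hB.good hA' hle
  have hG := hA.good hA' h₁
  have s : Saturated vert A' A B := .of_semi hA' hA h₁ h₂
  have md := m.down_model hB.toMatching hA' s
  have hB' := m.semi hB hA' hle hG'
  have hD := m.semi_down hB.toMatching hA' h₁ h₂ hA
  have hE : ∀ c, End vert A (u c) ↔ End vert' (down u B' A) c := fun c => by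
    rw [End, End, md.free_iff hA.toMatching hA' h₁ hG, md.legs_eq hA.toMatching hA' h₁ hG]
  have hDB : ∀ a b, down u B' A a b → B' a b := fun _ _ => And.left
  have haB : ¬ Free B' a := by
    rw [m.free_iff hB.toMatching hA' hle hG']
    exact fun hf => hne (m.inj (linked_eq_of_free hB.toMatching ha hf h)).symm
  obtain ⟨c, hca, hac, hc⟩ := exists_linked_end hB'.toMatching hD hDB (hB'.good hD hDB)
    ((hE a).1 ha) haB
  have := linked_ends_unique hB.toMatching hA.toMatching ha hb ((hE c).2 hc) h
    (m.linked_of_linked hB.toMatching hA' hA h₁ h₂ hac) (fun h => hne (m.inj h))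
    (fun h => hca (m.inj h).symm)
  exact m.inj this ▸ hac

end Model

end HalfEdge

/-! ### Isomorphism theorems for iterated subgraphs and quotients. -/

namespace PreGraph

open HalfEdge

theorem kept_iff_of_emb {H₁ V₁ H V : Type} {vert₁ : H₁ → V₁} {vert : H → V} {i : H₁ → H} {j : V₁ → V}
    {A₁ B₁ : H₁ → H₁ → Prop} {A B : H → H → Prop} (e : OpenEmb vert₁ vert i j) (r : Restr i A₁ A)
    (s : Restr i B₁ B) (a : H₁) : Kept vert₁ B₁ A₁ a ↔ Kept vert B A (i a) := by
  refine and_congr (e.end_iff r) ⟨?_, ?_⟩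
  · rintro ⟨k, hk, hj, hB⟩
    refine ⟨i k, (OpenEmb.free_iff r).1 hk, ?_, fun h => hB ((OpenEmb.free_iff s).2 h)⟩
    rw [e.comm, e.comm]
    exact (e.joined_iff r).1 hj
  · rintro ⟨k, hk, hj, hB⟩
    rw [e.comm] at hj
    obtain ⟨x, hx⟩ := e.joined_range r hj.symm
    obtain ⟨k, rfl⟩ := e.full k x hx.symm
    rw [e.comm] at hj
    exact ⟨k, (OpenEmb.free_iff r).2 hk, (e.joined_iff r).2 hj, fun h => hB ((OpenEmb.free_iff s).1 h)⟩

namespace Subgraph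

variable {Γ : PreGraph}

theorem restr_of_le (hΓ : Γ.IsFeynman) {γ γ' : Γ.Subgraph} (hle : ∀ a b, γ'.1.adj a b → γ.1.adj a b) :
    Restr (Subtype.val : γ.toGraph.H → Γ.H) (fun a b => γ'.1.adj a.1 b.1) γ'.1.adj where
  symm _ _ := (γ'.semi hΓ).symm
  iff _ _ := Iff.rfl
  closed _ y h := ⟨⟨y, (γ.1.adj_le _ _ (hle _ _ h)).2.2⟩, rfl⟩

/-- A subgraph contained in `γ`, as a subgraph of `γ`. -/
def restrict (hΓ : Γ.IsFeynman) (γ : Γ.Subgraph)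
    (γ' : {γ' : Γ.Subgraph // ∀ a b, γ'.1.adj a b → γ.1.adj a b}) : γ.toGraph.Subgraph :=
  ofAdj γ.2 (fun a b => γ'.1.1.adj a.1 b.1)
    (γ.1.openEmb.semi_restr (restr_of_le hΓ γ'.2) (γ'.1.semi hΓ)) fun _ _ h => γ'.2 _ _ h

theorem restrict_bijective (hΓ : Γ.IsFeynman) (γ : Γ.Subgraph) :
    Function.Bijective (restrict hΓ γ) := by
  constructor
  · intro γ₁ γ₂ h
    refine Subtype.ext (ext_adj hΓ fun a b => ?_)
    have hadj : ∀ a b : γ.toGraph.H, γ₁.1.1.adj a.1 b.1 ↔ γ₂.1.1.adj a.1 b.1 := fun a b =>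
      Iff.of_eq (congrFun (congrFun (congrArg (fun γ'' : γ.toGraph.Subgraph => γ''.1.adj) h) a) b)
    constructor
    · intro hab
      have := γ.1.adj_le _ _ (γ₁.2 _ _ hab)
      exact (hadj ⟨a, this.2.1⟩ ⟨b, this.2.2⟩).1 hab
    · intro hab
      have := γ.1.adj_le _ _ (γ₂.2 _ _ hab)
      exact (hadj ⟨a, this.2.1⟩ ⟨b, this.2.2⟩).2 hab
  · intro δ
    set A : Γ.H → Γ.H → Prop := fun p q => ∃ a b : γ.toGraph.H, a.1 = p ∧ b.1 = q ∧ δ.1.adj a b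
      with hA
    have hAγ : ∀ p q, A p q → γ.1.adj p q := by
      rintro _ _ ⟨a, b, rfl, rfl, h⟩
      exact δ.adj_le _ _ h
    have hδ := δ.semi γ.2
    have hr : Restr (Subtype.val : γ.toGraph.H → Γ.H) δ.1.adj A := by
      refine ⟨?_, ?_, ?_⟩
      · rintro _ _ ⟨a, b, rfl, rfl, h⟩
        exact ⟨b, a, rfl, rfl, hδ.symm h⟩
      · intro a b
        refine ⟨fun h => ⟨a, b, rfl, rfl, h⟩, ?_⟩
        rintro ⟨a', b', ha, hb, h⟩
        rwa [← Subtype.ext ha, ← Subtype.ext hb]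
      · rintro a y ⟨a', b', -, rfl, -⟩
        exact ⟨b', rfl⟩
    have hs : Semi Γ.vert A := by
      refine γ.1.openEmb.semi_extend hr ?_ hΓ.trivalent hδ
      rintro _ _ ⟨a, b, rfl, rfl, h⟩
      exact ⟨a, rfl⟩
    refine ⟨⟨ofAdj hΓ A hs fun a b h => γ.adj_le _ _ (hAγ a b h), hAγ⟩, ?_⟩
    exact ext_adj γ.2 fun a b => (hr.iff a b).symm

theorem restrict_iso (hΓ : Γ.IsFeynman) (γ : Γ.Subgraph)
    (γ' : {γ' : Γ.Subgraph // ∀ a b, γ'.1.adj a b → γ.1.adj a b}) :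
    Nonempty (Iso (restrict hΓ γ γ').toGraph γ'.1.toGraph) := by
  have p := (restrict hΓ γ γ').presents γ.2
  have hi := p.comp_emb (v := γ.val) (S₁ := fun h => Touched Γ.vert γ'.1.1.adj (Γ.vert h))
    (E₁ := fun a b => Γ.vert a = Γ.vert b) (B₁ := γ'.1.1.adj) Subtype.val_injective ?_
    (fun _ _ _ _ => Subtype.ext_iff) (fun _ _ _ _ => Iff.rfl)
  · obtain ⟨e, -⟩ := hi.exists_iso (γ'.1.presents hΓ)
    exact ⟨e⟩
  · intro h
    constructor
    · rintro ⟨a, ha, haf⟩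
      obtain ⟨b, hb⟩ := not_free.1 haf
      have hv : Γ.vert h ∈ γ.1.verts := ha ▸ (γ.1.adj_le _ _ (γ'.2 _ _ hb)).2.1
      refine ⟨⟨h, hv⟩, ⟨⟨a, ha ▸ hv⟩, Subtype.ext ha, not_free.2 ⟨⟨b, ?_⟩, hb⟩⟩, rfl⟩
      exact (γ.1.adj_le _ _ (γ'.2 _ _ hb)).2.2
    · rintro ⟨x, ⟨a, ha, haf⟩, rfl⟩
      obtain ⟨b, hb⟩ := not_free.1 haf
      exact ⟨a.1, congrArg Subtype.val ha, not_free.2 ⟨b.1, hb⟩⟩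

/-- The image of a subgraph containing `γ'` in the quotient by `γ'`. -/
def image (hΓ : Γ.IsFeynman) (γ' : Γ.Subgraph)
    (γ : {γ : Γ.Subgraph // ∀ a b, γ'.1.adj a b → γ.1.adj a b}) : (Γ.quotient γ').Subgraph :=
  ofAdj (γ'.quotient_isFeynman hΓ) (Model.down γ'.up (Γ.quotient γ').Adj γ.1.1.adj)
    ((γ'.model hΓ).semi_down hΓ.semi.toMatching (γ'.semi hΓ) γ.2 γ.1.adj_le (γ.1.semi hΓ))
    fun _ _ h => h.1

theorem image_bijective (hΓ : Γ.IsFeynman) (γ' : Γ.Subgraph) :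
    Function.Bijective (image hΓ γ') := by
  have m := γ'.model hΓ
  have hB := hΓ.semi.toMatching
  have hA' := γ'.semi hΓ
  have hG := γ'.good hΓ
  constructor
  · intro γ₁ γ₂ h
    refine Subtype.ext (ext_adj hΓ fun a b => ?_)
    have hadj : Model.down γ'.up (Γ.quotient γ').Adj γ₁.1.1.adj =
        Model.down γ'.up (Γ.quotient γ').Adj γ₂.1.1.adj :=
      congrArg (fun γ'' : (Γ.quotient γ').Subgraph => γ''.1.adj) h
    rw [← m.lifted_down hB hA' γ'.adj_le hG (.of_semi hA' (γ₁.1.semi hΓ) γ₁.2 γ₁.1.adj_le),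
      ← m.lifted_down hB hA' γ'.adj_le hG (.of_semi hA' (γ₂.1.semi hΓ) γ₂.2 γ₂.1.adj_le), hadj]
  · intro δ
    have hD := δ.semi (γ'.quotient_isFeynman hΓ)
    have s := Model.lifted_saturated (u := γ'.up) (D := δ.1.adj) hB hA' γ'.adj_le hG
    refine ⟨⟨ofAdj hΓ _ (m.semi_lifted hB hA' γ'.adj_le hG hD δ.adj_le) s.le₂, s.le₁⟩, ?_⟩
    exact ext_adj (γ'.quotient_isFeynman hΓ) fun a b =>
      m.down_lifted hB hA' γ'.adj_le hG (fun _ _ => hD.symm) δ.adj_le a b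

/-- Both graphs are presented by the half-edges kept when `γ'` is contracted in `γ`, seen in `Γ`
once through `γ` and once through the quotient by `γ'`. -/
theorem image_iso (hΓ : Γ.IsFeynman) (γ γ' : Γ.Subgraph)
    (hle : ∀ a b, γ'.1.adj a b → γ.1.adj a b) :
    Nonempty (Iso (γ.toGraph.quotient (restrict hΓ γ ⟨γ', hle⟩)) (image hΓ γ' ⟨γ, hle⟩).toGraph) := by
  have m := γ'.model hΓ
  have hB := hΓ.semi.toMatching
  have hA' := γ'.semi hΓ
  have hA := γ.semi hΓ
  have s : Saturated Γ.vert γ'.1.adj γ.1.adj Γ.Adj := .of_semi hA' hA hle γ.adj_le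
  have md := m.down_model hB hA' s
  have e := γ.1.openEmb
  have r := restr_of_le hΓ hle
  have hGA := hA.good hA' hle
  have p₁ := ((restrict hΓ γ ⟨γ', hle⟩).quotient_presents γ.2).comp_emb (v := γ.val)
    (S₁ := Kept Γ.vert γ.1.adj γ'.1.adj)
    (E₁ := fun a b => HalfEdge.Joined Γ.vert γ'.1.adj (Γ.vert a) (Γ.vert b))
    (B₁ := fun a b => a ≠ b ∧ HalfEdge.Linked Γ.vert γ.1.adj γ'.1.adj a b) Subtype.val_injective ?_
    (fun _ _ _ _ => e.joined_iff r) (fun a b _ _ => and_congr Subtype.val_injective.ne_iff.symm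
      (e.linked_iff r γ.restr))
  · have p₂ := ((image hΓ γ' ⟨γ, hle⟩).presents (γ'.quotient_isFeynman hΓ)).comp_emb (v := γ'.up)
      (S₁ := Kept Γ.vert γ.1.adj γ'.1.adj)
      (E₁ := fun a b => HalfEdge.Joined Γ.vert γ'.1.adj (Γ.vert a) (Γ.vert b))
      (B₁ := fun a b => a ≠ b ∧ HalfEdge.Linked Γ.vert γ.1.adj γ'.1.adj a b) γ'.up_injective ?_
      (fun _ _ _ _ => m.vert_iff _ _)
      (fun a b _ _ => (md.adj_iff a b).trans (and_congr_left' γ'.up_injective.ne_iff.symm))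
    · obtain ⟨e, -⟩ := p₁.exists_iso p₂
      exact ⟨e⟩
    · intro h
      constructor
      · rintro ⟨hE, k, hk, hkh, hkA⟩
        obtain ⟨c, rfl⟩ := md.cover k (hE.of_joined hk hkh.symm) hkA
        obtain ⟨a, rfl⟩ := md.closed c h hE.1 hkh.symm
        refine ⟨a, ⟨c, (m.vert_iff _ _).2 hkh, ?_⟩, rfl⟩
        change ¬ Free (Model.down γ'.up (Γ.quotient γ').Adj γ.1.adj) c
        rwa [md.free_iff hA.toMatching hA' hle hGA]
      · rintro ⟨a, ⟨c, hca, hc⟩, rfl⟩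
        change ¬ Free (Model.down γ'.up (Γ.quotient γ').Adj γ.1.adj) c at hc
        rw [md.free_iff hA.toMatching hA' hle hGA] at hc
        exact ⟨m.isEnd a, γ'.up c, (m.isEnd c).1, (m.vert_iff _ _).1 hca, hc⟩
  · intro h
    constructor
    · rintro hK
      have hv : Γ.vert h ∈ γ.1.verts := by
        obtain ⟨-, k, -, hkh, hkA⟩ := hK
        obtain ⟨l, hl⟩ := not_free.1 hkA
        exact γ.mem_of_joined (γ.1.adj_le _ _ hl).2.1 (hkh.mono hle)
      exact ⟨⟨h, hv⟩, (kept_iff_of_emb e r γ.restr _).2 hK, rfl⟩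
    · rintro ⟨x, hx, rfl⟩
      exact (kept_iff_of_emb e r γ.restr _).1 hx

/-- Half-edges kept by the two successive contractions are those kept by contracting `γ` directly,
and chains of the iterated quotient correspond to chains through `γ`. -/
theorem image_quotient_iso (hΓ : Γ.IsFeynman) (γ γ' : Γ.Subgraph)
    (hle : ∀ a b, γ'.1.adj a b → γ.1.adj a b) :
    Nonempty (Iso ((Γ.quotient γ').quotient (image hΓ γ' ⟨γ, hle⟩)) (Γ.quotient γ)) := by
  have m := γ'.model hΓ
  have hB := hΓ.semi
  have hA' := γ'.semi hΓ
  have hA := γ.semi hΓ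
  have hG := γ'.good hΓ
  have hGA := hA.good hA' hle
  have s : Saturated Γ.vert γ'.1.adj γ.1.adj Γ.Adj := .of_semi hA' hA hle γ.adj_le
  have md := m.down_model hB.toMatching hA' s
  have hf : ∀ a, Free (Model.down γ'.up (Γ.quotient γ').Adj γ.1.adj) a ↔ Free γ.1.adj (γ'.up a) :=
    md.free_iff hA.toMatching hA' hle hGA
  have hE : ∀ a, End (Γ.quotient γ').vert (Model.down γ'.up (Γ.quotient γ').Adj γ.1.adj) a ↔
      End Γ.vert γ.1.adj (γ'.up a) := fun a => by
    rw [End, End, hf, md.legs_eq hA.toMatching hA' hle hGA]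
  have hK : ∀ a, Kept (Γ.quotient γ').vert (Γ.quotient γ').Adj
      (Model.down γ'.up (Γ.quotient γ').Adj γ.1.adj) a ↔ Kept Γ.vert Γ.Adj γ.1.adj (γ'.up a) := by
    intro a
    constructor
    · rintro ⟨ha, k, hk, hj, hkB⟩
      refine ⟨(hE a).1 ha, γ'.up k, (hf k).1 hk, (md.joined_iff hA.toMatching hA' hle k a).1 hj, ?_⟩
      rwa [← m.free_iff hB.toMatching hA' γ'.adj_le hG]
    · rintro ⟨ha, k, hk, hj, hkB⟩
      obtain ⟨k, rfl⟩ := m.exists_of_kept hB.toMatching hA' hA hle γ.adj_le hGA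
        (ha.of_joined hk hj.symm) hk (.refl _) hkB
      refine ⟨(hE a).2 ha, k, (hf k).2 hk, (md.joined_iff hA.toMatching hA' hle k a).2 hj, ?_⟩
      rwa [m.free_iff hB.toMatching hA' γ'.adj_le hG]
  have p := ((image hΓ γ' ⟨γ, hle⟩).quotient_presents (γ'.quotient_isFeynman hΓ)).comp_emb
    (v := γ'.up) (S₁ := Kept Γ.vert Γ.Adj γ.1.adj)
    (E₁ := fun a b => HalfEdge.Joined Γ.vert γ.1.adj (Γ.vert a) (Γ.vert b))
    (B₁ := fun a b => a ≠ b ∧ HalfEdge.Linked Γ.vert Γ.Adj γ.1.adj a b) γ'.up_injective ?_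
    (fun a b _ _ => md.joined_iff hA.toMatching hA' hle a b) (fun a b ha hb => ?_)
  · obtain ⟨e, -⟩ := p.exists_iso (γ.quotient_presents hΓ)
    exact ⟨e⟩
  · intro h
    constructor
    · intro h'
      obtain ⟨hh, k, hk, hkh, hkB⟩ := id h'
      obtain ⟨a, rfl⟩ := m.exists_of_kept hB.toMatching hA' hA hle γ.adj_le hGA hh hk hkh hkB
      exact ⟨a, (hK a).2 h', rfl⟩
    · rintro ⟨a, ha, rfl⟩
      exact (hK a).1 ha
  · rw [γ'.up_injective.ne_iff]
    refine and_congr_right fun hne => ?_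
    exact m.linked_iff_linked hB hA' hA hle γ.adj_le ((hE a).1 ha.1) ((hE b).1 hb.1) hne

end Subgraph

end PreGraph

/-! ### Transport along isomorphisms; empty, full and disjoint subgraphs. -/

namespace PreGraph

open HalfEdge

section Transport

variable {Γ Γ' : PreGraph}

theorem Iso.openEmb (e : Iso Γ Γ') : OpenEmb Γ.vert Γ'.vert e.eH e.eV where
  inj := e.eH.injective
  injV := e.eV.injective
  comm := e.vert_eq
  full a _ _ := ⟨e.eH.symm a, by simp⟩

theorem Iso.restr (e : Iso Γ Γ') {A : Γ.H → Γ.H → Prop} (hA : ∀ a b, A a b → A b a) :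
    Restr e.eH A (fun a b => A (e.eH.symm a) (e.eH.symm b)) where
  symm _ _ := hA _ _
  iff a b := by simp
  closed _ y _ := ⟨e.eH.symm y, by simp⟩

theorem Iso.restr_symm (e : Iso Γ Γ') {A : Γ.H → Γ.H → Prop} (hA : ∀ a b, A a b → A b a) :
    Restr e.symm.eH (fun a b => A (e.eH.symm a) (e.eH.symm b)) A where
  symm := hA
  iff _ _ := Iff.rfl
  closed _ y _ := ⟨e.eH y, by simp [Iso.symm]⟩

theorem Iso.adj_symm_iff (e : Iso Γ Γ') (a b : Γ'.H) :
    Γ.Adj (e.eH.symm a) (e.eH.symm b) ↔ Γ'.Adj a b := by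
  rw [← e.adj_iff]; simp

theorem Iso.restr_adj (e : Iso Γ Γ') (h : Matching Γ'.Adj) : Restr e.eH Γ.Adj Γ'.Adj where
  symm _ _ h' := h.symm h'
  iff a b := (e.adj_iff a b).symm
  closed _ y _ := ⟨e.eH.symm y, by simp⟩

/-- Feynman graphs are stable under isomorphisms. -/
theorem Iso.isFeynman (e : Iso Γ Γ') (h : Γ'.IsFeynman) : Γ.IsFeynman := by
  have r := e.restr_adj h.semi.toMatching
  refine isFeynman_iff.2 ⟨e.openEmb.semi_restr r h.semi, fun v => ?_⟩
  obtain ⟨a, ha, ha'⟩ := h.touched (e.eV v)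
  refine ⟨e.eH.symm a, ?_, fun hf => ha' ?_⟩
  · apply e.eV.injective
    rw [← e.vert_eq, Equiv.apply_symm_apply, ha]
  · have := (OpenEmb.free_iff r).1 hf
    simpa using this

theorem Iso.isConnected (e : Iso Γ Γ') (hm : Matching Γ'.Adj) (h : Γ'.IsConnected) :
    Γ.IsConnected :=
  ⟨⟨e.eV.symm h.1.some⟩, fun _ _ => (e.openEmb.joined_iff (e.restr_adj hm)).2 (h.2 _ _)⟩

namespace Subgraph

/-- The image of a subgraph under an isomorphism. -/
def map (hΓ : Γ.IsFeynman) (hΓ' : Γ'.IsFeynman) (e : Iso Γ Γ') (γ : Γ.Subgraph) : Γ'.Subgraph :=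
  ofAdj hΓ' (fun a b => γ.1.adj (e.eH.symm a) (e.eH.symm b))
    (e.symm.openEmb.semi_restr (e.restr_symm fun _ _ => (γ.semi hΓ).symm) (γ.semi hΓ))
    fun _ _ h => (e.adj_symm_iff _ _).1 (γ.adj_le _ _ h)

theorem map_bijective (hΓ : Γ.IsFeynman) (hΓ' : Γ'.IsFeynman) (e : Iso Γ Γ') :
    Function.Bijective (map hΓ hΓ' e) := by
  constructor
  · intro γ γ' h
    refine ext_adj hΓ fun a b => ?_
    have := Iff.of_eq (congrFun (congrFun (congrArg (fun γ'' : Γ'.Subgraph => γ''.1.adj) h)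
      (e.eH a)) (e.eH b))
    simpa [map, ofAdj] using this
  · intro γ
    refine ⟨map hΓ' hΓ e.symm γ, ext_adj hΓ' fun a b => ?_⟩
    simp [map, ofAdj, Iso.symm]

theorem touched_iff_of_emb {H₁ V₁ H V : Type} {vert₁ : H₁ → V₁} {vert : H → V} {i : H₁ → H}
    {j : V₁ → V} {A₁ : H₁ → H₁ → Prop} {A : H → H → Prop} (e : OpenEmb vert₁ vert i j)
    (r : Restr i A₁ A) (v : V₁) : Touched vert₁ A₁ v ↔ Touched vert A (j v) := by
  constructor
  · rintro ⟨a, rfl, ha⟩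
    exact ⟨i a, e.comm a, fun h => ha ((OpenEmb.free_iff r).2 h)⟩
  · rintro ⟨a, ha, ha'⟩
    obtain ⟨b, rfl⟩ := e.full a v ha
    rw [e.comm] at ha
    exact ⟨b, e.injV ha, fun h => ha' ((OpenEmb.free_iff r).1 h)⟩

theorem map_iso (hΓ : Γ.IsFeynman) (hΓ' : Γ'.IsFeynman) (e : Iso Γ Γ') (γ : Γ.Subgraph) :
    ∃ i : Iso γ.toGraph (map hΓ hΓ' e γ).toGraph, ∀ a, (map hΓ hΓ' e γ).val (i.eH a) =
      e.eH (γ.val a) := by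
  have r := e.restr (A := γ.1.adj) fun _ _ => (γ.semi hΓ).symm
  refine ((γ.presents hΓ).comp_emb (v := e.eH) e.eH.injective ?_ (fun a b _ _ => ?_)
    (fun a b _ _ => ?_)).exists_iso ((map hΓ hΓ' e γ).presents hΓ')
  · intro y
    obtain ⟨y, rfl⟩ := e.eH.surjective y
    rw [e.vert_eq]
    refine (touched_iff_of_emb e.openEmb r _).symm.trans ⟨fun h => ⟨y, h, rfl⟩, ?_⟩
    rintro ⟨x, hx, h⟩
    exact e.eH.injective h ▸ hx
  · exact (e.vert_eq_iff a b).symm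
  · exact r.iff a b

theorem map_quotient_iso (hΓ : Γ.IsFeynman) (hΓ' : Γ'.IsFeynman) (e : Iso Γ Γ') (γ : Γ.Subgraph) :
    ∃ i : Iso (Γ.quotient γ) (Γ'.quotient (map hΓ hΓ' e γ)), ∀ a, (map hΓ hΓ' e γ).up (i.eH a) =
      e.eH (γ.up a) := by
  have r := e.restr (A := γ.1.adj) fun _ _ => (γ.semi hΓ).symm
  have s := e.restr_adj hΓ'.semi.toMatching
  refine ((γ.quotient_presents hΓ).comp_emb (v := e.eH) e.eH.injective ?_ (fun a b _ _ => ?_)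
    (fun a b _ _ => ?_)).exists_iso ((map hΓ hΓ' e γ).quotient_presents hΓ')
  · intro y
    obtain ⟨y, rfl⟩ := e.eH.surjective y
    refine (kept_iff_of_emb e.openEmb r s _).symm.trans ⟨fun h => ⟨y, h, rfl⟩, ?_⟩
    rintro ⟨x, hx, h⟩
    exact e.eH.injective h ▸ hx
  · rw [e.vert_eq, e.vert_eq]
    exact e.openEmb.joined_iff r
  · exact and_congr e.eH.injective.ne_iff.symm (e.openEmb.linked_iff r s)

end Subgraph

end Transport

section BotTop

variable {Γ : PreGraph}

theorem Subgraph.isEmpty_iff (hΓ : Γ.IsFeynman) (γ : Γ.Subgraph) :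
    IsEmpty γ.toGraph.V ↔ ∀ a b, ¬ γ.1.adj a b := by
  constructor
  · exact fun h a b hab => h.1 ⟨_, (γ.1.adj_le _ _ hab).2.1⟩
  · refine fun h => ⟨fun v => ?_⟩
    obtain ⟨a, -, ha⟩ := (γ.mem_verts hΓ v.1).1 v.2
    exact ha (h a)

/-- An edge of `Γ` outside `γ` lies on a chain ending at a half-edge of the quotient, so only the
full subgraph has empty quotient. -/
theorem Subgraph.isEmpty_quotient_iff (hΓ : Γ.IsFeynman) (γ : Γ.Subgraph) :
    IsEmpty (Γ.quotient γ).V ↔ ∀ a b, γ.1.adj a b ↔ Γ.Adj a b := by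
  constructor
  · intro h a b
    refine ⟨γ.adj_le a b, fun hab => ?_⟩
    by_contra hn
    have hA := γ.semi hΓ
    have hB := hΓ.semi.toMatching
    have haB : ¬ Free Γ.Adj a := not_free.2 ⟨b, hab⟩
    obtain ⟨k, hk, hl⟩ := (γ.good hΓ).exists_end hA (free_of_rel hB γ.adj_le hab hn) haB
    obtain ⟨c, -⟩ := (γ.range_up hΓ k).2
      ⟨hk, k, hk.1, .refl _, by rwa [← linked_free_iff (γ.good hΓ) hB hl]⟩
    exact h.1 ((Γ.quotient γ).vert c)
  · refine fun h => ⟨fun v => ?_⟩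
    obtain ⟨a, rfl⟩ := γ.quotient_surj hΓ v
    obtain ⟨-, k, hk, -, hkB⟩ := (γ.range_up hΓ _).1 ⟨a, rfl⟩
    exact hkB fun l hl => hk l ((h _ _).2 hl)

theorem semi_bot (hΓ : ∀ v, Nat.card {h : Γ.H // Γ.vert h = v} = 3) :
    Semi Γ.vert (fun _ _ => False) :=
  ⟨⟨fun h => h, fun _ h => h, fun h => h.elim⟩, hΓ,
    fun v => .inr ((OpenEmb.legs_of_untouched (fun _ _ h => h) fun _ _ _ h => h).trans (hΓ v)),
    fun _ _ h => h.elim⟩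

/-- The empty subgraph. -/
def Subgraph.bot (hΓ : Γ.IsFeynman) : Γ.Subgraph :=
  ofAdj hΓ (fun _ _ => False) (semi_bot hΓ.trivalent) fun _ _ h => h.elim

/-- The full subgraph. -/
def Subgraph.top (hΓ : Γ.IsFeynman) : Γ.Subgraph := ofAdj hΓ Γ.Adj hΓ.semi fun _ _ h => h

theorem presents_self (hΓ : Γ.IsFeynman) :
    Presents Γ id (fun _ => True) (fun a b => Γ.vert a = Γ.vert b) Γ.Adj :=
  ⟨Function.injective_id, hΓ.surj, fun x => iff_of_true ⟨x, rfl⟩ trivial, fun _ _ => Iff.rfl,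
    fun _ _ => Iff.rfl⟩

theorem joined_bot_iff {v w : Γ.V} :
    HalfEdge.Joined Γ.vert (fun _ _ => False) v w ↔ v = w :=
  ⟨fun h => (h.closed (P := fun w => v = w) (fun _ _ h => h.elim)).1 rfl, fun h => .of_eq h⟩

/-- With no edges to contract, every vertex has three legs, there are no bridges, and chains are
single edges. -/
theorem linked_bot_iff (hΓ : Γ.IsFeynman) {a b : Γ.H} :
    (a ≠ b ∧ HalfEdge.Linked Γ.vert Γ.Adj (fun _ _ => False) a b) ↔ Γ.Adj a b := by
  have hm := hΓ.semi.toMatching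
  constructor
  · rintro ⟨hne, h⟩
    refine ((eqvGen_closed (P := fun b => a = b ∨ Γ.Adj a b) ?_ h).1 (.inl rfl)).resolve_left hne
    have step : ∀ x y, ((Γ.Adj x y ∧ ¬ False) ∨ Bridge Γ.vert (fun _ _ => False) x y) →
        (a = x ∨ Γ.Adj a x) → (a = y ∨ Γ.Adj a y) := by
      rintro x y (⟨h, -⟩ | h)
      · rintro (rfl | hx)
        · exact .inr h
        · exact .inl (hm.unique (hm.symm hx) h)
      · have h2 := h.2.2.2.2
        rw [OpenEmb.legs_of_untouched (fun _ _ h => h) (fun _ _ _ h => h), hΓ.trivalent] at h2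
        omega
    exact fun x y hxy => ⟨step x y hxy, step y x (hxy.imp (fun h => ⟨hm.symm h.1, h.2⟩) Bridge.symm)⟩
  · exact fun h => ⟨by rintro rfl; exact hm.irrefl _ h, .of_rel h id⟩

theorem Subgraph.quotient_bot_iso (hΓ : Γ.IsFeynman) :
    Nonempty (Iso (Γ.quotient (bot hΓ)) Γ) := by
  have hk : ∀ x, Kept Γ.vert Γ.Adj (bot hΓ).1.adj x := by
    intro x
    obtain ⟨a, ha, ha'⟩ := hΓ.touched (Γ.vert x)
    exact ⟨⟨fun _ h => h, (OpenEmb.legs_of_untouched (fun _ _ h => h) (fun _ _ _ h => h)).trans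
      (hΓ.trivalent _)⟩, a, fun _ h => h, .of_eq ha, ha'⟩
  obtain ⟨e, -⟩ := ((bot hΓ).quotient_presents hΓ).exists_iso ((presents_self hΓ).congr
    (fun x => iff_of_true trivial (hk x)) (fun _ _ _ _ => joined_bot_iff.symm)
    (fun _ _ _ _ => (linked_bot_iff hΓ).symm))
  exact ⟨e⟩

theorem Subgraph.top_iso (hΓ : Γ.IsFeynman) : Nonempty (Iso (top hΓ).toGraph Γ) := by
  obtain ⟨e, -⟩ := ((top hΓ).presents hΓ).exists_iso ((presents_self hΓ).congr
    (fun x => iff_of_true trivial (hΓ.touched _)) (fun _ _ _ _ => Iff.rfl) (fun _ _ _ _ => Iff.rfl))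
  exact ⟨e⟩

end BotTop

section SumSubgraph

variable {Γ Γ' : PreGraph}

/-- The disjoint union of subgraphs. -/
def Subgraph.sum (h : Γ.IsFeynman) (h' : Γ'.IsFeynman) (p : Γ.Subgraph × Γ'.Subgraph) :
    (Γ.sum Γ').Subgraph :=
  ofAdj (sum_isFeynman h h') (Sum.LiftRel p.1.1.adj p.2.1.adj)
    (Γ.liftRel_semi Γ' (p.1.semi h) (p.2.semi h')) fun _ _ hab => hab.mono p.1.adj_le p.2.adj_le

theorem Subgraph.sum_bijective (h : Γ.IsFeynman) (h' : Γ'.IsFeynman) :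
    Function.Bijective (Subgraph.sum h h') := by
  constructor
  · rintro ⟨γ, γ'⟩ ⟨δ, δ'⟩ heq
    have hadj : Sum.LiftRel γ.1.adj γ'.1.adj = Sum.LiftRel δ.1.adj δ'.1.adj :=
      congrArg (fun γ'' : (Γ.sum Γ').Subgraph => γ''.1.adj) heq
    refine Prod.ext (ext_adj h fun a b => ?_) (ext_adj h' fun a b => ?_)
    · have := Iff.of_eq (congrFun (congrFun hadj (.inl a)) (.inl b))
      simpa using this
    · have := Iff.of_eq (congrFun (congrFun hadj (.inr a)) (.inr b))
      simpa using this
  · intro γ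
    have hs := γ.semi (sum_isFeynman h h')
    have r₁ : Restr (Sum.inl : Γ.H → (Γ.sum Γ').H) (fun a b => γ.1.adj (.inl a) (.inl b)) γ.1.adj :=
      ⟨fun _ _ => hs.symm, fun _ _ => Iff.rfl, fun a y hay => by
        cases γ.adj_le _ _ hay
        exact ⟨_, rfl⟩⟩
    have r₂ : Restr (Sum.inr : Γ'.H → (Γ.sum Γ').H) (fun a b => γ.1.adj (.inr a) (.inr b)) γ.1.adj :=
      ⟨fun _ _ => hs.symm, fun _ _ => Iff.rfl, fun a y hay => by
        cases γ.adj_le _ _ hay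
        exact ⟨_, rfl⟩⟩
    refine ⟨(ofAdj h _ ((Γ.sum_openEmb_inl Γ').semi_restr r₁ hs) fun a b hab => ?_,
      ofAdj h' _ ((Γ.sum_openEmb_inr Γ').semi_restr r₂ hs) fun a b hab => ?_),
      ext_adj (sum_isFeynman h h') fun a b => ⟨fun hab => ?_, fun hab => ?_⟩⟩
    · exact Sum.liftRel_inl_inl.1 (γ.adj_le _ _ hab)
    · exact Sum.liftRel_inr_inr.1 (γ.adj_le _ _ hab)
    · cases hab with
      | inl h => exact h
      | inr h => exact h
    · cases γ.adj_le _ _ hab with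
      | inl h => exact .inl hab
      | inr h => exact .inr hab

theorem Presents.sum {X X' : Type} {u : Γ.H → X} {S : X → Prop} {E B : X → X → Prop}
    {u' : Γ'.H → X'} {S' : X' → Prop} {E' B' : X' → X' → Prop} (p : Presents Γ u S E B)
    (p' : Presents Γ' u' S' E' B') :
    Presents (Γ.sum Γ') (Sum.map u u') (Sum.elim S S') (Sum.LiftRel E E') (Sum.LiftRel B B') where
  inj := p.inj.sumMap p'.inj
  surj := p.surj.sumMap p'.surj
  range := by
    rintro (x | x)
    · rw [Sum.elim_inl, ← p.range]
      constructor
      · rintro ⟨a | a, ha⟩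
        · exact ⟨a, Sum.inl_injective ha⟩
        · cases ha
      · rintro ⟨a, rfl⟩
        exact ⟨.inl a, rfl⟩
    · rw [Sum.elim_inr, ← p'.range]
      constructor
      · rintro ⟨a | a, ha⟩
        · cases ha
        · exact ⟨a, Sum.inr_injective ha⟩
      · rintro ⟨a, rfl⟩
        exact ⟨.inr a, rfl⟩
  vert_iff := by
    rintro (a | a) (b | b)
    · exact Sum.inl_injective.eq_iff.trans ((p.vert_iff a b).trans Sum.liftRel_inl_inl.symm)
    · exact iff_of_false (fun h => by cases h) (fun h => by cases h)
    · exact iff_of_false (fun h => by cases h) (fun h => by cases h)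
    · exact Sum.inr_injective.eq_iff.trans ((p'.vert_iff a b).trans Sum.liftRel_inr_inr.symm)
  adj_iff := by
    rintro (a | a) (b | b)
    · exact Sum.liftRel_inl_inl.trans ((p.adj_iff a b).trans Sum.liftRel_inl_inl.symm)
    · exact iff_of_false (fun h => by cases h) (fun h => by cases h)
    · exact iff_of_false (fun h => by cases h) (fun h => by cases h)
    · exact Sum.liftRel_inr_inr.trans ((p'.adj_iff a b).trans Sum.liftRel_inr_inr.symm)

theorem liftRel_congr {X X' : Type} {E : X → X → Prop} {E' : X' → X' → Prop}
    {F : X ⊕ X' → X ⊕ X' → Prop} (h₁ : ∀ a b, E a b ↔ F (.inl a) (.inl b))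
    (h₂ : ∀ a b, E' a b ↔ F (.inr a) (.inr b)) (h₃ : ∀ a b, ¬ F (.inl a) (.inr b))
    (h₄ : ∀ a b, ¬ F (.inr a) (.inl b)) (x y : X ⊕ X') : Sum.LiftRel E E' x y ↔ F x y := by
  rcases x with a | a <;> rcases y with b | b <;> simp [h₁, h₂, h₃, h₄]

theorem Subgraph.sum_iso (h : Γ.IsFeynman) (h' : Γ'.IsFeynman) (p : Γ.Subgraph × Γ'.Subgraph) :
    Nonempty (Iso (p.1.toGraph.sum p.2.toGraph) (Subgraph.sum h h' p).toGraph) := by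
  have r₁ : Restr (Sum.inl : Γ.H → (Γ.sum Γ').H) p.1.1.adj (Sum.LiftRel p.1.1.adj p.2.1.adj) :=
    liftRel_restr_inl (fun _ _ => (p.1.semi h).symm) fun _ _ => (p.2.semi h').symm
  have r₂ : Restr (Sum.inr : Γ'.H → (Γ.sum Γ').H) p.2.1.adj (Sum.LiftRel p.1.1.adj p.2.1.adj) :=
    liftRel_restr_inr (fun _ _ => (p.1.semi h).symm) fun _ _ => (p.2.semi h').symm
  refine Exists.elim (((Subgraph.sum h h' p).presents (sum_isFeynman h h')).exists_iso
    (((p.1.presents h).sum (p.2.presents h')).congr (fun x => ?_)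
      (fun x y _ _ => liftRel_congr (F := fun x y => (Γ.sum Γ').vert x = (Γ.sum Γ').vert y)
        ?_ ?_ ?_ ?_ x y) (fun _ _ _ _ => Iff.rfl))) fun e _ => ⟨e.symm⟩
  · rcases x with x | x
    · exact touched_iff_of_emb (Γ.sum_openEmb_inl Γ') r₁ _
    · exact touched_iff_of_emb (Γ.sum_openEmb_inr Γ') r₂ _
  · exact fun a b => Sum.inl_injective.eq_iff.symm
  · exact fun a b => Sum.inr_injective.eq_iff.symm
  · exact fun a b h => by cases h
  · exact fun a b h => by cases h

theorem Subgraph.sum_quotient_iso (h : Γ.IsFeynman) (h' : Γ'.IsFeynman)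
    (p : Γ.Subgraph × Γ'.Subgraph) : Nonempty (Iso ((Γ.quotient p.1).sum (Γ'.quotient p.2))
      ((Γ.sum Γ').quotient (Subgraph.sum h h' p))) := by
  have e₁ := Γ.sum_openEmb_inl Γ'
  have e₂ := Γ.sum_openEmb_inr Γ'
  have r₁ : Restr (Sum.inl : Γ.H → (Γ.sum Γ').H) p.1.1.adj (Sum.LiftRel p.1.1.adj p.2.1.adj) :=
    liftRel_restr_inl (fun _ _ => (p.1.semi h).symm) fun _ _ => (p.2.semi h').symm
  have r₂ : Restr (Sum.inr : Γ'.H → (Γ.sum Γ').H) p.2.1.adj (Sum.LiftRel p.1.1.adj p.2.1.adj) :=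
    liftRel_restr_inr (fun _ _ => (p.1.semi h).symm) fun _ _ => (p.2.semi h').symm
  have s₁ : Restr (Sum.inl : Γ.H → (Γ.sum Γ').H) Γ.Adj (Γ.sum Γ').Adj :=
    liftRel_restr_inl (fun _ _ => h.semi.symm) fun _ _ => h'.semi.symm
  have s₂ : Restr (Sum.inr : Γ'.H → (Γ.sum Γ').H) Γ'.Adj (Γ.sum Γ').Adj :=
    liftRel_restr_inr (fun _ _ => h.semi.symm) fun _ _ => h'.semi.symm
  refine Exists.elim (((Subgraph.sum h h' p).quotient_presents (sum_isFeynman h h')).exists_iso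
    (((p.1.quotient_presents h).sum (p.2.quotient_presents h')).congr (fun x => ?_)
      (fun x y _ _ => liftRel_congr (F := fun x y => HalfEdge.Joined (Γ.sum Γ').vert
        (Subgraph.sum h h' p).1.adj ((Γ.sum Γ').vert x) ((Γ.sum Γ').vert y)) ?_ ?_ ?_ ?_ x y)
      (fun x y _ _ => liftRel_congr (F := fun x y => x ≠ y ∧ HalfEdge.Linked (Γ.sum Γ').vert
        (Γ.sum Γ').Adj (Subgraph.sum h h' p).1.adj x y) ?_ ?_ ?_ ?_ x y))) fun e _ => ⟨e.symm⟩
  · rcases x with x | x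
    · exact kept_iff_of_emb e₁ r₁ s₁ _
    · exact kept_iff_of_emb e₂ r₂ s₂ _
  · exact fun a b => e₁.joined_iff r₁
  · exact fun a b => e₂.joined_iff r₂
  · intro a b hj
    obtain ⟨y, hy⟩ := e₁.joined_range r₁ hj
    cases hy
  · intro a b hj
    obtain ⟨y, hy⟩ := e₂.joined_range r₂ hj
    cases hy
  · exact fun a b => and_congr Sum.inl_injective.ne_iff.symm (e₁.linked_iff r₁ s₁)
  · exact fun a b => and_congr Sum.inr_injective.ne_iff.symm (e₂.linked_iff r₂ s₂)
  · rintro a b ⟨-, hl⟩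
    obtain ⟨y, hy, -⟩ := e₁.linked_aux r₁ s₁ hl
    cases hy
  · rintro a b ⟨-, hl⟩
    obtain ⟨y, hy, -⟩ := e₂.linked_aux r₂ s₂ hl
    cases hy

end SumSubgraph

end PreGraph

/-! ### The monoid of isomorphism classes and sums over subgraphs. -/

noncomputable instance (Γ : PreGraph) : Fintype Γ.Subgraph := Fintype.ofFinite _

namespace PreGraph

/-- The disjoint union of isomorphisms. -/
def Iso.sumCongr {Γ₁ Γ₂ Γ₁' Γ₂' : PreGraph} (e : Iso Γ₁ Γ₁') (e' : Iso Γ₂ Γ₂') :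
    Iso (Γ₁.sum Γ₂) (Γ₁'.sum Γ₂') where
  eV := Equiv.sumCongr e.eV e'.eV
  eH := Equiv.sumCongr e.eH e'.eH
  vert_eq := by
    rintro (h | h)
    · exact congrArg Sum.inl (e.vert_eq h)
    · exact congrArg Sum.inr (e'.vert_eq h)
  adj_iff := by
    have h : ∀ a b, Sum.LiftRel Γ₁'.Adj Γ₂'.Adj (Equiv.sumCongr e.eH e'.eH a)
        (Equiv.sumCongr e.eH e'.eH b) ↔ Sum.LiftRel Γ₁.Adj Γ₂.Adj a b := by
      rintro (a | a) (b | b) <;> simp [e.adj_iff, e'.adj_iff]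
    exact h

/-- Disjoint union is commutative. -/
def Iso.sumComm (Γ Γ' : PreGraph) : Iso (Γ.sum Γ') (Γ'.sum Γ) where
  eV := Equiv.sumComm _ _
  eH := Equiv.sumComm _ _
  vert_eq := by rintro (h | h) <;> rfl
  adj_iff := by
    have h : ∀ a b, Sum.LiftRel Γ'.Adj Γ.Adj (Equiv.sumComm Γ.H Γ'.H a) (Equiv.sumComm Γ.H Γ'.H b) ↔
        Sum.LiftRel Γ.Adj Γ'.Adj a b := by
      rintro (a | a) (b | b) <;> simp
    exact h

/-- Disjoint union is associative. -/
def Iso.sumAssoc (Γ Γ' Γ'' : PreGraph) : Iso ((Γ.sum Γ').sum Γ'') (Γ.sum (Γ'.sum Γ'')) where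
  eV := Equiv.sumAssoc _ _ _
  eH := Equiv.sumAssoc _ _ _
  vert_eq := by rintro ((h | h) | h) <;> rfl
  adj_iff := by
    have h : ∀ a b, Sum.LiftRel Γ.Adj (Sum.LiftRel Γ'.Adj Γ''.Adj)
        (Equiv.sumAssoc Γ.H Γ'.H Γ''.H a) (Equiv.sumAssoc Γ.H Γ'.H Γ''.H b) ↔
        Sum.LiftRel (Sum.LiftRel Γ.Adj Γ'.Adj) Γ''.Adj a b := by
      rintro ((a | a) | a) ((b | b) | b) <;> simp
    exact h

/-- The disjoint union with a graph without half-edges and vertices. -/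
def Iso.emptySum (Γ Γ' : PreGraph) [IsEmpty Γ.V] [IsEmpty Γ.H] : Iso (Γ.sum Γ') Γ' where
  eV := Equiv.emptySum _ _
  eH := Equiv.emptySum _ _
  vert_eq := by
    rintro (h | h)
    · exact isEmptyElim h
    · rfl
  adj_iff := by
    rintro (a | a) (b | b)
    · exact isEmptyElim a
    · exact isEmptyElim a
    · exact isEmptyElim b
    · exact Sum.liftRel_inr_inr.symm

/-- The empty graph. -/
def empty : PreGraph where
  H := Empty
  V := Empty
  finite_H := inferInstance
  finite_V := inferInstance
  vert := id
  Adj _ _ := False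

instance : IsEmpty empty.V := inferInstanceAs (IsEmpty Empty)

instance : IsEmpty empty.H := inferInstanceAs (IsEmpty Empty)

/-- Any two graphs without vertices are isomorphic. -/
def Iso.ofIsEmpty (Γ Γ' : PreGraph) [h : IsEmpty Γ.V] [h' : IsEmpty Γ'.V] : Iso Γ Γ' :=
  have := Γ.vert.isEmpty
  have := Γ'.vert.isEmpty
  ⟨Equiv.equivOfIsEmpty _ _, Equiv.equivOfIsEmpty _ _, fun h => isEmptyElim h,
    fun a => isEmptyElim a⟩

theorem empty_isFeynman : empty.IsFeynman :=
  isFeynman_iff.2 ⟨⟨⟨fun h => h.elim, fun h => h.elim, fun h => h.elim⟩, fun v => isEmptyElim v,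
    fun v => isEmptyElim v, fun _ _ h => h.elim⟩, fun v => isEmptyElim v⟩

end PreGraph

open PreGraph

theorem LFG.cls_eq {Γ Γ' : LFG} : Γ.cls = Γ'.cls ↔ Nonempty (Iso Γ.1 Γ'.1) := Quotient.eq

theorem LFG.cls_surjective : Function.Surjective LFG.cls := Quotient.mk_surjective

namespace LFGClass

noncomputable instance : Add LFGClass where
  add := Quotient.map₂ (fun Γ Γ' : LFG => ⟨Γ.1.sum Γ'.1, sum_isFeynman Γ.2 Γ'.2⟩)
    fun _ _ ⟨e⟩ _ _ ⟨e'⟩ => ⟨e.sumCongr e'⟩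

noncomputable instance : Zero LFGClass where
  zero := LFG.cls ⟨empty, empty_isFeynman⟩

noncomputable instance : AddCommMonoid LFGClass where
  add_assoc := by
    rintro ⟨a⟩ ⟨b⟩ ⟨c⟩
    exact Quotient.sound ⟨Iso.sumAssoc _ _ _⟩
  zero_add := by
    rintro ⟨a⟩
    exact Quotient.sound ⟨Iso.emptySum _ _⟩
  add_zero := by
    rintro ⟨a⟩
    exact Quotient.sound ⟨(Iso.sumComm _ _).trans (Iso.emptySum _ _)⟩
  add_comm := by
    rintro ⟨a⟩ ⟨b⟩
    exact Quotient.sound ⟨Iso.sumComm _ _⟩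
  nsmul := nsmulRec

theorem cls_sum (Γ Γ' : LFG) : LFG.cls ⟨Γ.1.sum Γ'.1, sum_isFeynman Γ.2 Γ'.2⟩ = Γ.cls + Γ'.cls :=
  rfl

/-- The number of vertices. -/
noncomputable def vcard : LFGClass → ℕ :=
  Quotient.lift (fun Γ : LFG => Nat.card Γ.1.V) fun _ _ ⟨e⟩ => Nat.card_congr e.eV

theorem vcard_cls (Γ : LFG) : vcard Γ.cls = Nat.card Γ.1.V := rfl

theorem vcard_add (M N : LFGClass) : vcard (M + N) = vcard M + vcard N := by
  obtain ⟨M, rfl⟩ := LFG.cls_surjective M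
  obtain ⟨N, rfl⟩ := LFG.cls_surjective N
  exact Nat.card_sum

theorem cls_eq_zero {Γ : LFG} : Γ.cls = 0 ↔ IsEmpty Γ.1.V := by
  refine LFG.cls_eq.trans ⟨fun ⟨e⟩ => e.eV.isEmpty, fun h => ⟨?_⟩⟩
  have : IsEmpty (⟨empty, empty_isFeynman⟩ : LFG).1.V := inferInstanceAs (IsEmpty Empty)
  exact .ofIsEmpty _ _

theorem vcard_eq_zero {M : LFGClass} : vcard M = 0 ↔ M = 0 := by
  obtain ⟨M, rfl⟩ := LFG.cls_surjective M
  rw [cls_eq_zero, vcard_cls, Finite.card_eq_zero_iff]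

/-- By trivalence a graph with `k` vertices has `3 * k` half-edges, so each class is represented on
standard finite sets, with finitely many choices of incidence and adjacency. -/
theorem finite_vcard_le (n : ℕ) : {M : LFGClass | vcard M ≤ n}.Finite := by
  let T : Type := Σ k : Fin (n + 1), (Fin (3 * k) → Fin k) × (Fin (3 * k) → Fin (3 * k) → Prop)
  let G : T → PreGraph := fun t =>
    ⟨Fin (3 * t.1), Fin t.1, inferInstance, inferInstance, t.2.1, t.2.2⟩
  let U : {t : T // (G t).IsFeynman} → LFGClass := fun t => LFG.cls ⟨G t.1, t.2⟩
  refine (Set.finite_range U).subset ?_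
  intro M hM
  obtain ⟨Γ, rfl⟩ := LFG.cls_surjective M
  have hH : Nat.card Γ.1.H = 3 * Nat.card Γ.1.V := by
    exact HalfEdge.card_eq_mul_of_fibers _ _ Γ.2.trivalent
  have eV := Finite.equivFin Γ.1.V
  have eH := (Finite.equivFin Γ.1.H).trans (finCongr hH)
  let t : T := ⟨⟨Nat.card Γ.1.V, Nat.lt_succ_of_le hM⟩, fun a => eV (Γ.1.vert (eH.symm a)),
    fun a b => Γ.1.Adj (eH.symm a) (eH.symm b)⟩
  let e : Iso (G t) Γ.1 := ⟨eV.symm, eH.symm, fun h => (eV.symm_apply_apply _).symm, fun _ _ => Iff.rfl⟩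
  exact ⟨⟨t, e.isFeynman Γ.2⟩, Quotient.sound ⟨e⟩⟩

/-- The class of a subgraph. -/
def sub (Γ : LFG) (γ : Γ.1.Subgraph) : LFGClass := LFG.cls ⟨γ.toGraph, γ.2⟩

/-- The class of a quotient. -/
def quo (Γ : LFG) (γ : Γ.1.Subgraph) : LFGClass :=
  LFG.cls ⟨Γ.1.quotient γ, γ.quotient_isFeynman Γ.2⟩

/-- The sum of `F γ (Γ / γ)` over all subgraphs `γ` of a graph `Γ`. -/
noncomputable def splitSum (F : LFGClass → LFGClass → ℚ) : LFGClass → ℚ :=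
  Quotient.lift (fun Γ : LFG => ∑ γ, F (sub Γ γ) (quo Γ γ)) (by
    rintro Γ Γ' ⟨e⟩
    refine Fintype.sum_bijective (Subgraph.map Γ.2 Γ'.2 e) (Subgraph.map_bijective _ _ _) _ _
      fun γ => ?_
    obtain ⟨i, -⟩ := Subgraph.map_iso Γ.2 Γ'.2 e γ
    obtain ⟨k, -⟩ := Subgraph.map_quotient_iso Γ.2 Γ'.2 e γ
    exact congrArg₂ F (LFG.cls_eq.2 ⟨i⟩) (LFG.cls_eq.2 ⟨k⟩))

theorem splitSum_cls (F : LFGClass → LFGClass → ℚ) (Γ : LFG) :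
    splitSum F Γ.cls = ∑ γ, F (sub Γ γ) (quo Γ γ) := rfl

/-- Both sides are the sum over flags γ' ⊆ γ ⊆ Γ of `G` at γ', γ/γ' and Γ/γ: on the left γ' is a
subgraph of γ, on the right γ/γ' is a subgraph of Γ/γ'. -/
theorem splitSum_assoc (G : LFGClass → LFGClass → LFGClass → ℚ) (L : LFGClass) :
    splitSum (fun M N => splitSum (fun M' M'' => G M' M'' N) M) L =
      splitSum (fun M N => splitSum (fun N' N'' => G M N' N'') N) L := by
  classical
  obtain ⟨Γ, rfl⟩ := LFG.cls_surjective L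
  let le : Γ.1.Subgraph → Γ.1.Subgraph → Prop := fun γ' γ => ∀ a b, γ'.1.adj a b → γ.1.adj a b
  rw [splitSum_cls, splitSum_cls]
  have h₁ : ∀ γ : Γ.1.Subgraph, splitSum (fun M' M'' => G M' M'' (quo Γ γ)) (sub Γ γ) =
      ∑ γ' : {γ' // le γ' γ}, G (sub Γ γ'.1)
        (LFG.cls ⟨_, (Subgraph.image Γ.2 γ'.1 ⟨γ, γ'.2⟩).2⟩) (quo Γ γ) := by
    intro γ
    refine (Fintype.sum_bijective _ (Subgraph.restrict_bijective Γ.2 γ) _ _ fun γ' => ?_).symm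
    congr 1
    · exact LFG.cls_eq.2 ((Subgraph.restrict_iso Γ.2 γ γ').map Iso.symm)
    · exact LFG.cls_eq.2 ((Subgraph.image_iso Γ.2 γ γ'.1 γ'.2).map Iso.symm)
  have h₂ : ∀ γ' : Γ.1.Subgraph, splitSum (fun N' N'' => G (sub Γ γ') N' N'') (quo Γ γ') =
      ∑ γ : {γ // le γ' γ}, G (sub Γ γ')
        (LFG.cls ⟨_, (Subgraph.image Γ.2 γ' γ).2⟩) (quo Γ γ.1) := by
    intro γ'
    refine (Fintype.sum_bijective _ (Subgraph.image_bijective Γ.2 γ') _ _ fun γ => ?_).symm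
    congr 1
    exact LFG.cls_eq.2 ((Subgraph.image_quotient_iso Γ.2 γ.1 γ' γ.2).map Iso.symm)
  simp_rw [h₁, h₂]
  rw [← Fintype.sum_sigma (fun p : Σ γ, {γ' // le γ' γ} => G (sub Γ p.2.1)
    (LFG.cls ⟨_, (Subgraph.image Γ.2 p.2.1 ⟨p.1, p.2.2⟩).2⟩) (quo Γ p.1)),
    ← Fintype.sum_sigma (fun p : Σ γ', {γ // le γ' γ} => G (sub Γ p.1)
      (LFG.cls ⟨_, (Subgraph.image Γ.2 p.1 p.2).2⟩) (quo Γ p.2.1))]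
  exact Fintype.sum_equiv ⟨fun p => ⟨p.2.1, p.1, p.2.2⟩, fun p => ⟨p.2.1, p.1, p.2.2⟩,
    fun _ => rfl, fun _ => rfl⟩ _ _ fun _ => rfl

theorem splitSum_left (F : LFGClass → LFGClass → ℚ) (hF : ∀ M N, M ≠ 0 → F M N = 0)
    (L : LFGClass) : splitSum F L = F 0 L := by
  obtain ⟨Γ, rfl⟩ := LFG.cls_surjective L
  rw [splitSum_cls, Fintype.sum_eq_single (Subgraph.bot Γ.2)]
  · congr 1
    · exact cls_eq_zero.2 ((Subgraph.isEmpty_iff Γ.2 _).2 fun _ _ h => h)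
    · exact LFG.cls_eq.2 (Subgraph.quotient_bot_iso Γ.2)
  · refine fun γ hγ => hF _ _ fun h => hγ ?_
    have := (Subgraph.isEmpty_iff Γ.2 γ).1 (cls_eq_zero.1 h)
    exact Subgraph.ext_adj Γ.2 fun a b => ⟨this a b, False.elim⟩

theorem splitSum_right (F : LFGClass → LFGClass → ℚ) (hF : ∀ M N, N ≠ 0 → F M N = 0)
    (L : LFGClass) : splitSum F L = F L 0 := by
  obtain ⟨Γ, rfl⟩ := LFG.cls_surjective L
  rw [splitSum_cls, Fintype.sum_eq_single (Subgraph.top Γ.2)]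
  · congr 1
    · exact LFG.cls_eq.2 (Subgraph.top_iso Γ.2)
    · exact cls_eq_zero.2 ((Subgraph.isEmpty_quotient_iff Γ.2 _).2 fun _ _ => Iff.rfl)
  · refine fun γ hγ => hF _ _ fun h => hγ ?_
    have := (Subgraph.isEmpty_quotient_iff Γ.2 γ).1 (cls_eq_zero.1 h)
    exact Subgraph.ext_adj Γ.2 this

/-- A subgraph of a disjoint union is a pair of subgraphs, and contraction acts separately on the
two parts. -/
theorem splitSum_add (F : LFGClass → LFGClass → ℚ) (L L' : LFGClass) :
    splitSum F (L + L') =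
      splitSum (fun M N => splitSum (fun M' N' => F (M + M') (N + N')) L') L := by
  obtain ⟨Γ, rfl⟩ := LFG.cls_surjective L
  obtain ⟨Γ', rfl⟩ := LFG.cls_surjective L'
  rw [← cls_sum, splitSum_cls, splitSum_cls]
  simp_rw [splitSum_cls]
  rw [← Fintype.sum_prod_type']
  refine (Fintype.sum_bijective _ (Subgraph.sum_bijective Γ.2 Γ'.2) _ _ fun p => ?_).symm
  exact congrArg₂ F (LFG.cls_eq.2 (Subgraph.sum_iso Γ.2 Γ'.2 p))
    (LFG.cls_eq.2 (Subgraph.sum_quotient_iso Γ.2 Γ'.2 p))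

/-- Vertices outside `γ` survive in the quotient. This bounds the support of a convolution product.
-/
theorem vcard_le (Γ : LFG) (γ : Γ.1.Subgraph) :
    vcard Γ.cls ≤ vcard (sub Γ γ) + vcard (quo Γ γ) := by
  classical
  have h : Nat.card Γ.1.V = Nat.card {v // v ∈ γ.1.verts} + Nat.card {v // v ∉ γ.1.verts} := by
    rw [← Nat.card_sum]
    exact Nat.card_congr (Equiv.sumCompl _).symm
  have h' : Nat.card {v // v ∉ γ.1.verts} ≤ Nat.card (Γ.1.quotient γ).V :=
    Nat.card_le_card_of_injective (Sum.inl : _ → (Γ.1.quotient γ).V) Sum.inl_injective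
  exact h.le.trans (Nat.add_le_add_left h' _)

end LFGClass

/-! ### Automorphisms, fillings and short exact sequences. -/

open PreGraph

namespace PreGraph

theorem Iso.ext_equiv {Γ Γ' : PreGraph} {e e' : Iso Γ Γ'} (hV : e.eV = e'.eV) (hH : e.eH = e'.eH) :
    e = e' := by
  obtain ⟨eV, eH, h1, h2⟩ := e
  obtain ⟨eV', eH', h1', h2'⟩ := e'
  obtain rfl : eV = eV' := hV
  obtain rfl : eH = eH' := hH
  rfl

/-- Conjugation with isomorphisms. -/
def Iso.congr {Γ₁ Γ₁' Γ₂ Γ₂' : PreGraph} (e₁ : Iso Γ₁ Γ₁') (e₂ : Iso Γ₂ Γ₂') :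
    Iso Γ₁ Γ₂ ≃ Iso Γ₁' Γ₂' where
  toFun e := (e₁.symm.trans e).trans e₂
  invFun e := (e₁.trans e).trans e₂.symm
  left_inv e := Iso.ext_equiv (by ext; simp [Iso.trans, Iso.symm]) (by ext; simp [Iso.trans, Iso.symm])
  right_inv e := Iso.ext_equiv (by ext; simp [Iso.trans, Iso.symm]) (by ext; simp [Iso.trans, Iso.symm])

theorem Iso.card_congr {Γ₁ Γ₁' Γ₂ Γ₂' : PreGraph} (h₁ : Nonempty (Iso Γ₁ Γ₁'))
    (h₂ : Nonempty (Iso Γ₂ Γ₂')) : Nat.card (Iso Γ₁ Γ₂) = Nat.card (Iso Γ₁' Γ₂') := by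
  obtain ⟨e₁⟩ := h₁
  obtain ⟨e₂⟩ := h₂
  exact Nat.card_congr (Iso.congr e₁ e₂)

/-- The subgraphs of `L` with identifications with `Γ₁` of the subgraph and with `Γ₂` of the
quotient. -/
abbrev Fill (Γ₁ Γ₂ L : PreGraph) : Type :=
  Σ γ : L.Subgraph, Iso Γ₁ γ.toGraph × Iso (L.quotient γ) Γ₂

end PreGraph

/-- The number of automorphisms. -/
noncomputable def autCard (Γ : PreGraph) : ℚ := Nat.card (Iso Γ Γ)

theorem autCard_ne_zero (Γ : PreGraph) : autCard Γ ≠ 0 := by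
  have : Nonempty (Iso Γ Γ) := ⟨.refl Γ⟩
  exact Nat.cast_ne_zero.2 Nat.card_pos.ne'

theorem LFG.card_iso_left (M N : LFG) :
    (Nat.card (Iso M.1 N.1) : ℚ) = autCard M.1 * M.delta N.cls := by
  classical
  rw [LFG.delta, Finsupp.single_apply]
  split_ifs with h
  · obtain ⟨e⟩ := LFG.cls_eq.1 h
    rw [mul_one, autCard, Iso.card_congr ⟨.refl M.1⟩ ⟨e.symm⟩]
  · have : IsEmpty (Iso M.1 N.1) := ⟨fun e => h (LFG.cls_eq.2 ⟨e⟩)⟩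
    simp

theorem LFG.card_iso_right (M N : LFG) :
    (Nat.card (Iso N.1 M.1) : ℚ) = autCard M.1 * M.delta N.cls := by
  rw [← LFG.card_iso_left]
  exact congrArg _ (Nat.card_congr ⟨Iso.symm, Iso.symm, fun _ => rfl, fun _ => rfl⟩)

/-- Over a given subgraph, the identifications with `M` and `N` number |Aut M| |Aut N| if the
subgraph and its quotient have the right classes, and 0 otherwise. -/
theorem LFGClass.card_fill (M N L : LFG) : (Nat.card (Fill M.1 N.1 L.1) : ℚ) =
    autCard M.1 * autCard N.1 * splitSum (fun A B => M.delta A * N.delta B) L.cls := by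
  rw [Nat.card_sigma, splitSum_cls, Finset.mul_sum, Nat.cast_sum]
  refine Finset.sum_congr rfl fun γ _ => ?_
  rw [Nat.card_prod, Nat.cast_mul]
  have h₁ := M.card_iso_left ⟨γ.toGraph, γ.2⟩
  have h₂ := N.card_iso_right ⟨L.1.quotient γ, γ.quotient_isFeynman L.2⟩
  dsimp only at h₁ h₂
  rw [h₁, h₂, sub, quo]
  ring

namespace LFG

theorem isBot_iff {Γ : LFG} (γ : Γ.1.Subgraph) : γ.IsBot ↔ γ = Subgraph.bot Γ.2 := by
  constructor
  · intro h
    refine Subgraph.ext_adj Γ.2 fun a b => ⟨fun hab => ?_, False.elim⟩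
    have := (γ.1.adj_le _ _ hab).2.1
    rw [h] at this
    exact this
  · rintro rfl
    refine Set.eq_empty_of_forall_notMem fun v hv => ?_
    obtain ⟨a, -, ha⟩ := ((Subgraph.bot Γ.2).mem_verts Γ.2 v).1 hv
    exact ha fun _ h => h

theorem isTop_iff {Γ : LFG} (γ : Γ.1.Subgraph) : γ.IsTop ↔ γ = Subgraph.top Γ.2 := by
  constructor
  · exact fun h => Subgraph.ext_adj Γ.2 fun a b => by rw [h.2]; rfl
  · rintro rfl
    exact ⟨Set.eq_univ_of_forall fun v => ((Subgraph.top Γ.2).mem_verts Γ.2 v).2 (Γ.2.touched v), rfl⟩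

/-- The first kernel must be empty and the last image full, and `M` modulo the empty subgraph is
`M`; what remains is a subgraph of `L` with two identifications. -/
theorem card_shortExact (M L N : LFG) :
    Nat.card (ShortExact M L N) = Nat.card (Fill M.1 N.1 L.1) := by
  have e₁ : Nat.card (Fill M.1 N.1 L.1) = Nat.card (Σ γ : L.1.Subgraph,
      Iso (M.1.quotient (Subgraph.bot M.2)) γ.toGraph ×
        Iso (L.1.quotient γ) (Subgraph.top N.2).toGraph) := by
    rw [Nat.card_sigma, Nat.card_sigma]
    refine Finset.sum_congr rfl fun γ _ => ?_
    rw [Nat.card_prod, Nat.card_prod,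
      Iso.card_congr ((Subgraph.quotient_bot_iso M.2).map Iso.symm) ⟨.refl γ.toGraph⟩,
      Iso.card_congr ⟨.refl (L.1.quotient γ)⟩ ((Subgraph.top_iso N.2).map Iso.symm)]
  rw [e₁]
  refine (Nat.card_congr (Equiv.ofBijective (fun p => ⟨(⟨Subgraph.bot M.2, p.1, p.2.1⟩,
    ⟨p.1, Subgraph.top N.2, p.2.2⟩), (isBot_iff _).2 rfl, (isTop_iff _).2 rfl, rfl⟩)
    ⟨?_, ?_⟩)).symm
  · rintro ⟨γ, i, k⟩ ⟨γ', i', k'⟩ h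
    obtain ⟨h₁, h₂⟩ := Prod.mk.inj (congrArg Subtype.val h)
    obtain ⟨-, rfl, h₁⟩ := Hom.mk.inj h₁
    obtain ⟨-, -, h₂⟩ := Hom.mk.inj h₂
    exact congrArg _ (Prod.ext (eq_of_heq h₁) (eq_of_heq h₂))
  · rintro ⟨⟨⟨ker, im, iso⟩, ⟨ker', im', iso'⟩⟩, h₁, h₂, h₃⟩
    dsimp only at h₁ h₂ h₃
    obtain rfl := (isBot_iff _).1 h₁
    obtain rfl := (isTop_iff _).1 h₂
    subst h₃
    exact ⟨⟨im, iso, iso'⟩, rfl⟩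

end LFG

/-! ### Positions of the half-edges in a filling. -/

namespace PreGraph

open HalfEdge

namespace Fill

variable {Γ₁ Γ₂ L : PreGraph}

/-- The half-edges of `L` corresponding to those of `Γ₁`. -/
def inner (p : Fill Γ₁ Γ₂ L) (x : Γ₁.H) : L.H := p.1.val (p.2.1.eH x)

/-- The half-edges of `L` corresponding to those of `Γ₂`. -/
def outer (p : Fill Γ₁ Γ₂ L) (c : Γ₂.H) : L.H := p.1.up (p.2.2.eH.symm c)

theorem inner_injective (p : Fill Γ₁ Γ₂ L) : Function.Injective p.inner :=
  Subtype.val_injective.comp p.2.1.eH.injective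

theorem inner_mem (p : Fill Γ₁ Γ₂ L) (x : Γ₁.H) : L.vert (p.inner x) ∈ p.1.1.verts := (p.2.1.eH x).2

theorem exists_inner (p : Fill Γ₁ Γ₂ L) {h : L.H} (hh : L.vert h ∈ p.1.1.verts) :
    ∃ x, p.inner x = h :=
  ⟨p.2.1.eH.symm ⟨h, hh⟩, congrArg Subtype.val (p.2.1.eH.apply_symm_apply _)⟩

theorem adj_inner (p : Fill Γ₁ Γ₂ L) (x y : Γ₁.H) :
    p.1.1.adj (p.inner x) (p.inner y) ↔ Γ₁.Adj x y := p.2.1.adj_iff x y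

theorem adj_iff (p : Fill Γ₁ Γ₂ L) (a b : L.H) :
    p.1.1.adj a b ↔ ∃ x y, p.inner x = a ∧ p.inner y = b ∧ Γ₁.Adj x y := by
  constructor
  · intro h
    obtain ⟨x, rfl⟩ := p.exists_inner (p.1.1.adj_le _ _ h).2.1
    obtain ⟨y, rfl⟩ := p.exists_inner (p.1.1.adj_le _ _ h).2.2
    exact ⟨x, y, rfl, rfl, (p.adj_inner x y).1 h⟩
  · rintro ⟨x, y, rfl, rfl, h⟩
    exact (p.adj_inner x y).2 h

theorem vert_inner (p : Fill Γ₁ Γ₂ L) (x y : Γ₁.H) :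
    L.vert (p.inner x) = L.vert (p.inner y) ↔ Γ₁.vert x = Γ₁.vert y :=
  Subtype.ext_iff.symm.trans (p.2.1.vert_eq_iff x y)

theorem outer_injective (p : Fill Γ₁ Γ₂ L) : Function.Injective p.outer :=
  p.1.up_injective.comp p.2.2.eH.symm.injective

theorem exists_outer (p : Fill Γ₁ Γ₂ L) {h : L.H} (hh : L.vert h ∉ p.1.1.verts) :
    ∃ c, p.outer c = h :=
  ⟨p.2.2.eH (.inl ⟨h, hh⟩), congrArg p.1.up (p.2.2.eH.symm_apply_apply _)⟩

theorem free_inner (p : Fill Γ₁ Γ₂ L) (x : Γ₁.H) : Free p.1.1.adj (p.inner x) ↔ Γ₁.IsExternal x := by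
  constructor
  · exact fun h y hy => h _ ((p.adj_inner x y).2 hy)
  · intro h b hb
    obtain ⟨y, rfl⟩ := p.exists_inner (p.1.1.adj_le _ _ hb).2.2
    exact h y ((p.adj_inner x y).1 hb)

theorem joined_inner (p : Fill Γ₁ Γ₂ L) {x y : Γ₁.H} (h : Γ₁.Joined Γ₁.Adj (Γ₁.vert x) (Γ₁.vert y)) :
    HalfEdge.Joined L.vert p.1.1.adj (L.vert (p.inner x)) (L.vert (p.inner y)) := by
  have h' : HalfEdge.Joined L.vert p.1.1.adj (p.2.1.eV (Γ₁.vert x)).1 (p.2.1.eV (Γ₁.vert y)).1 := by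
    refine eqvGen_map (fun v => (p.2.1.eV v).1) ?_ h
    rintro v w ⟨a, b, hab, rfl, rfl⟩
    rw [← p.2.1.vert_eq, ← p.2.1.vert_eq]
    exact HalfEdge.Joined.of_rel (vert := L.vert) ((p.adj_inner a b).2 hab)
  rwa [← p.2.1.vert_eq, ← p.2.1.vert_eq] at h'

theorem legs_inner (p : Fill Γ₁ Γ₂ L) (hc : Γ₁.IsConnected) (x : Γ₁.H) :
    HalfEdge.legs L.vert p.1.1.adj (L.vert (p.inner x)) = Nat.card Γ₁.Ex := by
  refine (Nat.card_congr (Equiv.ofBijective (fun y : Γ₁.Ex => ⟨p.inner y.1, (p.free_inner _).2 y.2,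
    p.joined_inner (hc.2 _ _)⟩) ⟨?_, ?_⟩)).symm
  · intro y z h
    have h' := congrArg Subtype.val h
    exact Subtype.ext (p.inner_injective h')
  · rintro ⟨h, hf, hj⟩
    obtain ⟨y, rfl⟩ := p.exists_inner (p.1.mem_of_joined (p.inner_mem x) hj.symm)
    exact ⟨⟨y, (p.free_inner _).1 hf⟩, rfl⟩

theorem kept_outer (p : Fill Γ₁ Γ₂ L) (hL : L.IsFeynman) (c : Γ₂.H) :
    Kept L.vert L.Adj p.1.1.adj (p.outer c) := (p.1.range_up hL _).1 ⟨_, rfl⟩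

theorem exists_outer_of_kept (p : Fill Γ₁ Γ₂ L) (hL : L.IsFeynman) {h : L.H}
    (hh : Kept L.vert L.Adj p.1.1.adj h) : ∃ c, p.outer c = h := by
  obtain ⟨c, rfl⟩ := (p.1.range_up hL _).2 hh
  exact ⟨p.2.2.eH c, congrArg p.1.up (p.2.2.eH.symm_apply_apply _)⟩

theorem vert_outer (p : Fill Γ₁ Γ₂ L) (c d : Γ₂.H) : Γ₂.vert c = Γ₂.vert d ↔
    HalfEdge.Joined L.vert p.1.1.adj (L.vert (p.outer c)) (L.vert (p.outer d)) :=
  (p.2.2.symm.vert_eq_iff c d).symm.trans (p.1.quotient_vert_iff _ _)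

theorem adj_outer (p : Fill Γ₁ Γ₂ L) (hL : L.IsFeynman) (c d : Γ₂.H) : Γ₂.Adj c d ↔
    c ≠ d ∧ HalfEdge.Linked L.vert L.Adj p.1.1.adj (p.outer c) (p.outer d) := by
  refine (p.2.2.symm.adj_iff c d).symm.trans ((p.1.model hL).adj_iff _ _ |>.trans ?_)
  exact and_congr_left' p.2.2.eH.symm.injective.ne_iff

/-- A filling is determined by where the half-edges of `Γ₁` and `Γ₂` lie in `L`. Insertions and
fillings are counted by comparing these pairs of maps. -/
theorem maps_injective (hL : L.IsFeynman) (h₁ : Γ₁.IsFeynman) (h₂ : Γ₂.IsFeynman) :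
    Function.Injective (fun p : Fill Γ₁ Γ₂ L => (p.inner, p.outer)) := by
  intro p q h
  obtain ⟨hi, ho⟩ := Prod.mk.inj h
  have hγ : p.1 = q.1 := Subgraph.ext_adj hL fun a b => by rw [p.adj_iff, q.adj_iff, hi]
  obtain ⟨γ, i, k⟩ := p
  obtain ⟨γ', i', k'⟩ := q
  obtain rfl : γ = γ' := hγ
  have e₁ : i = i' := Iso.ext_of_eH h₁.surj fun a => Subtype.ext (congrFun hi a)
  have e₂ : k.symm = k'.symm := Iso.ext_of_eH h₂.surj fun a => γ.up_injective (congrFun ho a)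
  have e₃ : k = k' := congrArg Iso.symm e₂
  rw [e₁, e₃]

/-- In a connected graph, the subgraph is not a connected component. -/
theorem exists_not_free (p : Fill Γ₁ Γ₂ L) (hL : L.IsFeynman) (hLc : L.IsConnected)
    (h₂ : Γ₂.IsFeynman) (hc₂ : Γ₂.IsConnected) (x : Γ₁.H) :
    ∃ k, Free p.1.1.adj k ∧ HalfEdge.Joined L.vert p.1.1.adj (L.vert k) (L.vert (p.inner x)) ∧
      ¬ Free L.Adj k := by
  -- Otherwise the copy of `Γ₁` would be a component of `L`, hence all of it, and the quotient would
  -- be empty, unlike `Γ₂`.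
  by_contra! hn
  obtain ⟨c, -⟩ := h₂.surj hc₂.1.some
  obtain ⟨-, k, hk, hj, hB⟩ := p.kept_outer hL c
  have := joined_of_whole hL.semi.toMatching (p.1.semi hL).toMatching p.1.adj_le hn
    (hLc.2 _ (L.vert (p.outer c)))
  exact hB (hn k hk (hj.trans this.symm))

end Fill

end PreGraph

/-! ### Fillings of connected graphs are insertions. -/

namespace PreGraph

open HalfEdge

theorem presents_of_model {Γ₂ L : PreGraph} {A : L.H → L.H → Prop} {u : Γ₂.H → L.H}
    (hL : L.IsFeynman) (h₂ : Γ₂.IsFeynman) (hA : Semi L.vert A) (hle : ∀ a b, A a b → L.Adj a b)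
    (m : Model L.vert A L.Adj Γ₂.vert Γ₂.Adj u) :
    Presents Γ₂ u (Kept L.vert L.Adj A)
      (fun a b => HalfEdge.Joined L.vert A (L.vert a) (L.vert b))
      (fun a b => a ≠ b ∧ HalfEdge.Linked L.vert L.Adj A a b) where
  inj := m.inj
  surj := m.surj
  range x := by
    constructor
    · rintro ⟨c, rfl⟩
      obtain ⟨d, hd, hd'⟩ := h₂.touched (Γ₂.vert c)
      rw [m.free_iff hL.semi.toMatching hA hle (hL.semi.good hA hle)] at hd'
      exact ⟨m.isEnd c, u d, (m.isEnd d).1, (m.vert_iff _ _).1 hd, hd'⟩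
    · rintro ⟨he, k, hk, hj, hB⟩
      obtain ⟨c, rfl⟩ := m.cover k (he.of_joined hk hj.symm) hB
      exact m.closed c x he.1 hj.symm
  vert_iff := m.vert_iff
  adj_iff a b := (m.adj_iff a b).trans (and_congr_left' m.inj.ne_iff.symm)

namespace Fill

variable {Γ₁ Γ₂ L : PreGraph}

theorem exists_of_model (hL : L.IsFeynman) (h₁ : Γ₁.IsFeynman) (h₂ : Γ₂.IsFeynman)
    {A : L.H → L.H → Prop} {i : Γ₁.H → L.H} {j : Γ₁.V → L.V} {u : Γ₂.H → L.H}
    (hA : Semi L.vert A) (hle : ∀ a b, A a b → L.Adj a b) (e : OpenEmb Γ₁.vert L.vert i j)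
    (r : Restr i Γ₁.Adj A) (hr : ∀ a b, A a b → ∃ x, i x = a)
    (m : Model L.vert A L.Adj Γ₂.vert Γ₂.Adj u) :
    ∃ p : Fill Γ₁ Γ₂ L, p.inner = i ∧ p.outer = u := by
  have p₁ : Presents Γ₁ i (fun h => Touched L.vert A (L.vert h))
      (fun a b => L.vert a = L.vert b) A := by
    refine ⟨e.inj, h₁.surj, fun x => ⟨?_, ?_⟩, fun a b => ?_, r.iff⟩
    · rintro ⟨a, rfl⟩
      rw [e.comm]
      exact (Subgraph.touched_iff_of_emb e r _).1 (h₁.touched _)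
    · rintro ⟨a, ha, ha'⟩
      obtain ⟨b, hb⟩ := not_free.1 ha'
      obtain ⟨y, rfl⟩ := hr a b hb
      exact e.full x (Γ₁.vert y) (by rw [← ha, e.comm])
    · rw [e.comm, e.comm, e.injV.eq_iff]
  obtain ⟨i₁, hi₁⟩ := p₁.exists_iso ((Subgraph.ofAdj hL A hA hle).presents hL)
  obtain ⟨i₂, hi₂⟩ := (presents_of_model hL h₂ hA hle m).exists_iso
    ((Subgraph.ofAdj hL A hA hle).quotient_presents hL)
  exact ⟨⟨Subgraph.ofAdj hL A hA hle, i₁, i₂.symm⟩, funext hi₁, funext hi₂⟩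

theorem exists_map {L' : PreGraph} (hL : L.IsFeynman) (hL' : L'.IsFeynman) (g : Iso L L')
    (p : Fill Γ₁ Γ₂ L) : ∃ q : Fill Γ₁ Γ₂ L', (∀ x, q.inner x = g.eH (p.inner x)) ∧
      ∀ c, q.outer c = g.eH (p.outer c) := by
  obtain ⟨i₁, hi₁⟩ := Subgraph.map_iso hL hL' g p.1
  obtain ⟨i₂, hi₂⟩ := Subgraph.map_quotient_iso hL hL' g p.1
  exact ⟨⟨p.1.map hL hL' g, p.2.1.trans i₁, i₂.symm.trans p.2.2⟩, fun x => hi₁ _, fun c => hi₂ _⟩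

theorem adj_le (p : Fill Γ₁ Γ₂ L) {a b : L.H} (h : p.1.1.adj a b) : L.Adj a b := p.1.adj_le _ _ h

/-- The three-legged copy of `Γ₁` is not a component of `L`, so it becomes a vertex `v` of the
quotient and its legs are the half-edges at `v`. This gives `f`, and `L` is reassembled from the
half-edges of `Γ₂` and the non-external ones of `Γ₁`. -/
theorem exists_vertex (p : Fill Γ₁ Γ₂ L) (hL : L.IsFeynman) (hLc : L.IsConnected)
    (h₁ : Γ₁.IsFeynman) (hc₁ : Γ₁.IsConnected) (h₂ : Γ₂.IsFeynman) (hc₂ : Γ₂.IsConnected)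
    (h3 : Nat.card Γ₁.Ex = 3) :
    ∃ (v : Γ₂.V) (f : Γ₁.Ex ≃ {h : Γ₂.H // Γ₂.vert h = v}) (g : Iso (Γ₂.insertVertex Γ₁ v f) L),
      (∀ x, g.eH (vertexIncl v f x) = p.inner x) ∧ ∀ c, g.eH (.inl c) = p.outer c := by
  have hB := hL.semi.toMatching
  have hA := p.1.semi hL
  have hinner : ∀ x : Γ₁.Ex, ∃ c, p.outer c = p.inner x.1 := fun x =>
    p.exists_outer_of_kept hL ⟨⟨(p.free_inner _).2 x.2, (p.legs_inner hc₁ _).trans h3⟩,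
      p.exists_not_free hL hLc h₂ hc₂ _⟩
  choose f₀ hf₀ using hinner
  have hpos : 0 < Nat.card Γ₁.Ex := by omega
  obtain ⟨⟨x₀⟩, -⟩ := Nat.card_pos_iff.1 hpos
  have hv : ∀ x, Γ₂.vert (f₀ x) = Γ₂.vert (f₀ x₀) := fun x => by
    rw [p.vert_outer, hf₀, hf₀]
    exact p.joined_inner (hc₁.2 _ _)
  have hbij : Function.Bijective
      (fun x => ⟨f₀ x, hv x⟩ : Γ₁.Ex → {h : Γ₂.H // Γ₂.vert h = Γ₂.vert (f₀ x₀)}) := by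
    refine Function.Injective.bijective_of_nat_card_le (fun x y h => ?_)
      (by rw [h₂.trivalent, h3])
    have h := congrArg Subtype.val h
    dsimp only at h
    have h' := hf₀ x
    rw [h, hf₀] at h'
    exact Subtype.ext (p.inner_injective h'.symm)
  set v := Γ₂.vert (f₀ x₀)
  set f := Equiv.ofBijective _ hbij
  have hfx : ∀ x, p.outer (f x).1 = p.inner x.1 := hf₀
  have hfree : ∀ c, Free p.1.1.adj (p.outer c) := fun c => (p.kept_outer hL c).1.1
  have hnot : ∀ c, Γ₂.vert c ≠ v → L.vert (p.outer c) ∉ p.1.1.verts := by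
    intro c hc hm
    obtain ⟨x, hx⟩ := p.exists_inner hm
    have hxe : Γ₁.IsExternal x := (p.free_inner _).1 (hx ▸ hfree c)
    apply hc
    rw [← p.outer_injective ((hfx ⟨x, hxe⟩).trans hx)]
    exact (f _).2
  let k : (Γ₂.insertVertex Γ₁ v f).H → L.H := Sum.elim p.outer fun x => p.inner x.1
  have hk : ∀ x, k (vertexIncl v f x) = p.inner x := by
    intro x
    by_cases hx : Γ₁.IsExternal x
    · rw [vertexIncl_ext v f ⟨x, hx⟩]
      exact hfx ⟨x, hx⟩
    · rw [vertexIncl_int v f ⟨x, hx⟩]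
      rfl
  have hcases : ∀ a : (Γ₂.insertVertex Γ₁ v f).H, (∃ x, vertexIncl v f x = a) ∨
      ∃ c, Γ₂.vert c ≠ v ∧ a = .inl c := by
    rintro (c | x)
    · by_cases hc : Γ₂.vert c = v
      · left
        refine ⟨(f.symm ⟨c, hc⟩).1, ?_⟩
        rw [vertexIncl_ext, Equiv.apply_symm_apply]
      · exact .inr ⟨c, hc, rfl⟩
    · exact .inl ⟨x.1, vertexIncl_int v f x⟩
  have hkb : Function.Bijective k := by
    constructor
    · rintro (c | x) (d | y) h
      · exact congrArg Sum.inl (p.outer_injective h)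
      · exact absurd ((p.free_inner y.1).1 ((show p.outer c = p.inner y.1 from h) ▸ hfree c)) y.2
      · exact absurd ((p.free_inner x.1).1 ((show p.inner x.1 = p.outer d from h) ▸ hfree d)) x.2
      · exact congrArg Sum.inr (Subtype.ext (p.inner_injective h))
    · intro h
      by_cases hh : L.vert h ∈ p.1.1.verts
      · obtain ⟨x, rfl⟩ := p.exists_inner hh
        exact ⟨_, hk x⟩
      · obtain ⟨c, rfl⟩ := p.exists_outer hh
        exact ⟨.inl c, rfl⟩
  have hs := (insertVertex_closed v f h₁ hc₁ h₂ hc₂).1.surj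
  have hout : ∀ x c, Γ₂.vert c ≠ v → L.vert (p.inner x) ≠ L.vert (p.outer c) := fun x c hc h =>
    hnot c hc (h ▸ p.inner_mem x)
  refine ⟨v, f, Iso.ofEquiv hs hL.surj (Equiv.ofBijective k hkb) ?_ ?_, hk, fun c => rfl⟩
  · intro a b
    show _ ↔ L.vert (k a) = L.vert (k b)
    rcases hcases a with ⟨x, rfl⟩ | ⟨c, hc, rfl⟩ <;> rcases hcases b with ⟨y, rfl⟩ | ⟨d, hd, rfl⟩
    · rw [hk, hk, p.vert_inner, (vertex_openEmb v f).comm, (vertex_openEmb v f).comm]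
      exact Sum.inr_injective.eq_iff
    · rw [hk, (vertex_openEmb v f).comm, insertVertex_vert_inl_of_ne v f d hd]
      exact iff_of_false (fun h => by cases h) (hout x d hd)
    · rw [hk, (vertex_openEmb v f).comm, insertVertex_vert_inl_of_ne v f c hc]
      exact iff_of_false (fun h => by cases h) fun h => hout y c hc h.symm
    · rw [insertVertex_vert_inl_of_ne v f c hc, insertVertex_vert_inl_of_ne v f d hd]
      refine (Sum.inl_injective.eq_iff.trans Subtype.ext_iff).trans ((p.vert_outer c d).trans ?_)
      exact ⟨p.1.joined_of_not_mem (hnot c hc), fun h => .of_eq h⟩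
  · have hno : ∀ c (x : {x // ¬ Γ₁.IsExternal x}), ¬ L.Adj (p.inner x.1) (p.outer c) := by
      intro c x h
      obtain ⟨y, hy⟩ := not_free.1 x.2
      have hxy := (p.adj_inner _ _).2 hy
      have := hB.unique h (p.adj_le hxy)
      exact hfree c _ (this ▸ hA.symm hxy)
    rintro (c | x) (d | y)
    · show L.Adj (p.outer c) (p.outer d) ↔ Sum.LiftRel _ _ _ _
      rw [Sum.liftRel_inl_inl, p.adj_outer hL]
      constructor
      · intro h
        refine ⟨?_, .of_rel h (hfree c _)⟩
        rintro rfl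
        exact hB.irrefl _ h
      -- The edge of `L` at `p.outer c` already leads to a half-edge `p.outer e` of the quotient;
      -- since a chain has only one second end, `e = d`.
      · rintro ⟨hne, h⟩
        by_cases hf : Free L.Adj (p.outer c)
        · exact absurd (p.outer_injective (linked_eq_of_free hB (p.kept_outer hL c).1 hf h)).symm hne
        · obtain ⟨q, hq⟩ := not_free.1 hf
          have hqA : Free p.1.1.adj q :=
            free_of_rel hB p.1.adj_le (hB.symm hq) fun h => hfree c _ (hA.symm h)
          have hqo : ∃ e, p.outer e = q := by
            by_cases hm : L.vert q ∈ p.1.1.verts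
            · obtain ⟨x, rfl⟩ := p.exists_inner hm
              exact ⟨_, hfx ⟨x, (p.free_inner _).1 hqA⟩⟩
            · exact p.exists_outer hm
          obtain ⟨e, rfl⟩ := hqo
          have hce : p.outer c ≠ p.outer e := fun h => hB.irrefl _ (h ▸ hq : L.Adj (p.outer e) _)
          rwa [linked_ends_unique hB hA.toMatching (p.kept_outer hL c).1 (p.kept_outer hL d).1
            (p.kept_outer hL e).1 h (.of_rel hq (hfree c _))
            (fun h => hne (p.outer_injective h)) hce]
    · exact iff_of_false (fun h => hno c y (hB.symm h)) fun h => by cases h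
    · exact iff_of_false (fun h => hno d x h) fun h => by cases h
    · show L.Adj (p.inner x.1) (p.inner y.1) ↔ Sum.LiftRel _ _ _ _
      rw [Sum.liftRel_inr_inr, ← p.adj_inner]
      refine ⟨fun h => ?_, p.adj_le⟩
      by_contra hn
      exact x.2 ((p.free_inner _).1 (free_of_rel hB p.1.adj_le h hn))

/-- Both sides inject into pairs of maps to the half-edges of `L`, with the same image. On the
insertion side `f` is recovered because a leg of `Γ₁` and its image under `f` are the same
half-edge. -/
theorem card_vertex (hL : L.IsFeynman) (hLc : L.IsConnected) (h₁ : Γ₁.IsFeynman)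
    (hc₁ : Γ₁.IsConnected) (h₂ : Γ₂.IsFeynman) (hc₂ : Γ₂.IsConnected) (h3 : Nat.card Γ₁.Ex = 3) :
    Nat.card (Σ v, Σ f : Γ₁.Ex ≃ {h : Γ₂.H // Γ₂.vert h = v}, Iso (Γ₂.insertVertex Γ₁ v f) L) =
      Nat.card (Fill Γ₁ Γ₂ L) := by
  let F : (Σ v, Σ f : Γ₁.Ex ≃ {h : Γ₂.H // Γ₂.vert h = v}, Iso (Γ₂.insertVertex Γ₁ v f) L) →
      (Γ₁.H → L.H) × (Γ₂.H → L.H) := fun t =>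
    (fun x => t.2.2.eH (vertexIncl t.1 t.2.1 x), fun c => t.2.2.eH (.inl c))
  have hpos : 0 < Nat.card Γ₁.Ex := by omega
  obtain ⟨⟨x₀⟩, -⟩ := Nat.card_pos_iff.1 hpos
  have hF : Function.Injective F := by
    rintro ⟨v, f, g⟩ ⟨v', f', g'⟩ h
    obtain ⟨hi, ho⟩ := Prod.mk.inj h
    have hff : ∀ x, (f x).1 = (f' x).1 := by
      intro x
      have := congrFun hi x.1
      dsimp only at this
      rw [vertexIncl_ext, vertexIncl_ext] at this
      have h' := congrFun ho (f x).1
      dsimp only at h'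
      rw [h'] at this
      exact Sum.inl_injective (g'.eH.injective this)
    obtain rfl : v = v' := by rw [← (f x₀).2, ← (f' x₀).2, hff]
    obtain rfl : f = f' := Equiv.ext fun x => Subtype.ext (hff x)
    have hg : g = g' := by
      refine Iso.ext_of_eH (insertVertex_closed v f h₁ hc₁ h₂ hc₂).1.surj ?_
      rintro (c | x)
      · exact congrFun ho c
      · have := congrFun hi x.1
        dsimp only at this
        rwa [vertexIncl_int] at this
    rw [hg]
  rw [← Nat.card_range_of_injective hF, ← Nat.card_range_of_injective (maps_injective hL h₁ h₂)]
  refine congrArg (fun s : Set _ => Nat.card s) (Set.ext fun t => ⟨?_, ?_⟩)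
  · rintro ⟨⟨v, f, g⟩, rfl⟩
    obtain ⟨p, hp, hp'⟩ := exists_of_model (insertVertex_closed v f h₁ hc₁ h₂ hc₂).1 h₁ h₂
      (vertexAdj_semi v f h₁.semi h₂.semi) (vertexAdj_le v f) (vertex_openEmb v f)
      (vertex_restr v f h₁.semi.toMatching) (fun a b h => by
        cases h with
        | inl h => exact h.elim
        | @inr c d h => exact ⟨c.1, vertexIncl_int v f c⟩) (vertex_model v f h₁.semi h₂.semi hc₁)
    obtain ⟨q, hq, hq'⟩ := exists_map (insertVertex_closed v f h₁ hc₁ h₂ hc₂).1 hL g p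
    exact ⟨q, Prod.ext (funext fun x => (hq x).trans (by rw [hp]))
      (funext fun c => (hq' c).trans (by rw [hp']))⟩
  · rintro ⟨p, rfl⟩
    obtain ⟨v, f, g, hg, hg'⟩ := p.exists_vertex hL hLc h₁ hc₁ h₂ hc₂ h3
    exact ⟨⟨v, f, g⟩, Prod.ext (funext hg) (funext hg')⟩

/-- The copy of `Γ₁` is not a component of `L`, so by `Good` neither of its two legs is free in `L`.
Their partners lie outside the copy and are linked through it, which makes them an edge `e` of the
quotient. -/
theorem exists_edge (p : Fill Γ₁ Γ₂ L) (hL : L.IsFeynman) (hLc : L.IsConnected)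
    (h₁ : Γ₁.IsFeynman) (hc₁ : Γ₁.IsConnected) (h₂ : Γ₂.IsFeynman) (hc₂ : Γ₂.IsConnected)
    (h2 : Nat.card Γ₁.Ex = 2) :
    ∃ (e : Γ₂.IntEdge) (f : Γ₁.Ex ≃ {h : Γ₂.H // h ∈ e.1}) (g : Iso (Γ₂.insertEdge Γ₁ e f) L),
      (∀ x, g.eH (.inr x) = p.inner x) ∧ ∀ c, g.eH (.inl c) = p.outer c := by
  have hB := hL.semi.toMatching
  have hA := p.1.semi hL
  have hG := p.1.good hL
  have hlegs : ∀ x, HalfEdge.legs L.vert p.1.1.adj (L.vert (p.inner x)) = 2 := fun x =>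
    (p.legs_inner hc₁ x).trans h2
  have hbr : ∀ x y : Γ₁.Ex, x ≠ y → Bridge L.vert p.1.1.adj (p.inner x.1) (p.inner y.1) :=
    fun x y hxy => bridge_of_legs_two (hlegs _) ((p.free_inner _).2 x.2) ((p.free_inner _).2 y.2)
      (p.joined_inner (hc₁.2 _ _)) fun h => hxy (Subtype.ext (p.inner_injective h))
  obtain ⟨x₁, x₂, hne, huniv⟩ : ∃ x₁ x₂ : Γ₁.Ex, x₁ ≠ x₂ ∧ ∀ x, x = x₁ ∨ x = x₂ := by
    obtain ⟨x₁, x₂, hne, hu⟩ := Nat.card_eq_two_iff.1 h2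
    refine ⟨x₁, x₂, hne, fun x => ?_⟩
    have : x ∈ ({x₁, x₂} : Set Γ₁.Ex) := hu ▸ Set.mem_univ x
    exact this
  have hnf : ∀ x : Γ₁.Ex, ¬ Free L.Adj (p.inner x.1) := by
    obtain ⟨k, hk, hj, hkB⟩ := p.exists_not_free hL hLc h₂ hc₂ x₁.1
    obtain ⟨y, rfl⟩ := p.exists_inner (p.1.mem_of_joined (p.inner_mem _) hj.symm)
    have hy := (p.free_inner _).1 hk
    intro x hx
    by_cases hxy : x = ⟨y, hy⟩
    · rw [hxy] at hx
      exact hkB hx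
    · exact hkB ((hG.bridge_iff (hbr _ _ hxy)).1 hx)
  -- If the two legs were joined to each other, their chain would consist of these two half-edges
  -- alone and would contain no end.
  have hmem : ∀ (x : Γ₁.Ex) q, L.Adj (p.inner x.1) q → L.vert q ∉ p.1.1.verts := by
    intro x q hq hm
    have hAx := (p.free_inner x.1).2 x.2
    obtain ⟨y, rfl⟩ := p.exists_inner hm
    have hy : Γ₁.IsExternal y := (p.free_inner _).1
      (free_of_rel hB p.1.adj_le (hB.symm hq) fun h => hAx _ (hA.symm h))
    have hxy : x.1 ≠ y := fun h => hB.irrefl _ (h ▸ hq : L.Adj (p.inner y) _)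
    have hb := hbr x ⟨y, hy⟩ fun h => hxy (congrArg Subtype.val h)
    obtain ⟨k, hk, hl⟩ := hG.exists_end hA hAx (hnf x)
    have := (eqvGen_closed (P := fun h => h = p.inner x.1 ∨ h = p.inner y) (by
      have step : ∀ a b, (L.Adj a b ∧ ¬ p.1.1.adj a b) ∨ Bridge L.vert p.1.1.adj a b →
          (a = p.inner x.1 ∨ a = p.inner y) → (b = p.inner x.1 ∨ b = p.inner y) := by
        rintro a b (⟨h, -⟩ | h) (rfl | rfl)
        · exact .inr (hB.unique h hq)
        · exact .inl (hB.unique h (hB.symm hq))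
        · exact .inr (bridge_matching.unique h hb)
        · exact .inl (bridge_matching.unique h hb.symm)
      exact fun a b h => ⟨step a b h, step b a
        (h.imp (fun h => ⟨hB.symm h.1, fun h' => h.2 (hA.symm h')⟩) Bridge.symm)⟩) hl).1 (.inl rfl)
    have h3 := hk.2
    rcases this with rfl | rfl <;> rw [hlegs] at h3 <;> omega
  have hex : ∀ x : Γ₁.Ex, ∃ c, L.Adj (p.inner x.1) (p.outer c) := by
    intro x
    obtain ⟨q, hq⟩ := not_free.1 (hnf x)
    obtain ⟨c, rfl⟩ := p.exists_outer (hmem x q hq)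
    exact ⟨c, hq⟩
  choose f₀ hf₀ using hex
  have hinj : Function.Injective f₀ := by
    intro x y h
    have := hf₀ y
    rw [← h] at this
    exact Subtype.ext (p.inner_injective (hB.unique (hB.symm (hf₀ x)) (hB.symm this)))
  have hfree : ∀ c, Free p.1.1.adj (p.outer c) := fun c => (p.kept_outer hL c).1.1
  have hout : ∀ c, L.vert (p.outer c) ∉ p.1.1.verts := by
    intro c hm
    obtain ⟨x, hx⟩ := p.exists_inner hm
    have := (p.kept_outer hL c).1.2
    rw [← hx, hlegs] at this
    omega
  have hadj : Γ₂.Adj (f₀ x₁) (f₀ x₂) := by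
    rw [p.adj_outer hL]
    exact ⟨fun h => hne (hinj h), .trans (.of_rel (hB.symm (hf₀ x₁)) (hfree _ _))
      (.trans (.of_bridge (hbr _ _ hne)) (.of_rel (hf₀ x₂) ((p.free_inner _).2 x₂.2 _)))⟩
  set e : Γ₂.IntEdge := ⟨{f₀ x₁, f₀ x₂}, _, _, hadj, rfl⟩
  have hfe : ∀ x, f₀ x ∈ e.1 := by
    intro x
    rcases huniv x with rfl | rfl
    · exact .inl rfl
    · exact .inr rfl
  have hbij : Function.Bijective (fun x => ⟨f₀ x, hfe x⟩ : Γ₁.Ex → {h : Γ₂.H // h ∈ e.1}) :=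
    Function.Injective.bijective_of_nat_card_le (fun x y h => hinj (congrArg Subtype.val h))
      (by rw [e.card h₂.semi.toMatching, h2])
  let f := Equiv.ofBijective _ hbij
  have hef : ∀ c ∈ e.1, ∃ x, f₀ x = c := by
    rintro c (rfl | rfl)
    · exact ⟨_, rfl⟩
    · exact ⟨_, rfl⟩
  let k : (Γ₂.insertEdge Γ₁ e f).H → L.H := Sum.elim p.outer p.inner
  have hio : ∀ x c, p.inner x ≠ p.outer c := fun x c h => hout c (h ▸ p.inner_mem x)
  have hkb : Function.Bijective k := by
    constructor
    · rintro (c | x) (d | y) h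
      · exact congrArg Sum.inl (p.outer_injective h)
      · exact absurd h.symm (hio y c)
      · exact absurd h (hio x d)
      · exact congrArg Sum.inr (p.inner_injective h)
    · intro h
      by_cases hh : L.vert h ∈ p.1.1.verts
      · obtain ⟨x, rfl⟩ := p.exists_inner hh
        exact ⟨.inr x, rfl⟩
      · obtain ⟨c, rfl⟩ := p.exists_outer hh
        exact ⟨.inl c, rfl⟩
  have hs := (insertEdge_closed e f h₁ hc₁ h₂ hc₂).1.surj
  refine ⟨e, f, Iso.ofEquiv hs hL.surj (Equiv.ofBijective k hkb) ?_ ?_, fun x => rfl, fun c => rfl⟩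
  · rintro (c | x) (d | y)
    · refine (Sum.inl_injective.eq_iff.trans ((p.vert_outer c d).trans ?_))
      exact ⟨p.1.joined_of_not_mem (hout c), fun h => .of_eq h⟩
    · refine iff_of_false (fun h => by cases h) fun h => hout c ?_
      have h : L.vert (p.outer c) = L.vert (p.inner y) := h
      exact h ▸ p.inner_mem y
    · refine iff_of_false (fun h => by cases h) fun h => hout d ?_
      have h : L.vert (p.inner x) = L.vert (p.outer d) := h
      exact h ▸ p.inner_mem x
    · exact Sum.inr_injective.eq_iff.trans (p.vert_inner x y).symm
  · have hoi : ∀ c x, L.Adj (p.outer c) (p.inner x) ↔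
        ∃ hx : Γ₁.IsExternal x, (f ⟨x, hx⟩).1 = c := by
      intro c x
      constructor
      · intro h
        have hx : Γ₁.IsExternal x := (p.free_inner _).1
          (free_of_rel hB p.1.adj_le (hB.symm h) fun h' => hfree c _ (hA.symm h'))
        exact ⟨hx, p.outer_injective (hB.unique (hf₀ ⟨x, hx⟩) (hB.symm h))⟩
      · rintro ⟨hx, rfl⟩
        exact hB.symm (hf₀ ⟨x, hx⟩)
    have hback : ∀ c d, L.Adj (p.outer c) (p.outer d) → Γ₂.Adj c d := by
      intro c d h
      rw [p.adj_outer hL]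
      refine ⟨?_, .of_rel h (hfree c _)⟩
      rintro rfl
      exact hB.irrefl _ h
    rintro (c | x) (d | y)
    · show L.Adj (p.outer c) (p.outer d) ↔ Γ₂.Adj c d ∧ ¬ (c ∈ e.1 ∧ d ∈ e.1)
      constructor
      · refine fun h => ⟨hback c d h, fun hcd => ?_⟩
        obtain ⟨x, rfl⟩ := hef c hcd.1
        exact hio _ _ (hB.unique (hB.symm (hf₀ x)) h)
      · rintro ⟨h, hcd⟩
        have hl := ((p.adj_outer hL c d).1 h)
        have hfc : ¬ Free L.Adj (p.outer c) := fun hf => hl.1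
          (p.outer_injective (linked_eq_of_free hB (p.kept_outer hL c).1 hf hl.2)).symm
        obtain ⟨q, hq⟩ := not_free.1 hfc
        by_cases hm : L.vert q ∈ p.1.1.verts
        · obtain ⟨x, rfl⟩ := p.exists_inner hm
          obtain ⟨hx, rfl⟩ := (hoi c x).1 hq
          exact absurd ⟨(f _).2, e.mem_of_adj h₂.semi.toMatching (f _).2 h⟩ hcd
        · obtain ⟨d', rfl⟩ := p.exists_outer hm
          rwa [h₂.semi.toMatching.unique h (hback c d' hq)]
    · exact hoi c y
    · exact ⟨fun h => (hoi d x).1 (hB.symm h), fun h => hB.symm ((hoi d x).2 h)⟩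
    · show L.Adj (p.inner x) (p.inner y) ↔ Γ₁.Adj x y
      rw [← p.adj_inner]
      refine ⟨fun h => ?_, p.adj_le⟩
      by_contra hn
      exact hmem ⟨x, (p.free_inner _).1 (free_of_rel hB p.1.adj_le h hn)⟩ _ h (p.inner_mem y)

/-- The counting is as for vertices, except that `f` is now recovered from adjacency: `f x` is the
partner of the leg `x`. -/
theorem card_edge (hL : L.IsFeynman) (hLc : L.IsConnected) (h₁ : Γ₁.IsFeynman)
    (hc₁ : Γ₁.IsConnected) (h₂ : Γ₂.IsFeynman) (hc₂ : Γ₂.IsConnected) (h2 : Nat.card Γ₁.Ex = 2) :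
    Nat.card (Σ e, Σ f : Γ₁.Ex ≃ {h : Γ₂.H // h ∈ (e : Γ₂.IntEdge).1},
      Iso (Γ₂.insertEdge Γ₁ e f) L) = Nat.card (Fill Γ₁ Γ₂ L) := by
  let F : (Σ e, Σ f : Γ₁.Ex ≃ {h : Γ₂.H // h ∈ (e : Γ₂.IntEdge).1},
      Iso (Γ₂.insertEdge Γ₁ e f) L) → (Γ₁.H → L.H) × (Γ₂.H → L.H) := fun t =>
    (fun x => t.2.2.eH (.inr x), fun c => t.2.2.eH (.inl c))
  have hF : Function.Injective F := by
    rintro ⟨e, f, g⟩ ⟨e', f', g'⟩ h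
    obtain ⟨hi, ho⟩ := Prod.mk.inj h
    have hff : ∀ x, (f x).1 = (f' x).1 := by
      intro x
      have hx : (Γ₂.insertEdge Γ₁ e f).Adj (.inl (f x).1) (.inr x.1) := ⟨x.2, rfl⟩
      have hx := (g.adj_iff _ _).2 hx
      have h₁ : g.eH (.inl (f x).1) = g'.eH (.inl (f x).1) := congrFun ho (f x).1
      have h₂ : g.eH (.inr x.1) = g'.eH (.inr x.1) := congrFun hi x.1
      rw [h₁, h₂] at hx
      obtain ⟨_, hz⟩ : (Γ₂.insertEdge Γ₁ e' f').Adj (.inl (f x).1) (.inr x.1) :=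
        (g'.adj_iff _ _).1 hx
      exact hz.symm
    obtain rfl : e = e' := by
      refine Subtype.ext (Set.ext fun a => ⟨fun ha => ?_, fun ha => ?_⟩)
      · have := hff (f.symm ⟨a, ha⟩)
        rw [Equiv.apply_symm_apply] at this
        have this : a = (f' (f.symm ⟨a, ha⟩)).1 := this
        rw [this]
        exact (f' _).2
      · have := hff (f'.symm ⟨a, ha⟩)
        rw [Equiv.apply_symm_apply] at this
        have this : (f (f'.symm ⟨a, ha⟩)).1 = a := this
        rw [← this]
        exact (f _).2
    obtain rfl : f = f' := Equiv.ext fun x => Subtype.ext (hff x)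
    have hg : g = g' := by
      refine Iso.ext_of_eH (insertEdge_closed e f h₁ hc₁ h₂ hc₂).1.surj ?_
      rintro (c | x)
      · exact congrFun ho c
      · exact congrFun hi x
    rw [hg]
  rw [← Nat.card_range_of_injective hF, ← Nat.card_range_of_injective (maps_injective hL h₁ h₂)]
  refine congrArg (fun s : Set _ => Nat.card s) (Set.ext fun t => ⟨?_, ?_⟩)
  · rintro ⟨⟨e, f, g⟩, rfl⟩
    obtain ⟨p, hp, hp'⟩ := exists_of_model (insertEdge_closed e f h₁ hc₁ h₂ hc₂).1 h₁ h₂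
      (edgeAdj_semi e f h₁.semi h₂.semi) (edgeAdj_le e f) (edge_openEmb e f)
      (edge_restr e f h₁.semi.toMatching) (fun a b h => by
        cases h with
        | inl h => exact h.elim
        | @inr c d h => exact ⟨c, rfl⟩) (edge_model e f h₁.semi h₂.semi hc₁)
    obtain ⟨q, hq, hq'⟩ := exists_map (insertEdge_closed e f h₁ hc₁ h₂ hc₂).1 hL g p
    exact ⟨q, Prod.ext (funext fun x => (hq x).trans (by rw [hp]))
      (funext fun c => (hq' c).trans (by rw [hp']))⟩
  · rintro ⟨p, rfl⟩
    obtain ⟨e, f, g, hg, hg'⟩ := p.exists_edge hL hLc h₁ hc₁ h₂ hc₂ h2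
    exact ⟨⟨e, f, g⟩, Prod.ext (funext hg) (funext hg')⟩

end Fill

end PreGraph

/-! ### Coefficients of the insertion product. -/

open PreGraph

/-- A connected graph, as a possibly disconnected one. -/
def ConnLFG.toLFG (Γ : ConnLFG) : LFG := ⟨Γ.1, Γ.2.1⟩

theorem ConnLFG.cls_eq {Γ Γ' : ConnLFG} : Γ.cls = Γ'.cls ↔ Nonempty (Iso Γ.1 Γ'.1) := Quotient.eq

theorem ConnLFG.cls_surjective : Function.Surjective ConnLFG.cls := Quotient.mk_surjective

theorem ConnLFG.card_ex (Γ : ConnLFG) : Nat.card Γ.1.Ex = 2 ∨ Nat.card Γ.1.Ex = 3 := by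
  obtain ⟨v⟩ := Γ.2.2.1
  rw [← Γ.2.2.legs_eq v]
  exact Γ.2.1.semi.legs_eq v

theorem ConnLFG.basis_apply (Γ L : ConnLFG) :
    Γ.basis L.cls * autCard L.1 = Nat.card (Iso Γ.1 L.1) := by
  classical
  rw [ConnLFG.basis, Finsupp.single_apply]
  split_ifs with h
  · obtain ⟨e⟩ := ConnLFG.cls_eq.1 h
    rw [one_mul, autCard, Iso.card_congr ⟨e.symm⟩ ⟨.refl L.1⟩]
  · have : IsEmpty (Iso Γ.1 L.1) := ⟨fun e => h (ConnLFG.cls_eq.2 ⟨e⟩)⟩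
    simp

/-- The coefficient of `L` times |Aut L| counts insertions with an isomorphism to `L`, that is
fillings. So the insertion product agrees with convolution on connected graphs once each Γ is
matched with |Aut Γ| δ_Γ. Only one of the two sums is nonempty, according to the number of legs of
`Γ₁`. -/
theorem insertionProduct_apply (Γ₁ Γ₂ L : ConnLFG) :
    insertionProduct insertionClosed Γ₁ Γ₂ L.cls * autCard L.1 = autCard Γ₁.1 * autCard Γ₂.1 *
      LFGClass.splitSum (fun A B => Γ₁.toLFG.delta A * Γ₂.toLFG.delta B) L.toLFG.cls := by
  have h := LFGClass.card_fill Γ₁.toLFG Γ₂.toLFG L.toLFG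
  refine Eq.trans ?_ h
  have := Fintype.ofFinite Γ₂.1.V
  have := Fintype.ofFinite Γ₂.1.IntEdge
  have fv := fun v => Fintype.ofFinite (Γ₁.1.Ex ≃ {h : Γ₂.1.H // Γ₂.1.vert h = v})
  have fe := fun e : Γ₂.1.IntEdge => Fintype.ofFinite (Γ₁.1.Ex ≃ {h : Γ₂.1.H // h ∈ e.1})
  rw [insertionProduct]
  simp only [finsum_eq_sum_of_fintype, Finsupp.add_apply, Finsupp.coe_finsetSum, Finset.sum_apply,
    add_mul, Finset.sum_mul, ConnLFG.basis_apply]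
  have hV : (∑ v : Γ₂.1.V, ∑ f : Γ₁.1.Ex ≃ {h : Γ₂.1.H // Γ₂.1.vert h = v},
      (Nat.card (Iso (Γ₂.1.insertVertex Γ₁.1 v f) L.1) : ℚ)) =
      Nat.card (Σ v, Σ f : Γ₁.1.Ex ≃ {h : Γ₂.1.H // Γ₂.1.vert h = v},
        Iso (Γ₂.1.insertVertex Γ₁.1 v f) L.1) := by
    simp [Nat.card_sigma]
  have hE : (∑ e : Γ₂.1.IntEdge, ∑ f : Γ₁.1.Ex ≃ {h : Γ₂.1.H // h ∈ e.1},
      (Nat.card (Iso (Γ₂.1.insertEdge Γ₁.1 e f) L.1) : ℚ)) =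
      Nat.card (Σ e, Σ f : Γ₁.1.Ex ≃ {h : Γ₂.1.H // h ∈ (e : Γ₂.1.IntEdge).1},
        Iso (Γ₂.1.insertEdge Γ₁.1 e f) L.1) := by
    simp [Nat.card_sigma]
  rw [hV, hE]
  rcases Γ₁.card_ex with h2 | h3
  · have : IsEmpty (Σ v, Σ f : Γ₁.1.Ex ≃ {h : Γ₂.1.H // Γ₂.1.vert h = v},
        Iso (Γ₂.1.insertVertex Γ₁.1 v f) L.1) := ⟨fun t => by
      have := Nat.card_congr t.2.1
      rw [Γ₂.2.1.trivalent, h2] at this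
      omega⟩
    rw [Nat.card_of_isEmpty, Nat.cast_zero, zero_add]
    exact congrArg _ (Fill.card_edge L.2.1 L.2.2 Γ₁.2.1 Γ₁.2.2 Γ₂.2.1 Γ₂.2.2 h2)
  · have : IsEmpty (Σ e, Σ f : Γ₁.1.Ex ≃ {h : Γ₂.1.H // h ∈ (e : Γ₂.1.IntEdge).1},
        Iso (Γ₂.1.insertEdge Γ₁.1 e f) L.1) := ⟨fun t => by
      have := Nat.card_congr t.2.1
      rw [t.1.card Γ₂.2.1.semi.toMatching, h3] at this
      omega⟩
    rw [add_comm, Nat.card_of_isEmpty, Nat.cast_zero, zero_add]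
    exact congrArg _ (Fill.card_vertex L.2.1 L.2.2 Γ₁.2.1 Γ₁.2.2 Γ₂.2.1 Γ₂.2.2 h3)

/-! ### Decomposition into connected graphs. -/

namespace PreGraph

open HalfEdge

variable {Γ : PreGraph}

/-- The part of a graph over a set of vertices. -/
def part (Γ : PreGraph) (S : Set Γ.V) : Γ.PreSubgraph where
  verts := S
  adj a b := Γ.Adj a b ∧ Γ.vert a ∈ S ∧ Γ.vert b ∈ S
  adj_le _ _ h := h

theorem part_isFeynman (h : Γ.IsFeynman) {S : Set Γ.V}
    (hS : ∀ a b, Γ.Adj a b → Γ.vert a ∈ S → Γ.vert b ∈ S) : (Γ.part S).toGraph.IsFeynman := by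
  have r : Restr (Subtype.val : (Γ.part S).toGraph.H → Γ.H) (Γ.part S).toGraph.Adj Γ.Adj :=
    ⟨fun _ _ => h.semi.symm, fun a b => ⟨fun h => h.1, fun h => ⟨h, a.2, b.2⟩⟩,
      fun a y hay => ⟨⟨y, hS _ _ hay a.2⟩, rfl⟩⟩
  refine isFeynman_iff.2 ⟨(Γ.part S).openEmb.semi_restr r h.semi, fun v => ?_⟩
  obtain ⟨a, ha, ha'⟩ := h.touched v.1
  exact ⟨⟨a, by rw [ha]; exact v.2⟩, Subtype.ext ha, fun hf => ha' ((OpenEmb.free_iff r).1 hf)⟩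

theorem part_sum (h : Γ.IsFeynman) {S : Set Γ.V}
    (hS : ∀ a b, Γ.Adj a b → Γ.vert a ∈ S → Γ.vert b ∈ S) :
    Nonempty (Iso ((Γ.part S).toGraph.sum (Γ.part Sᶜ).toGraph) Γ) := by
  classical
  refine ⟨⟨Equiv.sumCompl (fun v => v ∈ S), Equiv.sumCompl (fun h => Γ.vert h ∈ S), ?_, ?_⟩⟩
  · rintro (a | a) <;> rfl
  · rintro (a | a) (b | b)
    · exact Iff.trans ⟨fun h => ⟨h, a.2, b.2⟩, fun h => h.1⟩ Sum.liftRel_inl_inl.symm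
    · exact iff_of_false (fun hab => b.2 (hS _ _ hab a.2)) fun h => by cases h
    · exact iff_of_false (fun hab => a.2 (hS _ _ (h.symm _ _ hab) b.2)) fun h => by cases h
    · exact Iff.trans ⟨fun h => ⟨h, a.2, b.2⟩, fun h => h.1⟩ Sum.liftRel_inr_inr.symm

theorem not_isConnected_sum {Γ' : PreGraph} (h : Γ.IsFeynman) (h' : Γ'.IsFeynman)
    (hn : Nonempty Γ.V) (hn' : Nonempty Γ'.V) : ¬ (Γ.sum Γ').IsConnected := by
  intro hc
  obtain ⟨v⟩ := hn
  obtain ⟨w⟩ := hn'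
  obtain ⟨y, hy⟩ := (Γ.sum_openEmb_inl Γ').joined_range
    (liftRel_restr_inl (fun _ _ => h.semi.symm) fun _ _ => h'.semi.symm) (hc.2 (.inl v) (.inr w))
  cases hy

theorem Subgraph.quotient_isConnected (h : Γ.IsFeynman) (hc : Γ.IsConnected) (γ : Γ.Subgraph)
    (hn : Nonempty (Γ.quotient γ).V) : (Γ.quotient γ).IsConnected := by
  refine ⟨hn, fun v w => ?_⟩
  obtain ⟨a, rfl⟩ := γ.quotient_surj h v
  obtain ⟨b, rfl⟩ := γ.quotient_surj h w
  exact ((γ.model h).joined_iff h.semi.toMatching (γ.semi h) γ.adj_le a b).2 (hc.2 _ _)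

end PreGraph

/-- The class of a connected graph. -/
def ConnClass.conn : ConnClass → LFGClass :=
  Quotient.map ConnLFG.toLFG fun _ _ h => h

namespace LFGClass

open ConnClass

theorem conn_cls (Γ : ConnLFG) : conn Γ.cls = Γ.toLFG.cls := rfl

theorem conn_injective : Function.Injective conn := by
  intro c d h
  obtain ⟨c, rfl⟩ := ConnLFG.cls_surjective c
  obtain ⟨d, rfl⟩ := ConnLFG.cls_surjective d
  exact ConnLFG.cls_eq.2 (LFG.cls_eq.1 h)

theorem conn_ne_zero (c : ConnClass) : conn c ≠ 0 := by
  obtain ⟨c, rfl⟩ := ConnLFG.cls_surjective c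
  rw [conn_cls, Ne, cls_eq_zero, not_isEmpty_iff]
  exact c.2.2.1

theorem conn_ne_add (c : ConnClass) {M N : LFGClass} (hM : M ≠ 0) (hN : N ≠ 0) :
    conn c ≠ M + N := by
  obtain ⟨c, rfl⟩ := ConnLFG.cls_surjective c
  obtain ⟨M, rfl⟩ := LFG.cls_surjective M
  obtain ⟨N, rfl⟩ := LFG.cls_surjective N
  rw [Ne, cls_eq_zero, not_isEmpty_iff] at hM hN
  intro h
  obtain ⟨e⟩ := LFG.cls_eq.1 (h.trans (cls_sum M N).symm)
  exact not_isConnected_sum M.2 N.2 hM hN (e.symm.isConnected c.2.1.semi.toMatching c.2.2)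

/-- A disconnected graph is the disjoint union of one component and the rest, both of which are
Feynman graphs since no edge runs between them. -/
theorem zero_or_conn_or_add (L : LFGClass) :
    L = 0 ∨ (∃ c, conn c = L) ∨ ∃ M N, M ≠ 0 ∧ N ≠ 0 ∧ L = M + N := by
  obtain ⟨Γ, rfl⟩ := LFG.cls_surjective L
  by_cases h0 : IsEmpty Γ.1.V
  · exact .inl (cls_eq_zero.2 h0)
  rw [not_isEmpty_iff] at h0
  by_cases hc : Γ.1.IsConnected
  · exact .inr (.inl ⟨ConnLFG.cls ⟨Γ.1, Γ.2, hc⟩, rfl⟩)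
  obtain ⟨v, w, hvw⟩ : ∃ v w, ¬ Γ.1.Joined Γ.1.Adj v w := by
    by_contra! hn
    exact hc ⟨h0, hn⟩
  let S : Set Γ.1.V := {x | HalfEdge.Joined Γ.1.vert Γ.1.Adj v x}
  have hS : ∀ a b, Γ.1.Adj a b → Γ.1.vert a ∈ S → Γ.1.vert b ∈ S := fun a b hab h =>
    HalfEdge.Joined.trans h (.of_rel hab)
  have hS' : ∀ a b, Γ.1.Adj a b → Γ.1.vert a ∈ Sᶜ → Γ.1.vert b ∈ Sᶜ := fun a b hab h hb =>
    h (hS b a (Γ.2.symm _ _ hab) hb)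
  refine .inr (.inr ⟨LFG.cls ⟨_, part_isFeynman Γ.2 hS⟩, LFG.cls ⟨_, part_isFeynman Γ.2 hS'⟩,
    ?_, ?_, ?_⟩)
  · rw [Ne, cls_eq_zero, not_isEmpty_iff]
    exact ⟨⟨v, HalfEdge.Joined.refl v⟩⟩
  · rw [Ne, cls_eq_zero, not_isEmpty_iff]
    exact ⟨⟨w, hvw⟩⟩
  · rw [← cls_sum]
    exact LFG.cls_eq.2 ((part_sum Γ.2 hS).map Iso.symm)

/-- The disjoint union of a multiset of connected graphs. -/
noncomputable def total (t : Multiset ConnClass) : LFGClass := (t.map conn).sum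

theorem total_cons (c : ConnClass) (t : Multiset ConnClass) : total (c ::ₘ t) = conn c + total t := by
  rw [total, Multiset.map_cons, Multiset.sum_cons, total]

/-- By induction on the number of vertices. Uniqueness of the decomposition is not needed. -/
theorem total_surjective : Function.Surjective total := by
  have key : ∀ n : ℕ, ∀ L, vcard L = n → ∃ t, total t = L := by
    intro n
    induction n using Nat.strong_induction_on with
    | _ n ih =>
      rintro L rfl
      rcases zero_or_conn_or_add L with rfl | ⟨c, rfl⟩ | ⟨M, N, hM, hN, rfl⟩
      · exact ⟨0, rfl⟩
      · exact ⟨{c}, by simp [total]⟩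
      · have h₁ : vcard M ≠ 0 := fun h => hM (vcard_eq_zero.1 h)
        have h₂ : vcard N ≠ 0 := fun h => hN (vcard_eq_zero.1 h)
        obtain ⟨s, rfl⟩ := ih (vcard M) (by rw [vcard_add]; omega) M rfl
        obtain ⟨t, rfl⟩ := ih (vcard N) (by rw [vcard_add]; omega) N rfl
        exact ⟨s + t, by simp [total]⟩
  exact fun L => key _ L rfl

theorem total_eq_zero {t : Multiset ConnClass} (h : total t = 0) : t = 0 := by
  induction t using Multiset.induction_on with
  | empty => rfl
  | cons c t =>
    rw [total_cons] at h
    have h' := vcard_eq_zero.2 h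
    rw [vcard_add] at h'
    exact absurd (vcard_eq_zero.1 (Nat.eq_zero_of_add_eq_zero_right h')) (conn_ne_zero c)

/-- A quotient of a connected graph is empty or connected, so only the full subgraph contributes. -/
theorem splitSum_conn (F : LFGClass → LFGClass → ℚ) (hF : ∀ M c, F M (conn c) = 0) (d : ConnClass) :
    splitSum F (conn d) = F (conn d) 0 := by
  classical
  have h := splitSum_right (fun M N => if N = 0 then F M 0 else 0)
    (fun M N hN => if_neg hN) (conn d)
  rw [if_pos rfl] at h
  rw [← h]
  obtain ⟨d, rfl⟩ := ConnLFG.cls_surjective d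
  rw [conn_cls, splitSum_cls, splitSum_cls]
  refine Finset.sum_congr rfl fun γ _ => ?_
  split_ifs with h0
  · rw [h0]
  · rw [quo, cls_eq_zero, not_isEmpty_iff] at h0
    exact hF _ (ConnLFG.cls ⟨_, γ.quotient_isFeynman d.2.1, γ.quotient_isConnected d.2.1 d.2.2 h0⟩)

end LFGClass

/-! ### The convolution algebra and its primitive elements. -/

open PreGraph LFGClass ConnClass

namespace LFGClass

theorem splitSum_mul_const (F : LFGClass → LFGClass → ℚ) (c : ℚ) (L : LFGClass) :
    splitSum F L * c = splitSum (fun M N => F M N * c) L := by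
  obtain ⟨Γ, rfl⟩ := LFG.cls_surjective L
  exact Finset.sum_mul _ _ _

theorem const_mul_splitSum (F : LFGClass → LFGClass → ℚ) (c : ℚ) (L : LFGClass) :
    c * splitSum F L = splitSum (fun M N => c * F M N) L := by
  obtain ⟨Γ, rfl⟩ := LFG.cls_surjective L
  exact Finset.mul_sum _ _ _

theorem splitSum_add_fun (F G : LFGClass → LFGClass → ℚ) (L : LFGClass) :
    splitSum (fun M N => F M N + G M N) L = splitSum F L + splitSum G L := by
  obtain ⟨Γ, rfl⟩ := LFG.cls_surjective L
  exact Finset.sum_add_distrib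

theorem splitSum_zero_fun (L : LFGClass) : splitSum (fun _ _ => 0) L = 0 := by
  obtain ⟨Γ, rfl⟩ := LFG.cls_surjective L
  exact Finset.sum_const_zero

theorem exists_of_splitSum_ne_zero {F : LFGClass → LFGClass → ℚ} {L : LFGClass}
    (h : splitSum F L ≠ 0) : ∃ M N, F M N ≠ 0 ∧ vcard L ≤ vcard M + vcard N := by
  obtain ⟨Γ, rfl⟩ := LFG.cls_surjective L
  obtain ⟨γ, -, hγ⟩ := Finset.exists_ne_zero_of_sum_ne_zero h
  exact ⟨_, _, hγ, vcard_le Γ γ⟩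

/-- The convolution product. -/
noncomputable def conv (f g : HallSpace) : HallSpace :=
  Finsupp.ofSupportFinite (splitSum fun M N => f M * g N) (by
    -- A graph in the support splits into graphs in the supports of `f` and `g`, so its number of
    -- vertices is bounded.
    refine (finite_vcard_le (f.support.sup vcard + g.support.sup vcard)).subset fun L hL => ?_
    obtain ⟨M, N, h, hle⟩ := exists_of_splitSum_ne_zero hL
    exact hle.trans (Nat.add_le_add
      (Finset.le_sup (Finsupp.mem_support_iff.2 (left_ne_zero_of_mul h)))
      (Finset.le_sup (Finsupp.mem_support_iff.2 (right_ne_zero_of_mul h)))))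

end LFGClass

/-- The Ringel-Hall algebra. -/
def HallAlg : Type 1 := HallSpace

namespace HallAlg

noncomputable instance instAddCommGroup : AddCommGroup HallAlg := inferInstanceAs (AddCommGroup HallSpace)

noncomputable instance : Module ℚ HallAlg := inferInstanceAs (Module ℚ HallSpace)

/-- The identification with the underlying vector space. -/
noncomputable def equiv : HallAlg ≃ₗ[ℚ] HallSpace := LinearEquiv.refl ℚ HallSpace

/-- The value at an isomorphism class. -/
noncomputable def eval (L : LFGClass) : HallAlg →ₗ[ℚ] ℚ := Finsupp.lapply L ∘ₗ equiv.toLinearMap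

theorem ext {f g : HallAlg} (h : ∀ L, eval L f = eval L g) : f = g := Finsupp.ext h

noncomputable instance : Mul HallAlg := ⟨fun f g => conv f g⟩

noncomputable instance : One HallAlg := ⟨Finsupp.single 0 1⟩

theorem eval_mul (f g : HallAlg) (L : LFGClass) :
    eval L (f * g) = splitSum (fun M N => eval M f * eval N g) L := rfl

open Classical in
theorem eval_one (L : LFGClass) : eval L 1 = if L = 0 then 1 else 0 := by
  refine (Finsupp.single_apply (a := (0 : LFGClass)) (b := (1 : ℚ)) (a' := L)).trans ?_
  simp only [eq_comm]

theorem eval_zero_one : eval 0 1 = 1 := by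
  classical
  rw [eval_one, if_pos rfl]

theorem eval_one_of_ne {L : LFGClass} (h : L ≠ 0) : eval L 1 = 0 := by
  classical
  rw [eval_one, if_neg h]

noncomputable instance : Ring HallAlg where
  __ := instAddCommGroup
  zero_mul f := ext fun L => by
    rw [eval_mul, map_zero]
    simp [splitSum_zero_fun]
  mul_zero f := ext fun L => by
    rw [eval_mul, map_zero]
    simp [splitSum_zero_fun]
  left_distrib f g h := ext fun L => by
    simp only [map_add, eval_mul, mul_add, splitSum_add_fun]
  right_distrib f g h := ext fun L => by
    simp only [map_add, eval_mul, add_mul, splitSum_add_fun]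
  mul_assoc f g h := ext fun L => by
    simp only [eval_mul, splitSum_mul_const, const_mul_splitSum, ← mul_assoc]
    exact splitSum_assoc (fun A B C => eval A f * eval B g * eval C h) L
  one_mul f := ext fun L => by
    rw [eval_mul, splitSum_left _ fun M N h => by rw [eval_one_of_ne h, zero_mul], eval_zero_one,
      one_mul]
  mul_one f := ext fun L => by
    rw [eval_mul, splitSum_right _ fun M N h => by rw [eval_one_of_ne h, mul_zero], eval_zero_one,
      mul_one]

noncomputable instance : Algebra ℚ HallAlg :=
  Algebra.ofModule
    (fun c f g => ext fun L => by
      simp only [map_smul, eval_mul, smul_eq_mul, const_mul_splitSum, mul_assoc])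
    (fun c f g => ext fun L => by
      simp only [map_smul, eval_mul, smul_eq_mul, const_mul_splitSum, mul_left_comm])

/-- The value of a tensor at a pair of isomorphism classes. -/
noncomputable def eval₂ (M N : LFGClass) : HallAlg ⊗[ℚ] HallAlg →ₗ[ℚ] ℚ :=
  LinearMap.mul' ℚ ℚ ∘ₗ TensorProduct.map (eval M) (eval N)

theorem eval₂_tmul (M N : LFGClass) (f g : HallAlg) : eval₂ M N (f ⊗ₜ g) = eval M f * eval N g := rfl

theorem eval₂_mul (M N : LFGClass) (S T : HallAlg ⊗[ℚ] HallAlg) :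
    eval₂ M N (S * T) =
      splitSum (fun A B => splitSum (fun C D => eval₂ A C S * eval₂ B D T) N) M := by
  induction S using TensorProduct.induction_on with
  | zero => simp [splitSum_zero_fun]
  | add S S' hS hS' => simp only [add_mul, map_add, hS, hS', splitSum_add_fun]
  | tmul f g =>
    induction T using TensorProduct.induction_on with
    | zero => simp [splitSum_zero_fun]
    | add T T' hT hT' => simp only [mul_add, map_add, hT, hT', splitSum_add_fun]
    | tmul f' g' =>
      rw [Algebra.TensorProduct.tmul_mul_tmul, eval₂_tmul, eval_mul, eval_mul, splitSum_mul_const]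
      congr 1
      funext A B
      rw [const_mul_splitSum]
      congr 1
      funext C D
      rw [eval₂_tmul, eval₂_tmul]
      ring

/-- The function of two variables given by `T` is `(M, N) ↦ f (M ⊕ N)`. -/
def IsComul (f : HallAlg) (T : HallAlg ⊗[ℚ] HallAlg) : Prop :=
  ∀ M N, eval₂ M N T = eval (M + N) f

/-- This is the bialgebra axiom, by `splitSum_add`. The coproduct is only characterised by its
values here; a tensor realising it for every function comes later from the enveloping algebra. -/
theorem IsComul.mul {f g : HallAlg} {S T : HallAlg ⊗[ℚ] HallAlg} (hf : IsComul f S)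
    (hg : IsComul g T) : IsComul (f * g) (S * T) := by
  intro M N
  rw [eval₂_mul, eval_mul, splitSum_add]
  simp only [hf _ _, hg _ _]

theorem IsComul.add {f g : HallAlg} {S T : HallAlg ⊗[ℚ] HallAlg} (hf : IsComul f S)
    (hg : IsComul g T) : IsComul (f + g) (S + T) := fun M N => by
  rw [map_add, map_add, hf, hg]

theorem IsComul.smul {f : HallAlg} {S : HallAlg ⊗[ℚ] HallAlg} (c : ℚ) (hf : IsComul f S) :
    IsComul (c • f) (c • S) := fun M N => by
  rw [map_smul, map_smul, hf]

theorem isComul_one : IsComul 1 1 := by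
  intro M N
  rw [Algebra.TensorProduct.one_def, eval₂_tmul]
  by_cases hM : M = 0
  · rw [hM, eval_zero_one, one_mul, zero_add]
  · rw [eval_one_of_ne hM, zero_mul, eval_one_of_ne]
    intro h
    have h' := vcard_eq_zero.2 h
    rw [vcard_add] at h'
    exact hM (vcard_eq_zero.1 (Nat.eq_zero_of_add_eq_zero_right h'))

/-- Primitive elements. -/
def IsPrimitive (f : HallAlg) : Prop := IsComul f (f ⊗ₜ 1 + 1 ⊗ₜ f)

/-- Primitive functions are those vanishing on the empty graph and on proper disjoint unions, hence
supported on connected graphs. -/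
theorem isPrimitive_iff (f : HallAlg) :
    IsPrimitive f ↔ eval 0 f = 0 ∧ ∀ M N, M ≠ 0 → N ≠ 0 → eval (M + N) f = 0 := by
  have h : ∀ M N, eval₂ M N (f ⊗ₜ[ℚ] (1 : HallAlg) + (1 : HallAlg) ⊗ₜ[ℚ] f) =
      eval M f * eval N 1 + eval M 1 * eval N f := fun M N => by
    rw [map_add, eval₂_tmul, eval₂_tmul]
  constructor
  · intro hf
    constructor
    · have := (h 0 0).symm.trans (hf 0 0)
      rw [eval_zero_one, zero_add] at this
      linarith
    · intro M N hM hN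
      rw [← hf M N, h, eval_one_of_ne hM, eval_one_of_ne hN]
      ring
  · rintro ⟨h0, h1⟩ M N
    rw [h]
    by_cases hM : M = 0
    · subst hM
      rw [h0, eval_zero_one, zero_add]
      ring
    · by_cases hN : N = 0
      · subst hN
        rw [h0, eval_zero_one, add_zero]
        ring
      · rw [eval_one_of_ne hM, eval_one_of_ne hN, h1 M N hM hN]
        ring

attribute [local instance 10000] LieRing.ofAssociativeRing

/-- The Lie algebra of primitive elements. -/
noncomputable def primitives : LieSubalgebra ℚ HallAlg where
  carrier := {f | IsPrimitive f}
  add_mem' {f g} hf hg := by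
    have := IsComul.add hf hg
    show IsComul _ _
    rw [TensorProduct.add_tmul, TensorProduct.tmul_add]
    rwa [add_add_add_comm] at this
  zero_mem' := by
    refine (isPrimitive_iff 0).2 ?_
    exact ⟨map_zero _, fun _ _ _ _ => map_zero _⟩
  smul_mem' c f hf := by
    have := IsComul.smul c hf
    rwa [smul_add, TensorProduct.smul_tmul', ← TensorProduct.tmul_smul] at this
  lie_mem' {f g} hf hg := by
    -- The mixed terms `f ⊗ g` and `g ⊗ f` cancel in the commutator.
    have h := (IsComul.mul hf hg).add ((IsComul.mul hg hf).smul (-1))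
    show IsComul _ _
    rw [LieRing.of_associative_ring_bracket]
    convert h using 1
    · rw [neg_one_smul, sub_eq_add_neg]
    · simp only [neg_one_smul, add_mul, mul_add, Algebra.TensorProduct.tmul_mul_tmul, one_mul,
        mul_one, TensorProduct.sub_tmul, TensorProduct.tmul_sub]
      abel

theorem mem_primitives (f : HallAlg) : f ∈ primitives ↔ IsPrimitive f := Iff.rfl

/-- The characteristic function of a class. -/
noncomputable def single (L : LFGClass) : HallAlg := equiv.symm (Finsupp.single L 1)

open Classical in
theorem eval_single (L M : LFGClass) : eval M (single L) = if L = M then 1 else 0 :=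
  Finsupp.single_apply

theorem single_conn_mem (c : ConnClass) : single (conn c) ∈ primitives := by
  classical
  rw [mem_primitives, isPrimitive_iff]
  refine ⟨?_, fun M N hM hN => ?_⟩
  · rw [eval_single, if_neg (conn_ne_zero c)]
  · rw [eval_single, if_neg (conn_ne_add c hM hN)]

theorem sum_single (f : HallAlg) : f = (equiv f).sum fun L a => a • single L := by
  refine (Finsupp.sum_single (equiv f)).symm.trans ?_
  refine Finsupp.sum_congr fun L _ => ?_
  exact (Finsupp.smul_single_one L _).symm

theorem span_single_conn :
    Submodule.span ℚ (Set.range fun c => single (conn c)) = primitives.toSubmodule := by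
  apply le_antisymm
  · rw [Submodule.span_le]
    rintro _ ⟨c, rfl⟩
    exact single_conn_mem c
  · intro f hf
    obtain ⟨h0, h1⟩ := (isPrimitive_iff f).1 hf
    rw [sum_single f]
    refine Submodule.sum_mem _ fun L hL => Submodule.smul_mem _ _ ?_
    have hL : eval L f ≠ 0 := Finsupp.mem_support_iff.1 hL
    rcases zero_or_conn_or_add L with rfl | ⟨c, rfl⟩ | ⟨M, N, hM, hN, rfl⟩
    · exact absurd h0 hL
    · exact Submodule.subset_span ⟨c, rfl⟩
    · exact absurd (h1 M N hM hN) hL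

end HallAlg

/-! ### Spanning by ordered products. -/

section OrderedProducts

variable {R A ι : Type*} [CommRing R] [Ring A] [Algebra R A] (x : ι → A)

/-- The span of the products of at most `m` factors. -/
def shortProducts (R : Type*) {A ι : Type*} [CommRing R] [Ring A] [Algebra R A] (x : ι → A)
    (m : ℕ) : Submodule R A :=
  Submodule.span R {a | ∃ l : List ι, l.length ≤ m ∧ (l.map x).prod = a}

theorem prod_mem_shortProducts (l : List ι) {m : ℕ} (h : l.length ≤ m) :
    (l.map x).prod ∈ shortProducts R x m := Submodule.subset_span ⟨l, h, rfl⟩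

theorem mul_mem_shortProducts (c : ι) {a : A} {m : ℕ} (h : a ∈ shortProducts R x m) :
    x c * a ∈ shortProducts R x (m + 1) := by
  refine Submodule.span_induction ?_ ?_ ?_ ?_ h
  · rintro _ ⟨l, hl, rfl⟩
    exact prod_mem_shortProducts x (c :: l) (Nat.succ_le_succ hl)
  · rw [mul_zero]
    exact zero_mem _
  · intro a b _ _ ha hb
    rw [mul_add]
    exact add_mem ha hb
  · intro r a _ ha
    rw [mul_smul_comm]
    exact Submodule.smul_mem _ _ ha

theorem span_mul_mem_shortProducts {b : A} (hb : b ∈ Submodule.span R (Set.range x)) {a : A} {m : ℕ}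
    (h : a ∈ shortProducts R x m) : b * a ∈ shortProducts R x (m + 1) := by
  refine Submodule.span_induction ?_ ?_ ?_ ?_ hb
  · rintro _ ⟨c, rfl⟩
    exact mul_mem_shortProducts x c h
  · rw [zero_mul]
    exact zero_mem _
  · intro a b _ _ ha hb
    rw [add_mul]
    exact add_mem ha hb
  · intro r a _ ha
    rw [smul_mul_assoc]
    exact Submodule.smul_mem _ _ ha

/-- Exchanging two neighbours replaces two factors by their commutator, a combination of generators,
so the difference has one factor less. This is the easy half of the Poincaré–Birkhoff–Witt theorem.
-/
theorem perm_sub_mem_shortProducts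
    (hc : ∀ a b, x a * x b - x b * x a ∈ Submodule.span R (Set.range x)) {l l' : List ι}
    (h : l.Perm l') :
    ∀ m, l.length = m + 1 → (l.map x).prod - (l'.map x).prod ∈ shortProducts R x m := by
  induction h with
  | nil => intro m hm; cases hm
  | @cons c l l' h ih =>
    intro m hm
    rw [List.map_cons, List.map_cons, List.prod_cons, List.prod_cons, ← mul_sub]
    rcases m with _ | m
    · have hl : l = [] := List.length_eq_zero_iff.1 (Nat.succ.inj hm)
      subst hl
      rw [h.nil_eq, sub_self, mul_zero]
      exact zero_mem _
    · exact mul_mem_shortProducts x c (ih m (Nat.succ.inj hm))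
  | swap c d l =>
    intro m hm
    simp only [List.map_cons, List.prod_cons, ← mul_assoc]
    rw [← sub_mul]
    have hm : m = l.length + 1 := (Nat.succ.inj hm).symm
    rw [hm]
    exact span_mul_mem_shortProducts x (hc d c) (prod_mem_shortProducts x l le_rfl)
  | trans h₁ h₂ ih₁ ih₂ =>
    intro m hm
    have := add_mem (ih₁ m hm) (ih₂ m (h₁.length_eq ▸ hm))
    rwa [sub_add_sub_cancel] at this

/-- The products over multisets, in a chosen order, span the algebra. -/
theorem span_multiset_prod
    (hc : ∀ a b, x a * x b - x b * x a ∈ Submodule.span R (Set.range x))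
    (hg : Algebra.adjoin R (Set.range x) = ⊤) :
    Submodule.span R (Set.range fun s : Multiset ι => (s.toList.map x).prod) = ⊤ := by
  set W := Submodule.span R (Set.range fun s : Multiset ι => (s.toList.map x).prod)
  have key : ∀ m, shortProducts R x m ≤ W := by
    intro m
    induction m with
    | zero =>
      refine Submodule.span_le.2 ?_
      rintro _ ⟨l, hl, rfl⟩
      obtain rfl := List.length_eq_zero_iff.1 (Nat.le_zero.1 hl)
      exact Submodule.subset_span ⟨0, by simp⟩
    | succ m ih =>
      refine Submodule.span_le.2 ?_
      rintro _ ⟨l, hl, rfl⟩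
      rcases Nat.lt_or_ge m l.length with h | h
      · have hp := perm_sub_mem_shortProducts x hc
          (Multiset.coe_eq_coe.1 (Multiset.coe_toList (l : Multiset ι))).symm m (by omega)
        have := add_mem (ih hp) (Submodule.subset_span (s := Set.range fun s : Multiset ι =>
          (s.toList.map x).prod) ⟨(l : Multiset ι), rfl⟩)
        rwa [sub_add_cancel] at this
      · exact ih (prod_mem_shortProducts x l h)
  rw [eq_top_iff, ← Algebra.top_toSubmodule, ← hg, Algebra.adjoin_eq_span, Submodule.span_le]
  intro a ha
  obtain ⟨l, hl, rfl⟩ := Submonoid.exists_list_of_mem_closure ha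
  obtain ⟨k, rfl⟩ : l ∈ Set.range (List.map x) := by
    rw [Set.range_list_map]
    exact hl
  exact key k.length (prod_mem_shortProducts x k le_rfl)

end OrderedProducts

/-! ### Triangularity of products of connected graphs. -/

namespace HallAlg

open LFGClass ConnClass

/-- Since δ_c is primitive, multiplying by it obeys a Leibniz rule for disjoint unions: a connected
subgraph lies in one of the two parts. -/
theorem splitSum_single_add (c : ConnClass) (h : LFGClass → ℚ) (M N : LFGClass) :
    splitSum (fun A B => eval A (single (conn c)) * h B) (M + N) =
      splitSum (fun A B => eval A (single (conn c)) * h (B + N)) M +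
        splitSum (fun A B => eval A (single (conn c)) * h (M + B)) N := by
  have hp : ∀ A C, eval (A + C) (single (conn c)) =
      eval A (single (conn c)) * eval C 1 + eval A 1 * eval C (single (conn c)) := fun A C => by
    rw [← single_conn_mem c A C, map_add, eval₂_tmul, eval₂_tmul]
  rw [splitSum_add]
  simp only [hp, add_mul, splitSum_add_fun]
  congr 1
  · congr 1
    funext A B
    rw [splitSum_left _ fun C D hC => by rw [eval_one_of_ne hC]; ring, eval_zero_one, mul_one]
  · rw [splitSum_left]
    · simp only [eval_zero_one, one_mul]
    · intro A B hA
      simp only [eval_one_of_ne hA, zero_mul, splitSum_zero_fun]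

open Classical in
-- Contracting a copy of `c` inside a component either deletes that component, when it is isomorphic
-- to `c`, or leaves it nonempty and connected. In the second case the number of components is
-- unchanged and `h` vanishes, so only the deletions remain, one for each occurrence of `c`.
theorem splitSum_single_total (c : ConnClass) (t : Multiset ConnClass) (h : LFGClass → ℚ)
    (hh : ∀ u : Multiset ConnClass, Multiset.card u = Multiset.card t → h (total u) = 0) :
    splitSum (fun A B => eval A (single (conn c)) * h B) (total t) =
      t.count c * h (total (t.erase c)) := by
  induction t using Multiset.induction_on generalizing h with
  | empty =>
    rw [Multiset.count_zero, Nat.cast_zero, zero_mul]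
    refine (splitSum_cls _ ⟨PreGraph.empty, PreGraph.empty_isFeynman⟩).trans
      (Finset.sum_eq_zero fun γ _ => ?_)
    have hγ : sub ⟨PreGraph.empty, PreGraph.empty_isFeynman⟩ γ = 0 :=
      cls_eq_zero.2 ⟨fun v : γ.toGraph.V => (v.1 : Empty).elim⟩
    rw [hγ, eval_single, if_neg (conn_ne_zero c), zero_mul]
  | cons d t ih =>
    rw [total_cons, splitSum_single_add, ih (fun B => h (conn d + B)) ?_,
      splitSum_conn _ ?_ d, eval_single, zero_add]
    · by_cases hcd : c = d
      · subst hcd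
        rw [if_pos rfl, Multiset.count_cons_self, Multiset.erase_cons_head]
        by_cases hct : c ∈ t
        · rw [← total_cons, Multiset.cons_erase hct]
          push_cast
          ring
        · rw [Multiset.count_eq_zero_of_notMem hct]
          push_cast
          ring
      · rw [if_neg fun h => hcd (conn_injective h), Multiset.count_cons_of_ne hcd,
          Multiset.erase_cons_tail _ (Ne.symm hcd), total_cons]
        ring
    · intro M e
      rw [← total_cons, hh (e ::ₘ t) (by simp), mul_zero]
    · intro u hu
      rw [← total_cons]
      exact hh _ (by simp [hu])

/-- The product of characteristic functions of connected graphs. -/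
noncomputable def listProd (l : List ConnClass) : HallAlg := (l.map fun c => single (conn c)).prod

/-- Each factor removes at most one component. On a graph with at least as many components as
factors, a nonzero value therefore requires every factor to delete one, which forces `t` to be `l`;
the value there is a product of positive multiplicities. -/
theorem eval_listProd (l : List ConnClass) :
    (∀ t : Multiset ConnClass, l.length ≤ Multiset.card t → t ≠ l → eval (total t) (listProd l) = 0) ∧
      0 < eval (total l) (listProd l) := by
  classical
  induction l with
  | nil =>
    refine ⟨fun t _ ht => eval_one_of_ne fun h => ht (total_eq_zero h), ?_⟩
    exact eval_zero_one.symm ▸ one_pos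
  | cons c l ih =>
    have key : ∀ t : Multiset ConnClass, l.length + 1 ≤ Multiset.card t →
        eval (total t) (listProd (c :: l)) =
          t.count c * eval (total (t.erase c)) (listProd l) := by
      intro t ht
      refine splitSum_single_total c t (fun B => eval B (listProd l)) fun u hu => ?_
      refine ih.1 u (by omega) ?_
      rintro rfl
      rw [Multiset.coe_card] at hu
      omega
    constructor
    · intro t ht hne
      rw [List.length_cons] at ht
      rw [key t ht]
      by_cases hct : c ∈ t
      · rw [ih.1, mul_zero]
        · rw [Multiset.card_erase_of_mem hct]
          exact Nat.le_pred_of_lt ht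
        · intro h
          apply hne
          rw [← Multiset.cons_erase hct, h, Multiset.cons_coe]
      · rw [Multiset.count_eq_zero_of_notMem hct, Nat.cast_zero, zero_mul]
    · rw [key _ (by simp)]
      refine mul_pos (Nat.cast_pos.2 (Multiset.count_pos.2 (by simp))) ?_
      rw [← Multiset.cons_coe, Multiset.erase_cons_head]
      exact ih.2

/-- The products of characteristic functions of connected graphs, indexed by multisets. -/
noncomputable def multisetProd (s : Multiset ConnClass) : HallAlg := listProd s.toList

theorem eval_multisetProd_of_ne {s t : Multiset ConnClass} (h : Multiset.card s ≤ Multiset.card t)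
    (hne : t ≠ s) : eval (total t) (multisetProd s) = 0 :=
  (eval_listProd s.toList).1 t (by rwa [Multiset.length_toList]) (by rwa [Multiset.coe_toList])

theorem eval_multisetProd_self (s : Multiset ConnClass) :
    eval (total s) (multisetProd s) ≠ 0 := by
  have := (eval_listProd s.toList).2
  rw [Multiset.coe_toList] at this
  exact this.ne'

/-- In a linear relation, evaluate at a multiset `t` of maximal size in its support: only the term
of `t` survives. -/
theorem linearIndependent_multisetProd : LinearIndependent ℚ multisetProd := by
  rw [linearIndependent_iff]
  intro a ha
  by_contra hne
  obtain ⟨t, ht, hmax⟩ := a.support.exists_max_image Multiset.card (Finsupp.support_nonempty_iff.2 hne)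
  have := congrArg (eval (total t)) ha
  rw [Finsupp.linearCombination_apply, Finsupp.sum, map_sum, map_zero, Finset.sum_eq_single t] at this
  · rw [map_smul, smul_eq_mul] at this
    exact (Finsupp.mem_support_iff.1 ht)
      ((mul_eq_zero.1 this).resolve_right (eval_multisetProd_self t))
  · intro s hs hst
    rw [map_smul, eval_multisetProd_of_ne (hmax s hs) (Ne.symm hst), smul_zero]
  · exact fun h => absurd ht h

theorem span_multisetProd : Submodule.span ℚ (Set.range multisetProd) = ⊤ := by
  set W := Submodule.span ℚ (Set.range multisetProd)
  have key : ∀ n : ℕ, ∀ t : Multiset ConnClass, Multiset.card t = n → single (total t) ∈ W := by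
    intro n
    induction n using Nat.strong_induction_on with
    | _ n ih =>
      rintro t rfl
      have ht : multisetProd t ∈ W := Submodule.subset_span ⟨t, rfl⟩
      -- By triangularity the difference is supported on unions of fewer components, which the
      -- induction covers.
      have hsum : multisetProd t - eval (total t) (multisetProd t) • single (total t) ∈ W := by
        rw [sum_single (multisetProd t - eval (total t) (multisetProd t) • single (total t))]
        refine Submodule.sum_mem _ fun L hL => Submodule.smul_mem _ _ ?_
        have hL : eval L (multisetProd t - eval (total t) (multisetProd t) • single (total t)) ≠ 0 :=
          Finsupp.mem_support_iff.1 hL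
        obtain ⟨s, rfl⟩ := total_surjective L
        classical
        rw [map_sub, map_smul, eval_single, smul_eq_mul] at hL
        refine ih _ ?_ s rfl
        by_contra hlt
        by_cases hst : s = t
        · rw [hst, if_pos rfl, mul_one, sub_self] at hL
          exact hL rfl
        · rw [eval_multisetProd_of_ne (not_lt.1 hlt) hst, zero_sub, neg_ne_zero] at hL
          -- Distinct multisets with the same total are not excluded in advance; here they would
          -- give `multisetProd t` both a zero and a nonzero value at that class.
          have heq : total t = total s := by
            by_contra hn
            rw [if_neg hn, mul_zero] at hL
            exact hL rfl
          rw [if_pos heq, mul_one, heq, eval_multisetProd_of_ne (not_lt.1 hlt) hst] at hL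
          exact hL rfl
      have h := W.smul_mem (eval (total t) (multisetProd t))⁻¹ (W.sub_mem ht hsum)
      rwa [sub_sub_cancel, inv_smul_smul₀ (eval_multisetProd_self t)] at h
  rw [eq_top_iff]
  intro f _
  rw [sum_single f]
  refine Submodule.sum_mem _ fun L _ => Submodule.smul_mem _ _ ?_
  obtain ⟨t, rfl⟩ := total_surjective L
  exact key _ t rfl

end HallAlg

/-! ### The antipode of an enveloping algebra. -/

namespace UniversalEnvelopingAlgebra

attribute [local instance 10000] LieRing.ofAssociativeRing

variable (R : Type*) {L : Type*} [CommRing R] [LieRing L] [LieAlgebra R L]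

/-- By the universal property, the lift of `L → S` followed by the inclusion of `S` is the identity.
Identities that define a subalgebra can thus be checked on `L`. -/
theorem subalgebra_eq_top (S : Subalgebra R (UniversalEnvelopingAlgebra R L))
    (h : ∀ x : L, ι R x ∈ S) : S = ⊤ := by
  let g : L →ₗ⁅R⁆ S :=
    { toFun := fun x => ⟨ι R x, h x⟩
      map_add' := fun x y => Subtype.ext (map_add (ι R) x y)
      map_smul' := fun c x => Subtype.ext (map_smul (ι R) c x)
      map_lie' := fun {x y} => Subtype.ext (LieHom.map_lie (ι R) x y) }
  have hg : S.val.comp (lift R g) = AlgHom.id R _ := by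
    refine hom_ext R (LieHom.ext fun x => ?_)
    exact congrArg Subtype.val (lift_ι_apply R g x)
  rw [eq_top_iff]
  intro u _
  rw [← AlgHom.id_apply (R := R) u, ← hg]
  exact (lift R g u).2

theorem comul_ι (x : L) : Coalgebra.comul (R := R) (ι R x) = ι R x ⊗ₜ[R] 1 + 1 ⊗ₜ[R] ι R x :=
  lift_diag_ι R L x

theorem counit_ι (x : L) : Coalgebra.counit (R := R) (ι R x) = 0 := lift_zero_ι R L x

/-- The antipode, as an antihomomorphism. -/
noncomputable def antipodeAlgHom (L : Type*) [LieRing L] [LieAlgebra R L] :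
    UniversalEnvelopingAlgebra R L →ₐ[R] (UniversalEnvelopingAlgebra R L)ᵐᵒᵖ :=
  lift R
    { toFun := fun x : L => MulOpposite.op (-ι R x)
      map_add' := fun x y => by rw [map_add, neg_add, MulOpposite.op_add]
      map_smul' := fun c x => by rw [map_smul, ← smul_neg, MulOpposite.op_smul, RingHom.id_apply]
      map_lie' := fun {x y} => by
        rw [LieHom.map_lie, LieRing.of_associative_ring_bracket, LieRing.of_associative_ring_bracket,
          ← MulOpposite.op_mul, ← MulOpposite.op_mul, ← MulOpposite.op_sub, neg_mul_neg, neg_mul_neg,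
          neg_sub] }

/-- The antipode. -/
noncomputable def antipode (L : Type*) [LieRing L] [LieAlgebra R L] :
    UniversalEnvelopingAlgebra R L →ₗ[R] UniversalEnvelopingAlgebra R L :=
  (MulOpposite.opLinearEquiv R).symm.toLinearMap ∘ₗ (antipodeAlgHom R L).toLinearMap

theorem antipode_ι (x : L) : antipode R L (ι R x) = -ι R x :=
  congrArg MulOpposite.unop (lift_ι_apply R _ x)

theorem antipode_one : antipode R L 1 = 1 :=
  congrArg MulOpposite.unop (map_one (antipodeAlgHom R L))

theorem antipode_mul (u v : UniversalEnvelopingAlgebra R L) :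
    antipode R L (u * v) = antipode R L v * antipode R L u :=
  congrArg MulOpposite.unop (map_mul (antipodeAlgHom R L) u v)

/-- The map `a ⊗ b ↦ S a * b`. -/
noncomputable def leftAntipode (L : Type*) [LieRing L] [LieAlgebra R L] :
    UniversalEnvelopingAlgebra R L ⊗[R] UniversalEnvelopingAlgebra R L →ₗ[R]
      UniversalEnvelopingAlgebra R L :=
  LinearMap.mul' R _ ∘ₗ (antipode R L).rTensor _

/-- The map `a ⊗ b ↦ a * S b`. -/
noncomputable def rightAntipode (L : Type*) [LieRing L] [LieAlgebra R L] :
    UniversalEnvelopingAlgebra R L ⊗[R] UniversalEnvelopingAlgebra R L →ₗ[R]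
      UniversalEnvelopingAlgebra R L :=
  LinearMap.mul' R _ ∘ₗ (antipode R L).lTensor _

theorem leftAntipode_tmul (a b : UniversalEnvelopingAlgebra R L) :
    leftAntipode R L (a ⊗ₜ b) = antipode R L a * b := rfl

theorem rightAntipode_tmul (a b : UniversalEnvelopingAlgebra R L) :
    rightAntipode R L (a ⊗ₜ b) = a * antipode R L b := rfl

/-- As the antipode reverses products, the value at `X * (c ⊗ d)` is S(c) · `leftAntipode X` · d,
and a scalar in the middle moves out. So the elements satisfying the antipode identity are closed
under multiplication. -/
theorem leftAntipode_mul {X : UniversalEnvelopingAlgebra R L ⊗[R] UniversalEnvelopingAlgebra R L}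
    {r : R} (hX : leftAntipode R L X = algebraMap R _ r)
    (Y : UniversalEnvelopingAlgebra R L ⊗[R] UniversalEnvelopingAlgebra R L) :
    leftAntipode R L (X * Y) = r • leftAntipode R L Y := by
  induction Y using TensorProduct.induction_on with
  | zero => simp
  | add Y Z hY hZ => rw [mul_add, map_add, map_add, smul_add, hY, hZ]
  | tmul c d =>
    have h : leftAntipode R L (X * c ⊗ₜ d) = antipode R L c * leftAntipode R L X * d := by
      clear hX
      induction X using TensorProduct.induction_on with
      | zero => simp
      | add Y Z hY hZ => rw [add_mul, map_add, map_add, hY, hZ, mul_add, add_mul]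
      | tmul a b =>
        rw [Algebra.TensorProduct.tmul_mul_tmul, leftAntipode_tmul, leftAntipode_tmul, antipode_mul]
        simp only [mul_assoc]
    rw [h, hX, leftAntipode_tmul, ← Algebra.commutes, mul_assoc, Algebra.smul_def]

theorem rightAntipode_mul (X : UniversalEnvelopingAlgebra R L ⊗[R] UniversalEnvelopingAlgebra R L)
    {Y : UniversalEnvelopingAlgebra R L ⊗[R] UniversalEnvelopingAlgebra R L}
    {r : R} (hY : rightAntipode R L Y = algebraMap R _ r) :
    rightAntipode R L (X * Y) = r • rightAntipode R L X := by
  induction X using TensorProduct.induction_on with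
  | zero => simp
  | add Y Z hY hZ => rw [add_mul, map_add, map_add, smul_add, hY, hZ]
  | tmul a b =>
    have h : rightAntipode R L (a ⊗ₜ b * Y) = a * rightAntipode R L Y * antipode R L b := by
      clear hY
      induction Y using TensorProduct.induction_on with
      | zero => simp
      | add Y Z hY hZ => rw [mul_add, map_add, map_add, hY, hZ, mul_add, add_mul]
      | tmul c d =>
        rw [Algebra.TensorProduct.tmul_mul_tmul, rightAntipode_tmul, rightAntipode_tmul,
          antipode_mul]
        simp only [mul_assoc]
    rw [h, hY, rightAntipode_tmul, ← Algebra.commutes, mul_assoc, Algebra.smul_def]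

theorem leftAntipode_comul (u : UniversalEnvelopingAlgebra R L) :
    leftAntipode R L (Coalgebra.comul (R := R) u) =
      algebraMap R _ (Coalgebra.counit (R := R) u) := by
  let S : Subalgebra R (UniversalEnvelopingAlgebra R L) :=
    { carrier := {u | leftAntipode R L (Coalgebra.comul (R := R) u) =
        algebraMap R _ (Coalgebra.counit (R := R) u)}
      mul_mem' := fun {u v} hu hv => by
        show leftAntipode R L _ = _
        rw [Bialgebra.comul_mul, leftAntipode_mul R hu, hv, Bialgebra.counit_mul, map_mul,
          Algebra.smul_def]
      add_mem' := fun {u v} hu hv => by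
        show leftAntipode R L _ = _
        rw [map_add, map_add, hu, hv, map_add, map_add]
      algebraMap_mem' := fun r => by
        show leftAntipode R L _ = _
        rw [Bialgebra.comul_algebraMap, Bialgebra.counit_algebraMap,
          Algebra.TensorProduct.algebraMap_apply, leftAntipode_tmul, mul_one,
          Algebra.algebraMap_eq_smul_one, map_smul, antipode_one] }
  have hS : S = ⊤ := subalgebra_eq_top R S fun x => by
    show leftAntipode R L _ = _
    rw [comul_ι, counit_ι, map_add, leftAntipode_tmul, leftAntipode_tmul, antipode_ι, antipode_one,
      mul_one, one_mul, neg_add_cancel, map_zero]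
  exact (hS ▸ Algebra.mem_top : u ∈ S)

theorem rightAntipode_comul (u : UniversalEnvelopingAlgebra R L) :
    rightAntipode R L (Coalgebra.comul (R := R) u) =
      algebraMap R _ (Coalgebra.counit (R := R) u) := by
  let S : Subalgebra R (UniversalEnvelopingAlgebra R L) :=
    { carrier := {u | rightAntipode R L (Coalgebra.comul (R := R) u) =
        algebraMap R _ (Coalgebra.counit (R := R) u)}
      mul_mem' := fun {u v} hu hv => by
        show rightAntipode R L _ = _
        rw [Bialgebra.comul_mul, rightAntipode_mul R _ hv, hu, Bialgebra.counit_mul, mul_comm,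
          map_mul, Algebra.smul_def]
      add_mem' := fun {u v} hu hv => by
        show rightAntipode R L _ = _
        rw [map_add, map_add, hu, hv, map_add, map_add]
      algebraMap_mem' := fun r => by
        show rightAntipode R L _ = _
        rw [Bialgebra.comul_algebraMap, Bialgebra.counit_algebraMap,
          Algebra.TensorProduct.algebraMap_apply, rightAntipode_tmul, antipode_one, mul_one] }
  have hS : S = ⊤ := subalgebra_eq_top R S fun x => by
    show rightAntipode R L _ = _
    rw [comul_ι, counit_ι, map_add, rightAntipode_tmul, rightAntipode_tmul, antipode_ι,
      antipode_one, mul_one, one_mul, add_neg_cancel, map_zero]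
  exact (hS ▸ Algebra.mem_top : u ∈ S)

noncomputable instance : HopfAlgebra R (UniversalEnvelopingAlgebra R L) where
  antipode := antipode R L
  mul_antipode_rTensor_comul := LinearMap.ext (leftAntipode_comul R)
  mul_antipode_lTensor_comul := LinearMap.ext (rightAntipode_comul R)

end UniversalEnvelopingAlgebra

/-! ### The Lie algebra of connected graphs and the enveloping algebra. -/

namespace HallAlg

open LFGClass ConnClass UniversalEnvelopingAlgebra

attribute [local instance 10000] LieRing.ofAssociativeRing

/-- The characteristic function of a connected graph, as a primitive element. -/
noncomputable def conn (c : ConnClass) : primitives := ⟨single c.conn, single_conn_mem c⟩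

theorem exists_sum_conn (p : primitives) :
    ∃ a : ConnClass →₀ ℚ, a.sum (fun c r => r • conn c) = p := by
  have h : p.1 ∈ Submodule.span ℚ (Set.range fun c => single (ConnClass.conn c)) := by
    rw [span_single_conn]
    exact p.2
  obtain ⟨a, ha⟩ := Finsupp.mem_span_range_iff_exists_finsupp.1 h
  refine ⟨a, Subtype.ext (Eq.trans ?_ ha)⟩
  exact map_finsuppSum primitives.toSubmodule.subtype a _

/-- The order of the automorphism group of an unlabeled graph. -/
noncomputable def autOrder : ConnClass → ℚ :=
  Quotient.lift (fun Γ : ConnLFG => autCard Γ.1) fun _ _ ⟨e⟩ =>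
    congrArg (Nat.cast : ℕ → ℚ) (PreGraph.Iso.card_congr ⟨e⟩ ⟨e⟩)

theorem autOrder_cls (Γ : ConnLFG) : autOrder Γ.cls = autCard Γ.1 := rfl

theorem autOrder_ne_zero (c : ConnClass) : autOrder c ≠ 0 := by
  obtain ⟨Γ, rfl⟩ := ConnLFG.cls_surjective c
  exact autCard_ne_zero Γ.1

/-- A connected graph corresponds to a multiple of its characteristic function. -/
noncomputable def graphMap : GraphSpace →ₗ[ℚ] primitives :=
  Finsupp.linearCombination ℚ fun c => autOrder c • conn c

theorem eval_graphMap (x : GraphSpace) (c : ConnClass) :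
    eval c.conn (graphMap x).1 = x c * autOrder c := by
  classical
  induction x using Finsupp.induction_linear with
  | zero =>
    rw [map_zero]
    exact (map_zero _).trans (zero_mul _).symm
  | add x y hx hy =>
    rw [map_add, Finsupp.add_apply, add_mul, ← hx, ← hy]
    exact map_add (eval c.conn) _ _
  | single d r =>
    rw [graphMap, Finsupp.linearCombination_single, Finsupp.single_apply]
    refine (map_smul (eval c.conn) r (autOrder d • single d.conn)).trans ?_
    rw [map_smul, eval_single]
    by_cases h : d = c
    · rw [h, if_pos rfl, if_pos rfl, smul_eq_mul, smul_eq_mul, mul_one]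
    · rw [if_neg h, if_neg fun h' => h (conn_injective h'), smul_zero, smul_zero, zero_mul]

theorem graphMap_bijective : Function.Bijective graphMap := by
  constructor
  · intro x y h
    ext c
    have hx := eval_graphMap x c
    rw [h, eval_graphMap] at hx
    exact (mul_right_cancel₀ (autOrder_ne_zero c) hx).symm
  · intro p
    obtain ⟨a, rfl⟩ := exists_sum_conn p
    refine ⟨a.sum fun c r => Finsupp.single c (r / autOrder c), ?_⟩
    rw [map_finsuppSum]
    refine Finsupp.sum_congr fun c _ => ?_
    rw [graphMap, Finsupp.linearCombination_single, smul_smul, div_mul_cancel₀ _ (autOrder_ne_zero c)]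

/-- The space of connected graphs is the space of primitive elements. -/
noncomputable def graphEquiv : GraphSpace ≃ₗ[ℚ] primitives :=
  LinearEquiv.ofBijective graphMap graphMap_bijective

theorem primitives_ext {p q : primitives} (h : ∀ c : ConnClass, eval c.conn p.1 = eval c.conn q.1) :
    p = q := by
  refine Subtype.ext (ext fun L => ?_)
  obtain ⟨hp, hp'⟩ := (isPrimitive_iff _).1 p.2
  obtain ⟨hq, hq'⟩ := (isPrimitive_iff _).1 q.2
  rcases zero_or_conn_or_add L with rfl | ⟨c, rfl⟩ | ⟨M, N, hM, hN, rfl⟩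
  · rw [hp, hq]
  · exact h c
  · rw [hp' M N hM hN, hq' M N hM hN]

theorem graphMap_basis (Γ : ConnLFG) :
    (graphMap Γ.basis).1 = autCard Γ.1 • single Γ.toLFG.cls := by
  rw [graphMap, ConnLFG.basis, Finsupp.linearCombination_single, one_smul]
  rfl

theorem eval_single_mul_single (M N : LFG) (L : LFGClass) :
    eval L (single M.cls * single N.cls) = splitSum (fun A B => M.delta A * N.delta B) L := rfl

/-- Primitive elements are determined by their values on connected graphs, and the factors |Aut| in
`graphMap` are those appearing in `insertionProduct_apply`. -/
theorem graphMap_lie (Γ₁ Γ₂ : ConnLFG) :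
    ⁅graphMap Γ₁.basis, graphMap Γ₂.basis⁆ =
      graphMap (insertionProduct insertionClosed Γ₁ Γ₂ -
        insertionProduct insertionClosed Γ₂ Γ₁) := by
  refine primitives_ext fun c => ?_
  obtain ⟨L, rfl⟩ := ConnLFG.cls_surjective c
  rw [eval_graphMap, Finsupp.sub_apply, sub_mul, autOrder_cls, insertionProduct_apply,
    insertionProduct_apply, LieSubalgebra.coe_bracket, LieRing.of_associative_ring_bracket,
    graphMap_basis, graphMap_basis, map_sub, conn_cls]
  simp only [smul_mul_assoc, mul_smul_comm, map_smul, smul_eq_mul, eval_single_mul_single]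
  ring

/-- The algebra homomorphism extending the inclusion of the primitive elements. -/
noncomputable def fromU : UniversalEnvelopingAlgebra ℚ primitives →ₐ[ℚ] HallAlg :=
  lift ℚ primitives.incl

theorem fromU_ι (p : primitives) : fromU (ι ℚ p) = p.1 := lift_ι_apply ℚ _ p

theorem ι_mem_span (p : primitives) :
    ι ℚ p ∈ Submodule.span ℚ (Set.range fun c => ι ℚ (conn c)) := by
  obtain ⟨a, rfl⟩ := exists_sum_conn p
  rw [map_finsuppSum]
  refine Submodule.sum_mem _ fun c _ => ?_
  dsimp only
  rw [map_smul]
  exact Submodule.smul_mem _ _ (Submodule.subset_span ⟨c, rfl⟩)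

theorem span_ι_prod : Submodule.span ℚ (Set.range fun s : Multiset ConnClass =>
    (s.toList.map fun c => ι ℚ (conn c)).prod) = ⊤ := by
  refine span_multiset_prod (fun c => ι ℚ (conn c)) (fun a b => ?_) ?_
  · rw [← LieRing.of_associative_ring_bracket, ← LieHom.map_lie]
    exact ι_mem_span _
  · exact subalgebra_eq_top ℚ _ fun p => Algebra.span_le_adjoin ℚ _ (ι_mem_span p)

theorem fromU_prod (s : Multiset ConnClass) :
    fromU (s.toList.map fun c => ι ℚ (conn c)).prod = multisetProd s := by
  rw [map_list_prod, List.map_map, multisetProd, listProd]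
  congr 1
  refine List.map_congr_left fun c _ => ?_
  exact fromU_ι (conn c)

/-- Ordered monomials in the δ_c span the enveloping algebra and are sent to a basis of the Hall
algebra, so the map is an isomorphism. Linear independence of the monomials in the enveloping
algebra is a consequence, not an input. -/
theorem fromU_bijective : Function.Bijective fromU := by
  constructor
  · rw [injective_iff_map_eq_zero]
    intro u hu
    have hmem : u ∈ Submodule.span ℚ (Set.range fun s : Multiset ConnClass =>
        (s.toList.map fun c => ι ℚ (conn c)).prod) := span_ι_prod ▸ Submodule.mem_top
    obtain ⟨a, rfl⟩ := Finsupp.mem_span_range_iff_exists_finsupp.1 hmem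
    rw [map_finsuppSum] at hu
    simp only [map_smul, fromU_prod] at hu
    have := linearIndependent_iff.1 linearIndependent_multisetProd a hu
    rw [this, Finsupp.sum_zero_index]
  · have h : Submodule.span ℚ (Set.range multisetProd) ≤ LinearMap.range fromU.toLinearMap := by
      rw [Submodule.span_le]
      rintro _ ⟨s, rfl⟩
      exact ⟨_, fromU_prod s⟩
    intro f
    exact h (span_multisetProd ▸ Submodule.mem_top)

/-- The Ringel-Hall algebra is an enveloping algebra. -/
noncomputable def equivU : HallSpace ≃ₗ[ℚ] UniversalEnvelopingAlgebra ℚ primitives :=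
  equiv.symm.trans (LinearEquiv.ofBijective fromU.toLinearMap fromU_bijective).symm

theorem equivU_symm_apply (u : UniversalEnvelopingAlgebra ℚ primitives) :
    equivU.symm u = equiv (fromU u) := rfl

theorem fromU_equivU (f : HallSpace) : fromU (equivU f) = equiv.symm f :=
  equivU.symm_apply_apply f

/-- It holds on primitive elements by definition, and the elements for which it holds form a
subalgebra. -/
theorem isComul_fromU (u : UniversalEnvelopingAlgebra ℚ primitives) :
    IsComul (fromU u) (Algebra.TensorProduct.map fromU fromU (Coalgebra.comul (R := ℚ) u)) := by
  let S : Subalgebra ℚ (UniversalEnvelopingAlgebra ℚ primitives) :=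
    { carrier := {u | IsComul (fromU u)
        (Algebra.TensorProduct.map fromU fromU (Coalgebra.comul (R := ℚ) u))}
      mul_mem' := fun {u v} hu hv => by
        show IsComul _ _
        rw [Bialgebra.comul_mul, map_mul, map_mul]
        exact IsComul.mul hu hv
      add_mem' := fun {u v} hu hv => by
        show IsComul _ _
        rw [map_add, map_add, map_add]
        exact IsComul.add hu hv
      algebraMap_mem' := fun r => by
        show IsComul _ _
        rw [Bialgebra.comul_algebraMap, AlgHom.commutes, AlgHom.commutes,
          Algebra.algebraMap_eq_smul_one, Algebra.algebraMap_eq_smul_one]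
        exact isComul_one.smul r }
  have hS : S = ⊤ := subalgebra_eq_top ℚ S fun p => by
    show IsComul _ _
    rw [comul_ι, map_add, Algebra.TensorProduct.map_tmul, Algebra.TensorProduct.map_tmul, map_one,
      fromU_ι]
    exact p.2
  exact (hS ▸ Algebra.mem_top : u ∈ S)

theorem evalPair_map (M N : LFGClass) (T : UniversalEnvelopingAlgebra ℚ primitives ⊗[ℚ]
    UniversalEnvelopingAlgebra ℚ primitives) :
    evalPair M N (TensorProduct.map equivU.symm.toLinearMap equivU.symm.toLinearMap T) =
      eval₂ M N (Algebra.TensorProduct.map fromU fromU T) := by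
  induction T using TensorProduct.induction_on with
  | zero => simp only [map_zero]
  | add S T hS hT => simp only [map_add, hS, hT]
  | tmul u v => rfl

end HallAlg

theorem mainTheorem2 :
    ∃ (hq : ∀ (Γ : LFG) (γ : Γ.1.Subgraph), (Γ.1.quotient γ).IsFeynman)
      (hs : ∀ Γ Γ' : LFG, (Γ.1.sum Γ'.1).IsFeynman)
      (hi : InsertionClosed)
      (n : Type 1) (_ : LieRing n) (_ : LieAlgebra ℚ n) (j : GraphSpace ≃ₗ[ℚ] n)
      (A : Type 1) (_ : Ring A) (_ : HopfAlgebra ℚ A) (φ : HallSpace ≃ₗ[ℚ] A),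
      -- `n` is the space of connected unlabeled graphs with the insertion bracket
      (∀ Γ₁ Γ₂ : ConnLFG,
        ⁅j Γ₁.basis, j Γ₂.basis⁆ = j (insertionProduct hi Γ₁ Γ₂ - insertionProduct hi Γ₂ Γ₁)) ∧
      -- `A` is the space of finitely supported functions with the convolution product
      (∀ (f g : HallSpace) (Γ : LFG),
        φ.symm (φ f * φ g) Γ.cls =
          ∑ᶠ γ : Γ.1.Subgraph,
            f (LFG.cls ⟨γ.toGraph, γ.2⟩) * g (LFG.cls ⟨Γ.1.quotient γ, hq Γ γ⟩)) ∧
      -- whose structure constants count short exact sequences,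
      (∀ M N L : LFG,
        φ.symm (φ M.delta * φ N.delta) L.cls =
          (Nat.card (LFG.ShortExact M L N) : ℚ)
            / (Nat.card (PreGraph.Iso M.1 M.1) * Nat.card (PreGraph.Iso N.1 N.1))) ∧
      -- and with the coproduct `Δ(f)(M, N) = f(M ⊕ N)`
      (∀ (f : HallSpace) (M N : LFG),
        evalPair M.cls N.cls
            (TensorProduct.map φ.symm.toLinearMap φ.symm.toLinearMap
              (Coalgebra.comul (R := ℚ) (φ f))) =
          f (LFG.cls ⟨M.1.sum N.1, hs M N⟩)) ∧
      Nonempty (A ≃ₐc[ℚ] UniversalEnvelopingAlgebra ℚ n) := by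
  have hmul : ∀ (f g : HallSpace) (L : LFGClass),
      HallAlg.equivU.symm (HallAlg.equivU f * HallAlg.equivU g) L =
        LFGClass.splitSum (fun A B => f A * g B) L := by
    intro f g L
    rw [HallAlg.equivU_symm_apply, map_mul, HallAlg.fromU_equivU, HallAlg.fromU_equivU]
    rfl
  -- `n` is the Lie algebra of primitive elements and `A` its enveloping algebra. The last
  -- isomorphism is therefore the identity, and the content lies in `equivU`, which identifies
  -- functions on classes with `A` compatibly with product and coproduct.
  refine ⟨fun Γ γ => γ.quotient_isFeynman Γ.2, fun Γ Γ' => PreGraph.sum_isFeynman Γ.2 Γ'.2,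
    insertionClosed, HallAlg.primitives, inferInstance, inferInstance, HallAlg.graphEquiv,
    UniversalEnvelopingAlgebra ℚ HallAlg.primitives, inferInstance, inferInstance, HallAlg.equivU,
    HallAlg.graphMap_lie, fun f g Γ => ?_, fun M N L => ?_, fun f M N => ?_,
    ⟨BialgEquiv.refl ℚ _⟩⟩
  · rw [hmul, finsum_eq_sum_of_fintype]
    rfl
  · rw [hmul, LFG.card_shortExact, LFGClass.card_fill, eq_div_iff, mul_comm]
    · rfl
    · exact mul_ne_zero (autCard_ne_zero M.1) (autCard_ne_zero N.1)
  · rw [HallAlg.evalPair_map, HallAlg.isComul_fromU, HallAlg.fromU_equivU]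
    rfl
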